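/- For $\Delta>0$ and $0<z<1$ let $\bar D_{\Delta\Delta\Delta\Delta}(z)$ be the one-dimensional reduced contact function $$\bar D_{\Delta\Delta\Delta\Delta}(z)=\Gamma(\Delta)^2\int_{\alpha,\beta,\gamma>0}d\alpha\,d\beta\,d\gamma\;\delta(\alpha+\beta+\gamma-1)\,\frac{(\alpha\beta\gamma)^{\Delta-1}}{\big(\alpha\gamma+\alpha\beta\,z^2+\beta\gamma\,(1-z)^2\big)^{\Delta}} .$$ Let $\Delta_\phi\ge 1$ be an integer. With $z=\frac{t}{1+t}$, define the reduced Mellin transform $$\hat M_{\Delta_\phi}(s)=\int_0^\infty dt\;\bar D_{\Delta_\phi\Delta_\phi\Delta_\phi\Delta_\phi}\big(\tfrac{t}{1+t}\big)\Big(\frac{t}{1+t}\Big)^{2\Delta_\phi}t^{-1-s},$$ and, with $(x)_n$ the rising factorial, $$P_{\Delta_\phi}(s)=2\sum_{n=0}^{\Delta_\phi-1}(-1)^n\frac{\Gamma(2n+1)\Gamma(\Delta_\phi)^4\Gamma(\Delta_\phi+n)}{\Gamma(n+1)^4\,\Gamma(\Delta_\phi-n)\,\Gamma(2(\Delta_\phi+n))}(2\Delta_\phi-s)_n(s)_n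 .$$ 1. The integral defining $\hat M_{\Delta_\phi}(s)$ converges absolutely for $0<\mathrm{Re}(s)<2\Delta_\phi$, and for every non-integer $s$ in this strip $$\hat M_{\Delta_\phi}(s)=\pi\csc(\pi s)\Big(\pi\cot(\pi s)\,P_{\Delta_\phi}(s)-\sum_{k=1}^{2\Delta_\phi-1}\frac{P_{\Delta_\phi}(k)}{s-k}\Big).$$ At the integers $m=1,\dots,2\Delta_\phi-1$ the poles of the right-hand side cancel: it tends to $\hat M_{\Delta_\phi}(m)$ as $s\to m$, $s\ne m$. 2. For all $s\in\mathbb C$, $$P_{\Delta_\phi}(s)=2\,\frac{\Gamma(\Delta_\phi)^4}{\Gamma(2\Delta_\phi)}\;{}_4F_3\big(\tfrac12,\,s,\,1-\Delta_\phi,\,2\Delta_\phi-s;\;1,\,1,\,\Delta_\phi+\tfrac12;\;1\big),$$ and $P_{\Delta_\phi}$ is a polynomial in $s$ of degree $2\Delta_\phi-2$. 3. Let $L\ge 0$ be an integer and let $$f^{(1)}_L(z)=N_L\,z^{2\Delta_\phi}\big(1+z^{2L}+(1-z)^{2L}\big)\bar D_{\Delta_\phi+L,\Delta_\phi+L,\Delta_\phi+L,\Delta_\phi+L}(z),\qquad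 N_L=\frac{4^{L-1}\pi^{-3/2}\,\Gamma(2\Delta_\phi-\frac12+2L)}{\Gamma(\Delta_\phi+\frac12)^4},$$ be the first-order (tree-level) correlator of the quartic contact interaction with $4L$ derivatives. For $0<\mathrm{Re}(s)<2\Delta_\phi$ its Mellin integral converges absolutely and $$\int_0^\infty dt\;f^{(1)}_L\big(\tfrac{t}{1+t}\big)\,t^{-1-s}=2N_L\sum_{k=0}^{2L}c_{k,L}\,\hat M_{\Delta_\phi+L}(s+k),\qquad 2c_{k,L}=\frac{\Gamma(2L+1)}{\Gamma(k+1)\Gamma(2L-k+1)}+\delta_{k,0}+\delta_{k,2L}.$$ -/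

import Mathlib

open Filter Topology MeasureTheory

noncomputable section

/-- The reduced function `D̄_{Δ₁Δ₂Δ₃Δ₄}(u, v)` as its Feynman parameter integral
`∫ dα dβ dγ δ(α+β+γ-1) α^(Δ₁-1) β^(Δ₂-1) γ^(Δ₃-1) Γ(Σ-Δ₄) Γ(Δ₄) / (αγ + αβ u + βγ v)^(Σ-Δ₄)`,
`Σ = (Δ₁+Δ₂+Δ₃+Δ₄)/2`. The delta function is used to eliminate `γ = 1 - α - β`, and
`p = (α, β)`. -/
def DbarUV (Δ₁ Δ₂ Δ₃ Δ₄ u v : ℝ) : ℝ :=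
  ∫ p in {p : ℝ × ℝ | 0 < p.1 ∧ 0 < p.2 ∧ p.1 + p.2 < 1},
    p.1 ^ (Δ₁ - 1) * p.2 ^ (Δ₂ - 1) * (1 - p.1 - p.2) ^ (Δ₃ - 1) *
      (Real.Gamma ((Δ₁ + Δ₂ + Δ₃ + Δ₄) / 2 - Δ₄) * Real.Gamma Δ₄ /
        (p.1 * (1 - p.1 - p.2) + p.1 * p.2 * u + p.2 * (1 - p.1 - p.2) * v) ^
          ((Δ₁ + Δ₂ + Δ₃ + Δ₄) / 2 - Δ₄))

/-- The one-dimensional, equal-weight function `D̄_{ΔΔΔΔ}(z)`: `u = z²`, `v = (1-z)²`. -/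
def Dbar (Δ : ℝ) (z : ℝ) : ℝ := DbarUV Δ Δ Δ Δ (z ^ 2) ((1 - z) ^ 2)

/-- `t ↦ D̄_{ΔΔΔΔ}(z) z^(2Δ)` at `z = t/(1+t)`. -/
def DbarIntegrand (Δ : ℕ) (t : ℝ) : ℂ :=
  ((Dbar Δ (t / (1 + t)) * (t / (1 + t)) ^ (2 * Δ) : ℝ) : ℂ)

/-- The reduced Mellin transform `M̂_Δ(s) = ∫₀^∞ D̄_{ΔΔΔΔ}(t) (t/(1+t))^(2Δ) t^(-1-s) dt`
(Mathlib's `mellin f w` is `∫₀^∞ t^(w-1) f(t) dt`). -/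
def Mhat (Δ : ℕ) (s : ℂ) : ℂ := mellin (DbarIntegrand Δ) (-s)

/-- `P_Δ(s)` as a finite sum; `(x)_n` is the rising factorial. -/
def PDelta (Δ : ℕ) (s : ℂ) : ℂ :=
  2 * ∑ n ∈ Finset.range Δ,
    (-1) ^ n *
      (Complex.Gamma (2 * n + 1) * Complex.Gamma Δ ^ 4 * Complex.Gamma (Δ + n) /
        (Complex.Gamma (n + 1) ^ 4 * Complex.Gamma (Δ - n) * Complex.Gamma (2 * (Δ + n)))) *
      (ascPochhammer ℂ n).eval (2 * Δ - s) * (ascPochhammer ℂ n).eval s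

/-- The (unregularized) generalized hypergeometric function with upper parameters `a` and lower
parameters `b`; Mathlib's function carries an extra factor `1 / ∏ Γ(bᵢ)`. -/
def hypergeometricF (a b : Multiset ℂ) (x : ℂ) : ℂ :=
  (b.map Complex.Gamma).prod * Complex.regularizedHGFun a b x

/-- `π csc(πs) (π cot(πs) P_Δ(s) - ∑_{k=1}^{2Δ-1} P_Δ(k)/(s-k))`. -/
def MhatClosed (Δ : ℕ) (s : ℂ) : ℂ :=
  Real.pi / Complex.sin (Real.pi * s) *
    (Real.pi * Complex.cot (Real.pi * s) * PDelta Δ s -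
      ∑ k ∈ Finset.Icc 1 (2 * Δ - 1), PDelta Δ k / (s - k))

/-- The normalization `4^(L-1) π^(-3/2) Γ(2Δ - 1/2 + 2L) / Γ(Δ + 1/2)^4`. -/
def contactNorm (Δ L : ℕ) : ℝ :=
  4 ^ ((L : ℝ) - 1) * Real.pi ^ (-(3 / 2) : ℝ) * Real.Gamma (2 * Δ - 1 / 2 + 2 * L) /
    Real.Gamma (Δ + 1 / 2) ^ 4

/-- The first-order correlator `f⁽¹⁾_L(z)` of the contact interaction with `4L` derivatives. -/
def contactCorrelator (Δ L : ℕ) (z : ℝ) : ℝ :=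
  contactNorm Δ L * z ^ (2 * Δ) * (1 + z ^ (2 * L) + (1 - z) ^ (2 * L)) * Dbar ((Δ + L : ℕ) : ℝ) z

/-- `c_{k,L}`, with `2 c_{k,L} = Γ(2L+1)/(Γ(k+1)Γ(2L-k+1)) + δ_{k,0} + δ_{k,2L}`. -/
def cCoeff (k L : ℕ) : ℝ :=
  (Real.Gamma (2 * L + 1) / (Real.Gamma (k + 1) * Real.Gamma (2 * L - k + 1)) +
    (if k = 0 then 1 else 0) + (if k = 2 * L then 1 else 0)) / 2

end

open Polynomial in
/-- The coefficients of the trigonometric sum `∑ᵢ aᵢ(ν) sin ((ν + N - 2i) θ)` obtained from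
`sin (ν θ)` by applying the operators `f ↦ sin · f' - (2 n + 1) cos · f` for `n < N`,
as polynomials in `ν`. -/
noncomputable def trigCoeff : ℕ → ℕ → Polynomial ℝ
  | 0, 0 => 1
  | 0, _ + 1 => 0
  | N + 1, 0 => C (1 / 2) * ((X - C ((N : ℝ) + 1)) * trigCoeff N 0)
  | N + 1, i + 1 => C (1 / 2) * ((X - C ((N : ℝ) + 3 + 2 * i)) * trigCoeff N (i + 1) -
      (X + C (3 * (N : ℝ) + 1 - 2 * i)) * trigCoeff N i)

lemma trigCoeff_eq_zero (N : ℕ) : ∀ i, N < i → trigCoeff N i = 0 := by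
  induction N with
  | zero =>
    intro i hi
    obtain ⟨j, rfl⟩ : ∃ j, i = j + 1 := ⟨i - 1, by omega⟩
    rfl
  | succ N ih =>
    intro i hi
    obtain ⟨j, rfl⟩ : ∃ j, i = j + 1 := ⟨i - 1, by omega⟩
    simp [trigCoeff, ih (j + 1) (by omega), ih j (by omega)]

/-- `binom(N, i) (ν + N)(ν + N - 1)⋯(ν + N - i + 1) · (ν - i - 1)⋯(ν - N)`. -/
noncomputable def trigProd (N i : ℕ) (ν : ℝ) : ℝ :=
  N.choose i * (descPochhammer ℝ i).eval (ν + N) * (descPochhammer ℝ (N - i)).eval (ν - i - 1)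

lemma descPochhammer_succ_eval_left (n : ℕ) (x : ℝ) :
    (descPochhammer ℝ (n + 1)).eval x = x * (descPochhammer ℝ n).eval (x - 1) := by
  rw [descPochhammer_succ_left]; simp [Polynomial.eval_comp]

lemma descPochhammer_shift (n : ℕ) (x : ℝ) :
    x * (descPochhammer ℝ n).eval (x - 1) = (descPochhammer ℝ n).eval x * (x - n) := by
  rw [← descPochhammer_succ_eval_left, descPochhammer_succ_eval]

lemma choose_succ_mul_real (N i : ℕ) :
    (N.choose (i + 1) : ℝ) * (i + 1) = N.choose i * (N - i) := by
  rcases le_or_gt i N with h | h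
  · have := Nat.choose_succ_right_eq N i
    have h2 : ((N - i : ℕ) : ℝ) = N - i := by push_cast [h]; ring
    rw [← h2]
    exact_mod_cast this
  · rw [Nat.choose_eq_zero_of_lt h, Nat.choose_eq_zero_of_lt (by omega)]; simp

lemma trigProd_eq_zero {N i : ℕ} (h : N < i) (ν : ℝ) : trigProd N i ν = 0 := by
  simp [trigProd, Nat.choose_eq_zero_of_lt h]

lemma trigProd_succ_zero (N : ℕ) (ν : ℝ) :
    trigProd (N + 1) 0 ν = (ν - (N + 1)) * trigProd N 0 ν := by
  simp [trigProd, descPochhammer_succ_eval]; ring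

lemma trigProd_succ_succ (N i : ℕ) (ν : ℝ) :
    trigProd (N + 1) (i + 1) ν =
      (ν - (N + 3 + 2 * i)) * trigProd N (i + 1) ν + (ν + (3 * N + 1 - 2 * i)) * trigProd N i ν := by
  rcases lt_trichotomy i N with h | h | h
  · obtain ⟨j, rfl⟩ : ∃ j, N = i + 1 + j := ⟨N - i - 1, by omega⟩
    have hr := choose_succ_mul_real (i + 1 + j) i
    have e1 : i + 1 + j + 1 - (i + 1) = j + 1 := by omega
    have e2 : i + 1 + j - (i + 1) = j := by omega
    have e3 : i + 1 + j - i = j + 1 := by omega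
    simp only [trigProd, e1, e2, e3, Nat.choose_succ_succ (i + 1 + j) i]
    rw [descPochhammer_succ_eval_left i (ν + ((i + 1 + j + 1 : ℕ) : ℝ)),
      descPochhammer_succ_eval i (ν + ((i + 1 + j : ℕ) : ℝ)),
      descPochhammer_succ_eval j (ν - ((i + 1 : ℕ) : ℝ) - 1),
      descPochhammer_succ_eval_left j (ν - (i : ℝ) - 1)]
    have a1 : ν + ((i + 1 + j + 1 : ℕ) : ℝ) - 1 = ν + ((i + 1 + j : ℕ) : ℝ) := by push_cast; ring
    have a2 : ν - ((i + 1 : ℕ) : ℝ) - 1 = ν - (i : ℝ) - 1 - 1 := by push_cast; ring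
    rw [a1, a2]
    generalize (descPochhammer ℝ i).eval (ν + ((i + 1 + j : ℕ) : ℝ)) = p
    generalize (descPochhammer ℝ j).eval (ν - (i : ℝ) - 1 - 1) = q
    generalize (Nat.choose (i + 1 + j) i) = c at *
    generalize (Nat.choose (i + 1 + j) (i + 1)) = d at *
    push_cast at hr ⊢
    linear_combination (3 * ν + (i + 1 + j) - 1 - 2 * i) * p * q * hr
  · subst h
    rw [trigProd_eq_zero (Nat.lt_succ_self i)]
    simp only [trigProd, Nat.choose_self, Nat.sub_self, descPochhammer_zero, Polynomial.eval_one]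
    rw [descPochhammer_succ_eval_left]
    have a1 : ν + ((i + 1 : ℕ) : ℝ) - 1 = ν + (i : ℝ) := by push_cast; ring
    rw [a1]; push_cast; ring
  · rw [trigProd_eq_zero h, trigProd_eq_zero (by omega), trigProd_eq_zero (by omega)]; simp

lemma trigCoeff_eval (N : ℕ) : ∀ (i : ℕ) (ν : ℝ),
    (trigCoeff N i).eval ν = (1 / 2) ^ N * (-1) ^ i * trigProd N i ν := by
  induction N with
  | zero =>
    intro i ν
    cases i with
    | zero => simp [trigCoeff, trigProd]
    | succ i => rw [trigProd_eq_zero (Nat.succ_pos i)]; simp [trigCoeff]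
  | succ N ih =>
    intro i ν
    cases i with
    | zero =>
      rw [trigProd_succ_zero]
      simp [trigCoeff, ih]; ring
    | succ i =>
      rw [trigProd_succ_succ]
      simp [trigCoeff, ih]; ring

/-! ### Moments of the coefficients -/

open Polynomial in
lemma natDegree_comp_X_add_one_sub_lt {q : ℝ[X]} (hq : 0 < q.natDegree) :
    (q.comp (X + 1) - q).natDegree < q.natDegree := by
  have hne : q ≠ 0 := by rintro rfl; simp at hq
  have hd : (q.comp (X + 1)).natDegree = q.natDegree := by
    rw [natDegree_comp, ← C_1, natDegree_X_add_C, mul_one]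
  have hl : (q.comp (X + 1)).leadingCoeff = q.leadingCoeff := by
    rw [leadingCoeff_comp (by rw [← C_1, natDegree_X_add_C]; exact one_ne_zero), ← C_1,
      leadingCoeff_X_add_C]; simp
  have hne' : q.comp (X + 1) ≠ 0 := by
    intro h; rw [h, leadingCoeff_zero] at hl; exact hne (leadingCoeff_eq_zero.mp hl.symm)
  have := degree_sub_lt_left (by rw [degree_eq_natDegree hne', degree_eq_natDegree hne, hd]) hne' hl
  rcases eq_or_ne (q.comp (X + 1) - q) 0 with h0 | h0
  · rw [h0]; simpa using hq
  · rw [← hd]; exact natDegree_lt_natDegree h0 this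

open Polynomial in
lemma sum_trigCoeff_succ (N : ℕ) (q : ℝ[X]) :
    ∑ i ∈ Finset.range (N + 2), C (q.eval (i : ℝ)) * trigCoeff (N + 1) i =
      C (1 / 2) * (-(X * ∑ i ∈ Finset.range (N + 1),
          C ((q.comp (X + 1) - q).eval (i : ℝ)) * trigCoeff N i) +
        ∑ i ∈ Finset.range (N + 1), C ((2 * X * (q.comp (X + 1) - q) - C ((N : ℝ) + 1) * q -
          C (3 * (N : ℝ) + 1) * q.comp (X + 1)).eval (i : ℝ)) * trigCoeff N i) := by
  have key : ∑ i ∈ Finset.range (N + 2), C (q.eval (i : ℝ)) * trigCoeff (N + 1) i =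
      C (1 / 2) * (∑ i ∈ Finset.range (N + 1),
          C (q.eval (i : ℝ)) * ((X - C ((N : ℝ) + 1 + 2 * i)) * trigCoeff N i) -
        ∑ i ∈ Finset.range (N + 1),
          C (q.eval ((i : ℝ) + 1)) * ((X + C (3 * (N : ℝ) + 1 - 2 * i)) * trigCoeff N i)) := by
    have h1 : ∑ i ∈ Finset.range (N + 1),
          C (q.eval (i : ℝ)) * ((X - C ((N : ℝ) + 1 + 2 * i)) * trigCoeff N i) =
        ∑ i ∈ Finset.range (N + 2),
          C (q.eval (i : ℝ)) * ((X - C ((N : ℝ) + 1 + 2 * i)) * trigCoeff N i) := by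
      rw [Finset.sum_range_succ _ (N + 1), trigCoeff_eq_zero N (N + 1) (Nat.lt_succ_self N)]
      simp
    rw [h1, Finset.sum_range_succ' _ (N + 1), Finset.sum_range_succ' _ (N + 1)]
    have h2 : ∀ i : ℕ, C (q.eval ((i + 1 : ℕ) : ℝ)) * trigCoeff (N + 1) (i + 1) =
        C (1 / 2) * (C (q.eval ((i + 1 : ℕ) : ℝ)) *
            ((X - C ((N : ℝ) + 1 + 2 * (i + 1 : ℕ))) * trigCoeff N (i + 1)) -
          C (q.eval ((i : ℝ) + 1)) * ((X + C (3 * (N : ℝ) + 1 - 2 * i)) * trigCoeff N i)) := by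
      intro i
      have e : ((N : ℝ) + 1 + 2 * (i + 1 : ℕ)) = N + 3 + 2 * i := by push_cast; ring
      rw [e]
      simp only [trigCoeff, Nat.cast_add, Nat.cast_one]
      ring
    rw [Finset.sum_congr rfl fun i _ => h2 i, ← Finset.mul_sum, Finset.sum_sub_distrib]
    have h3 : C (q.eval ((0 : ℕ) : ℝ)) * trigCoeff (N + 1) 0 = C (1 / 2) *
        (C (q.eval ((0 : ℕ) : ℝ)) *
          ((X - C ((N : ℝ) + 1 + 2 * (0 : ℕ))) * trigCoeff N 0)) := by
      simp only [trigCoeff, Nat.cast_zero, mul_zero, add_zero]; ring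
    rw [h3]; ring
  rw [key, Finset.mul_sum (a := X), ← Finset.sum_neg_distrib, ← Finset.sum_add_distrib,
    ← Finset.sum_sub_distrib]
  congr 1
  refine Finset.sum_congr rfl fun i _ => ?_
  simp only [eval_sub, eval_comp, eval_add, eval_X, eval_one, eval_mul, eval_C, eval_ofNat, C_add,
    C_sub, C_mul]
  ring

open Polynomial in
/-- The `q`-moment of the coefficients has degree at most `deg q`. -/
lemma natDegree_sum_trigCoeff_le (N : ℕ) : ∀ q : ℝ[X],
    (∑ i ∈ Finset.range (N + 1), C (q.eval (i : ℝ)) * trigCoeff N i).natDegree ≤ q.natDegree := by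
  induction N with
  | zero => intro q; simp [trigCoeff]
  | succ N ih =>
    intro q
    rw [sum_trigCoeff_succ]
    refine (natDegree_C_mul_le _ _).trans ?_
    have hc : (q.comp (X + 1)).natDegree ≤ q.natDegree := by
      rw [natDegree_comp, ← C_1, natDegree_X_add_C, mul_one]
    have hX : ∀ p : ℝ[X], p.natDegree < q.natDegree → (X * p).natDegree ≤ q.natDegree := fun p hp =>
      natDegree_mul_le.trans (by rw [natDegree_X]; omega)
    refine (natDegree_add_le_of_degree_le ?_ ((ih _).trans ?_))
    · rw [natDegree_neg]
      rcases Nat.eq_zero_or_pos q.natDegree with h | h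
      · obtain ⟨c, rfl⟩ := natDegree_eq_zero.mp h
        simp
      · exact hX _ ((ih _).trans_lt (natDegree_comp_X_add_one_sub_lt h))
    · refine (natDegree_sub_le_of_le (natDegree_sub_le_of_le (m := q.natDegree) ?_
        (natDegree_C_mul_le _ _)) ((natDegree_C_mul_le _ _).trans hc)).trans (by simp)
      rcases Nat.eq_zero_or_pos q.natDegree with h | h
      · obtain ⟨c, rfl⟩ := natDegree_eq_zero.mp h
        simp
      · rw [mul_assoc, ← C_ofNat]
        exact (natDegree_C_mul_le _ _).trans (hX _ (natDegree_comp_X_add_one_sub_lt h))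

open Polynomial in
lemma sum_pow_mul_coeff_trigCoeff (N : ℕ) (c : ℝ) {r p : ℕ} (h : r < p) :
    ∑ i ∈ Finset.range (N + 1), ((i : ℝ) - c) ^ r * (trigCoeff N i).coeff p = 0 := by
  have h1 := natDegree_sum_trigCoeff_le N ((X - C c) ^ r)
  have h2 : ((X - C c) ^ r : ℝ[X]).natDegree = r := by simp
  rw [h2] at h1
  have h3 := coeff_eq_zero_of_natDegree_lt (h1.trans_lt h)
  rw [finsetSum_coeff] at h3
  simpa only [coeff_C_mul, eval_pow, eval_sub, eval_X, eval_C] using h3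

lemma sum_sum_pow_mul_coeff_trigCoeff (N : ℕ) {p q e : ℕ} (h : e < p + q) :
    ∑ i ∈ Finset.range (N + 1), ∑ j ∈ Finset.range (N + 1),
      (trigCoeff N i).coeff p * (trigCoeff N j).coeff q * ((i : ℝ) + j - N) ^ e = 0 := by
  have h1 : ∀ i j : ℕ, (trigCoeff N i).coeff p * (trigCoeff N j).coeff q * ((i : ℝ) + j - N) ^ e =
      ∑ c ∈ Finset.range (e + 1), (((i : ℝ) - N / 2) ^ c * (trigCoeff N i).coeff p) *
        (((j : ℝ) - N / 2) ^ (e - c) * (trigCoeff N j).coeff q) * (e.choose c : ℝ) := by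
    intro i j
    rw [show (i : ℝ) + j - N = ((i : ℝ) - N / 2) + ((j : ℝ) - N / 2) by ring, add_pow,
      Finset.mul_sum]
    exact Finset.sum_congr rfl fun c _ => by ring
  simp_rw [h1]
  rw [Finset.sum_congr rfl fun i _ => Finset.sum_comm, Finset.sum_comm]
  refine Finset.sum_eq_zero fun c hc => ?_
  simp_rw [← Finset.sum_mul, ← Finset.mul_sum]
  rw [← Finset.sum_mul]
  rcases lt_or_ge c p with hcp | hcp
  · rw [sum_pow_mul_coeff_trigCoeff N _ hcp]; simp
  · have : e - c < q := by
      have := Finset.mem_range.mp hc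
      omega
    rw [sum_pow_mul_coeff_trigCoeff N _ this]; simp

/-- The polynomial part of `∑ aᵢ(ν) aⱼ(ν) / (ν + N - i - j)` vanishes. -/
lemma sum_trigCoeff_div_eq (N : ℕ) {ν : ℝ} (hν : ∀ m : ℤ, ν ≠ m) :
    ∑ i ∈ Finset.range (N + 1), ∑ j ∈ Finset.range (N + 1),
      (trigCoeff N i).eval ν * (trigCoeff N j).eval ν / (ν - ((i : ℝ) + j - N)) =
    ∑ i ∈ Finset.range (N + 1), ∑ j ∈ Finset.range (N + 1),
      (trigCoeff N i).eval ((i : ℝ) + j - N) * (trigCoeff N j).eval ((i : ℝ) + j - N) /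
        (ν - ((i : ℝ) + j - N)) := by
  set D : ℕ := 1 + ∑ i ∈ Finset.range (N + 1), (trigCoeff N i).natDegree with hD
  have hev : ∀ i ∈ Finset.range (N + 1), ∀ x : ℝ, (trigCoeff N i).eval x =
      ∑ p ∈ Finset.range D, (trigCoeff N i).coeff p * x ^ p := by
    intro i hi x
    apply Polynomial.eval_eq_sum_range'
    have := Finset.single_le_sum (f := fun i => (trigCoeff N i).natDegree)
      (fun _ _ => Nat.zero_le _) hi
    omega
  rw [← sub_eq_zero, ← Finset.sum_sub_distrib]
  simp_rw [← Finset.sum_sub_distrib]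
  have key : ∀ i ∈ Finset.range (N + 1), ∀ j ∈ Finset.range (N + 1),
      (trigCoeff N i).eval ν * (trigCoeff N j).eval ν / (ν - ((i : ℝ) + j - N)) -
      (trigCoeff N i).eval ((i : ℝ) + j - N) * (trigCoeff N j).eval ((i : ℝ) + j - N) /
        (ν - ((i : ℝ) + j - N)) =
      ∑ p ∈ Finset.range D, ∑ q ∈ Finset.range D, ∑ r ∈ Finset.range (p + q),
        ν ^ r * ((trigCoeff N i).coeff p * (trigCoeff N j).coeff q *
          ((i : ℝ) + j - N) ^ (p + q - 1 - r)) := by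
    intro i hi j hj
    have hne : ν - ((i : ℝ) + j - N) ≠ 0 := by
      have := hν ((i : ℤ) + j - N)
      push_cast at this
      exact sub_ne_zero.mpr this
    rw [← sub_div, div_eq_iff hne, hev i hi, hev i hi, hev j hj, hev j hj, Finset.sum_mul_sum,
      Finset.sum_mul_sum, ← Finset.sum_sub_distrib, Finset.sum_mul]
    refine Finset.sum_congr rfl fun p _ => ?_
    rw [← Finset.sum_sub_distrib, Finset.sum_mul]
    refine Finset.sum_congr rfl fun q _ => ?_
    have hg := geom_sum₂_mul ν ((i : ℝ) + j - N) (p + q)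
    have : ∑ r ∈ Finset.range (p + q), ν ^ r * ((trigCoeff N i).coeff p * (trigCoeff N j).coeff q *
          ((i : ℝ) + j - N) ^ (p + q - 1 - r)) =
        (trigCoeff N i).coeff p * (trigCoeff N j).coeff q *
          ∑ r ∈ Finset.range (p + q), ν ^ r * ((i : ℝ) + j - N) ^ (p + q - 1 - r) := by
      rw [Finset.mul_sum]
      exact Finset.sum_congr rfl fun r _ => by ring
    rw [this, mul_assoc _ _ (ν - _), hg, pow_add, pow_add]
    ring
  rw [Finset.sum_congr rfl fun i hi => Finset.sum_congr rfl fun j hj => key i hi j hj]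
  rw [Finset.sum_congr rfl fun i _ => Finset.sum_comm, Finset.sum_comm]
  refine Finset.sum_eq_zero fun p _ => ?_
  rw [Finset.sum_congr rfl fun i _ => Finset.sum_comm, Finset.sum_comm]
  refine Finset.sum_eq_zero fun q _ => ?_
  rw [Finset.sum_congr rfl fun i _ => Finset.sum_comm, Finset.sum_comm]
  refine Finset.sum_eq_zero fun r hr => ?_
  simp_rw [← Finset.mul_sum]
  rw [sum_sum_pow_mul_coeff_trigCoeff N (by have := Finset.mem_range.mp hr; omega), mul_zero]

/-! ### Values at integers -/

lemma descPochhammer_neg_shift (k : ℕ) (x : ℝ) :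
    (descPochhammer ℝ k).eval (-x - 1) = (-1) ^ k * (descPochhammer ℝ k).eval (x + k) := by
  induction k with
  | zero => simp
  | succ k ih =>
    rw [descPochhammer_succ_eval, ih, descPochhammer_succ_eval_left]
    rw [show x + ((k + 1 : ℕ) : ℝ) - 1 = x + k by push_cast; ring]
    push_cast; ring

lemma trigCoeff_eval_sub (N n i : ℕ) (hn : n ≤ 2 * N) (hi : i ≤ N) :
    (trigCoeff N i).eval ((n : ℝ) - N) =
      (1 / 2) ^ N * (-1) ^ N * N.factorial * (n.choose i * (2 * N - n).choose (N - i)) := by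
  rw [trigCoeff_eval, trigProd, sub_add_cancel, descPochhammer_eval_eq_descFactorial]
  have h1 : (n : ℝ) - N - i - 1 = -((N : ℝ) + i - n) - 1 := by ring
  have h2 : (N : ℝ) + i - n + ((N - i : ℕ) : ℝ) = ((2 * N - n : ℕ) : ℝ) := by
    push_cast [hi, hn]; ring
  rw [h1, descPochhammer_neg_shift, h2, descPochhammer_eval_eq_descFactorial,
    Nat.descFactorial_eq_factorial_mul_choose, Nat.descFactorial_eq_factorial_mul_choose]
  have h3 : (-1 : ℝ) ^ i * (-1) ^ (N - i) = (-1) ^ N := by rw [← pow_add]; congr 1; omega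
  have h4 : (N.choose i : ℝ) * i.factorial * (N - i).factorial = N.factorial := by
    exact_mod_cast Nat.choose_mul_factorial_mul_factorial hi
  rw [← h3, ← h4]; push_cast; ring

/-- The sum of squares of the coefficients. -/
noncomputable def trigNormSq (N : ℕ) (ν : ℝ) : ℝ :=
  ∑ i ∈ Finset.range (N + 1), (trigCoeff N i).eval ν ^ 2

lemma sum_trigCoeff_antidiagonal (N n : ℕ) (hn : n ≤ 2 * N) :
    ∑ i ∈ Finset.range (N + 1), ∑ j ∈ Finset.range (N + 1), (if i + j = n then
      (trigCoeff N i).eval ((n : ℝ) - N) * (trigCoeff N j).eval ((n : ℝ) - N) else 0) =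
    trigNormSq N ((n : ℝ) - N) := by
  refine Finset.sum_congr rfl fun i hi => ?_
  have hi' : i ≤ N := Nat.lt_succ_iff.mp (Finset.mem_range.mp hi)
  rcases le_or_gt i n with h1 | h1
  · rcases le_or_gt (n - i) N with h2 | h2
    · rw [Finset.sum_eq_single (n - i)]
      · rw [if_pos (by omega), trigCoeff_eval_sub N n i hn hi',
          trigCoeff_eval_sub N n (n - i) hn h2, Nat.choose_symm h1]
        have : (2 * N - n).choose (N - (n - i)) = (2 * N - n).choose (N - i) := by
          rw [← Nat.choose_symm (show N - i ≤ 2 * N - n by omega)]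
          congr 1; omega
        rw [this]; ring
      · intro j _ hj; rw [if_neg (by omega)]
      · intro h; exact absurd (Finset.mem_range.mpr (by omega)) h
    · rw [trigCoeff_eval_sub N n i hn hi', Nat.choose_eq_zero_of_lt (show 2 * N - n < N - i by omega)]
      simp
  · rw [trigCoeff_eval_sub N n i hn hi', Nat.choose_eq_zero_of_lt h1]
    simp

/-- Partial fraction expansion of `∑ aᵢ(ν) aⱼ(ν) / (ν + N - i - j)`. -/
lemma sum_trigCoeff_div_eq_sum_trigNormSq (N : ℕ) {ν : ℝ} (hν : ∀ m : ℤ, ν ≠ m) :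
    ∑ i ∈ Finset.range (N + 1), ∑ j ∈ Finset.range (N + 1),
      (trigCoeff N i).eval ν * (trigCoeff N j).eval ν / (ν - ((i : ℝ) + j - N)) =
    ∑ n ∈ Finset.range (2 * N + 1), trigNormSq N ((n : ℝ) - N) / (ν - ((n : ℝ) - N)) := by
  rw [sum_trigCoeff_div_eq N hν]
  have h1 : ∀ i ∈ Finset.range (N + 1), ∀ j ∈ Finset.range (N + 1),
      (trigCoeff N i).eval ((i : ℝ) + j - N) * (trigCoeff N j).eval ((i : ℝ) + j - N) /
        (ν - ((i : ℝ) + j - N)) =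
      ∑ n ∈ Finset.range (2 * N + 1), (if i + j = n then
        (trigCoeff N i).eval ((n : ℝ) - N) * (trigCoeff N j).eval ((n : ℝ) - N) else 0) /
          (ν - ((n : ℝ) - N)) := by
    intro i hi j hj
    rw [Finset.mem_range] at hi hj
    rw [Finset.sum_eq_single (i + j)]
    · simp
    · intro n _ hn; rw [if_neg (Ne.symm hn), zero_div]
    · intro h; exact absurd (Finset.mem_range.mpr (by omega)) h
  rw [Finset.sum_congr rfl fun i hi => Finset.sum_congr rfl fun j hj => h1 i hi j hj,
    Finset.sum_congr rfl fun i _ => Finset.sum_comm, Finset.sum_comm]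
  refine Finset.sum_congr rfl fun n hn => ?_
  simp_rw [← Finset.sum_div]
  rw [sum_trigCoeff_antidiagonal N n (by have := Finset.mem_range.mp hn; omega)]

/-! ### The difference equation -/

lemma trigProd_add_one (N i : ℕ) (hi : i ≤ N) (ν : ℝ) :
    trigProd N i (ν + 1) * (ν + N + 1 - i) * (ν - N) =
      trigProd N i ν * (ν + N + 1) * (ν - i) := by
  have h1 := descPochhammer_shift i (ν + N + 1)
  have h2 := descPochhammer_shift (N - i) (ν - i)
  rw [show ν + N + 1 - 1 = ν + N by ring] at h1
  push_cast [hi] at h2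
  simp only [trigProd]
  rw [show ν + 1 + N = ν + N + 1 by ring, show ν + 1 - i - 1 = ν - i by ring]
  rw [show ν - ↑i - (↑N - ↑i) = ν - N by ring] at h2
  linear_combination (-(N.choose i : ℝ) * (descPochhammer ℝ (N - i)).eval (ν - i) * (ν - N)) * h1 -
    (N.choose i : ℝ) * (ν + N + 1) * (descPochhammer ℝ i).eval (ν + N) * h2

lemma trigProd_succ_index (N i : ℕ) (hi : i ≤ N) (ν : ℝ) :
    trigProd N (i + 1) ν * (i + 1) * (ν - i - 1) = trigProd N i ν * (N - i) * (ν + N - i) := by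
  rcases hi.lt_or_eq with h | h
  · obtain ⟨j, rfl⟩ : ∃ j, N = i + 1 + j := ⟨N - i - 1, by omega⟩
    have hr := choose_succ_mul_real (i + 1 + j) i
    simp only [trigProd]
    rw [show i + 1 + j - (i + 1) = j by omega, show i + 1 + j - i = j + 1 by omega,
      descPochhammer_succ_eval i, descPochhammer_succ_eval_left j (ν - (i : ℝ) - 1)]
    have a2 : ν - ((i + 1 : ℕ) : ℝ) - 1 = ν - (i : ℝ) - 1 - 1 := by push_cast; ring
    rw [a2]
    linear_combination (descPochhammer ℝ i).eval (ν + ((i + 1 + j : ℕ) : ℝ)) *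
      (ν + ((i + 1 + j : ℕ) : ℝ) - i) * (descPochhammer ℝ j).eval (ν - (i : ℝ) - 1 - 1) *
      (ν - i - 1) * hr
  · subst h
    rw [trigProd_eq_zero (Nat.lt_succ_self i)]; ring

/-- The second-order difference operator annihilating the sum of squares of the coefficients. -/
noncomputable def wilsonOp (N : ℕ) (y : ℝ → ℝ) (ν : ℝ) : ℝ :=
  (N + 1 + ν) * (ν - N) ^ 2 * (y (ν + 1) - y ν) -
    (N + 1 - ν) * (ν + N) ^ 2 * (y (ν - 1) - y ν) - 2 * N * ν * y ν

lemma wilsonOp_sum (N : ℕ) {ι : Type*} (s : Finset ι) (f : ι → ℝ → ℝ) (ν : ℝ) :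
    wilsonOp N (fun x => ∑ i ∈ s, f i x) ν = ∑ i ∈ s, wilsonOp N (f i) ν := by
  simp only [wilsonOp, ← Finset.sum_sub_distrib, Finset.mul_sum]

/-- The certificate telescoping the difference operator on the squares of the coefficients. -/
noncomputable def wilsonCert (N i : ℕ) (ν : ℝ) : ℝ :=
  (trigProd N i ν * i / (ν + N + 1 - i)) ^ 2 *
    ((N + 1) * ((2 * ν - (N + 1)) * (ν + N + 1) - 2 * ν * i))

lemma wilsonOp_trigProd_sq (N i : ℕ) (hi : i ≤ N) {ν : ℝ} (hν : (N : ℝ) + 1 < ν) :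
    wilsonOp N (fun x => trigProd N i x ^ 2) ν = wilsonCert N (i + 1) ν - wilsonCert N i ν := by
  have hiN : (i : ℝ) ≤ N := by exact_mod_cast hi
  have hi0 : (0 : ℝ) ≤ i := Nat.cast_nonneg i
  have d1 : ν + N + 1 - i ≠ 0 := by linarith
  have d2 : ν - N ≠ 0 := by linarith
  have d3 : ν + N ≠ 0 := by linarith
  have d4 : ν - 1 - i ≠ 0 := by linarith
  have d5 : (i : ℝ) + 1 ≠ 0 := by linarith
  have d6 : ν + N - i ≠ 0 := by linarith
  have e1 : trigProd N i (ν + 1) =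
      trigProd N i ν * (ν + N + 1) * (ν - i) / ((ν + N + 1 - i) * (ν - N)) := by
    rw [eq_div_iff (mul_ne_zero d1 d2), ← trigProd_add_one N i hi]; ring
  have e2 : trigProd N i (ν - 1) =
      trigProd N i ν * (ν + N - i) * (ν - 1 - N) / ((ν + N) * (ν - 1 - i)) := by
    have := trigProd_add_one N i hi (ν - 1)
    rw [sub_add_cancel] at this
    rw [eq_div_iff (mul_ne_zero d3 d4)]
    linear_combination -this
  have e3 : trigProd N (i + 1) ν =
      trigProd N i ν * (N - i) * (ν + N - i) / ((i + 1) * (ν - 1 - i)) := by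
    rw [eq_div_iff (mul_ne_zero d5 d4), ← trigProd_succ_index N i hi]; ring
  have e4 : wilsonCert N (i + 1) ν = (trigProd N i ν * (N - i) / (ν - 1 - i)) ^ 2 *
      ((N + 1) * ((2 * ν - (N + 1)) * (ν + N + 1) - 2 * ν * (i + 1))) := by
    rw [wilsonCert, e3]
    congr 1
    · congr 1
      push_cast
      rw [show ν + N + 1 - (i + 1) = ν + N - i by ring]
      field_simp
    · push_cast; ring
  simp only [wilsonOp]
  rw [e4, e1, e2, wilsonCert]
  field_simp
  ring

lemma wilsonOp_sum_trigProd_sq_of_gt (N : ℕ) {ν : ℝ} (hν : (N : ℝ) + 1 < ν) :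
    wilsonOp N (fun x => ∑ i ∈ Finset.range (N + 1), trigProd N i x ^ 2) ν = 0 := by
  rw [wilsonOp_sum, Finset.sum_congr rfl fun i hi =>
    wilsonOp_trigProd_sq N i (Nat.lt_succ_iff.mp (Finset.mem_range.mp hi)) hν,
    Finset.sum_range_sub (fun i => wilsonCert N i ν)]
  simp [wilsonCert, trigProd_eq_zero (Nat.lt_succ_self N)]

lemma continuous_trigProd (N i : ℕ) : Continuous (trigProd N i) := by
  unfold trigProd
  have h1 := (descPochhammer ℝ i).continuous
  have h2 := (descPochhammer ℝ (N - i)).continuous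
  fun_prop

lemma wilsonOp_sum_trigProd_sq (N : ℕ) {ν : ℝ} (hν : (N : ℝ) + 1 ≤ ν) :
    wilsonOp N (fun x => ∑ i ∈ Finset.range (N + 1), trigProd N i x ^ 2) ν = 0 := by
  have hc : Continuous (wilsonOp N (fun x => ∑ i ∈ Finset.range (N + 1), trigProd N i x ^ 2)) := by
    unfold wilsonOp
    have := continuous_trigProd N
    fun_prop
  have h : Set.EqOn (wilsonOp N (fun x => ∑ i ∈ Finset.range (N + 1), trigProd N i x ^ 2))
      (fun _ => 0) (closure (Set.Ioi ((N : ℝ) + 1))) :=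
    Set.EqOn.closure (fun x hx => wilsonOp_sum_trigProd_sq_of_gt N hx) hc continuous_const
  rw [closure_Ioi] at h
  exact h hν

/-- The coefficients of `P_{N+1}` in the basis `(N + 1 - ν)ₙ (N + 1 + ν)ₙ`. -/
noncomputable def pCoeff (N n : ℕ) : ℝ :=
  2 * ((-1) ^ n * ((2 * n).factorial * N.factorial ^ 4 * (N + n).factorial /
    (n.factorial ^ 4 * (N - n).factorial * (2 * (N + n) + 1).factorial)))

lemma pCoeff_succ (N n : ℕ) (hn : n < N) :
    pCoeff N (n + 1) * ((n + 1) ^ 3 * (2 * N + 2 * n + 3)) =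
      pCoeff N n * ((2 * n + 1) * (n - N)) := by
  obtain ⟨j, rfl⟩ : ∃ j, N = n + 1 + j := ⟨N - n - 1, by omega⟩
  simp only [pCoeff]
  rw [show n + 1 + j - (n + 1) = j by omega, show n + 1 + j - n = j + 1 by omega,
    show 2 * (n + 1) = 2 * n + 1 + 1 by ring,
    show n + 1 + j + (n + 1) = n + 1 + j + n + 1 by ring,
    show 2 * (n + 1 + j + n + 1) + 1 = 2 * (n + 1 + j + n) + 1 + 1 + 1 by ring]
  simp only [Nat.factorial_succ (2 * n + 1), Nat.factorial_succ (2 * n), Nat.factorial_succ n,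
    Nat.factorial_succ j, Nat.factorial_succ (n + 1 + j + n),
    Nat.factorial_succ (2 * (n + 1 + j + n) + 1 + 1),
    Nat.factorial_succ (2 * (n + 1 + j + n) + 1)]
  have f1 : ((2 * n).factorial : ℝ) ≠ 0 := by positivity
  have f2 : (n.factorial : ℝ) ≠ 0 := by positivity
  have f3 : (j.factorial : ℝ) ≠ 0 := by positivity
  have f4 : ((n + 1 + j + n).factorial : ℝ) ≠ 0 := by positivity
  have f5 : ((2 * (n + 1 + j + n) + 1).factorial : ℝ) ≠ 0 := by positivity
  generalize ((2 * n).factorial) = a1 at *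
  generalize (n.factorial) = a2 at *
  generalize (j.factorial) = a3 at *
  generalize ((n + 1 + j + n).factorial) = a4 at *
  generalize ((2 * (n + 1 + j + n) + 1).factorial) = a5 at *
  push_cast
  field_simp
  ring

/-- `(N + 1 - ν)ₙ (N + 1 + ν)ₙ`. -/
noncomputable def wilsonBasis (N n : ℕ) (ν : ℝ) : ℝ :=
  (ascPochhammer ℝ n).eval (N + 1 - ν) * (ascPochhammer ℝ n).eval (N + 1 + ν)

lemma ascPochhammer_succ_eval_left' (n : ℕ) (x : ℝ) :
    (ascPochhammer ℝ (n + 1)).eval x = x * (ascPochhammer ℝ n).eval (x + 1) := by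
  rw [ascPochhammer_succ_left]; simp [Polynomial.eval_comp]

lemma wilsonBasis_succ (N n : ℕ) (ν : ℝ) :
    wilsonBasis N (n + 1) ν = wilsonBasis N n ν * ((N + 1 + n) ^ 2 - ν ^ 2) := by
  simp only [wilsonBasis, ascPochhammer_succ_eval]; ring

lemma wilsonOp_wilsonBasis_succ (N n : ℕ) (ν : ℝ) :
    wilsonOp N (wilsonBasis N (n + 1)) ν =
      ν * (2 * (2 * n + 3) * (n + 1 - N) * wilsonBasis N (n + 1) ν -
        2 * (n + 1) ^ 3 * (2 * N + 2 * n + 3) * wilsonBasis N n ν) := by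
  have h1 : wilsonBasis N (n + 1) (ν + 1) * (N + 1 + ν) =
      wilsonBasis N n ν * (N - ν) * ((N + 1 + ν + n) * (N + 1 + ν + n + 1)) := by
    have a := ascPochhammer_succ_eval_left' n (N + 1 - (ν + 1))
    have b := ascPochhammer_succ_eval_left' (n + 1) (N + 1 + ν)
    have c : (ascPochhammer ℝ (n + 1 + 1)).eval (N + 1 + ν) =
      (ascPochhammer ℝ n).eval (N + 1 + ν) * ((N + 1 + ν + n) * (N + 1 + ν + n + 1)) := by
      simp only [ascPochhammer_succ_eval]; push_cast; ring
    rw [show (N : ℝ) + 1 - (ν + 1) + 1 = N + 1 - ν by ring] at a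
    rw [show (N : ℝ) + 1 + ν + 1 = N + 1 + (ν + 1) by ring] at b
    simp only [wilsonBasis]
    rw [a]
    linear_combination (N - ν) * (ascPochhammer ℝ n).eval (N + 1 - ν) * (c - b)
  have h2 : wilsonBasis N (n + 1) (ν - 1) * (N + 1 - ν) =
      wilsonBasis N n ν * (N + ν) * ((N + 1 - ν + n) * (N + 1 - ν + n + 1)) := by
    have a := ascPochhammer_succ_eval_left' n (N + 1 + (ν - 1))
    have b := ascPochhammer_succ_eval_left' (n + 1) (N + 1 - ν)
    have c : (ascPochhammer ℝ (n + 1 + 1)).eval (N + 1 - ν) =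
      (ascPochhammer ℝ n).eval (N + 1 - ν) * ((N + 1 - ν + n) * (N + 1 - ν + n + 1)) := by
      simp only [ascPochhammer_succ_eval]; push_cast; ring
    rw [show (N : ℝ) + 1 + (ν - 1) + 1 = N + 1 + ν by ring] at a
    rw [show (N : ℝ) + 1 - ν + 1 = N + 1 - (ν - 1) by ring] at b
    simp only [wilsonBasis]
    rw [a]
    linear_combination (N + ν) * (ascPochhammer ℝ n).eval (N + 1 + ν) * (c - b)
  simp only [wilsonOp]
  rw [wilsonBasis_succ N n ν]
  have e : (N + 1 + ν) * (ν - N) ^ 2 *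
      (wilsonBasis N (n + 1) (ν + 1) - wilsonBasis N n ν * ((N + 1 + n) ^ 2 - ν ^ 2)) -
      (N + 1 - ν) * (ν + N) ^ 2 *
      (wilsonBasis N (n + 1) (ν - 1) - wilsonBasis N n ν * ((N + 1 + n) ^ 2 - ν ^ 2)) =
      (ν - N) ^ 2 * (wilsonBasis N n ν * (N - ν) * ((N + 1 + ν + n) * (N + 1 + ν + n + 1)) -
        (N + 1 + ν) * (wilsonBasis N n ν * ((N + 1 + n) ^ 2 - ν ^ 2))) -
      (ν + N) ^ 2 * (wilsonBasis N n ν * (N + ν) * ((N + 1 - ν + n) * (N + 1 - ν + n + 1)) -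
        (N + 1 - ν) * (wilsonBasis N n ν * ((N + 1 + n) ^ 2 - ν ^ 2))) := by
    linear_combination (ν - N) ^ 2 * h1 - (ν + N) ^ 2 * h2
  rw [e]; ring

lemma wilsonOp_sum_wilsonBasis (N : ℕ) (ν : ℝ) :
    wilsonOp N (fun x => ∑ n ∈ Finset.range (N + 1), pCoeff N n * wilsonBasis N n x) ν = 0 := by
  have h : ∀ k ≤ N, wilsonOp N
      (fun x => ∑ n ∈ Finset.range (k + 1), pCoeff N n * wilsonBasis N n x) ν =
      2 * ν * pCoeff N k * ((2 * k + 1) * (k - N)) * wilsonBasis N k ν := by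
    intro k
    induction k with
    | zero =>
      intro _
      simp [wilsonOp, wilsonBasis]; ring
    | succ k ih =>
      intro hk
      have ih' := ih (by omega)
      rw [wilsonOp_sum] at ih' ⊢
      rw [Finset.sum_range_succ, ih']
      have : wilsonOp N (fun x => pCoeff N (k + 1) * wilsonBasis N (k + 1) x) ν =
          pCoeff N (k + 1) * wilsonOp N (wilsonBasis N (k + 1)) ν := by
        simp only [wilsonOp]; ring
      rw [this, wilsonOp_wilsonBasis_succ]
      have hp := pCoeff_succ N k (by omega)
      push_cast
      linear_combination (-2 * ν * wilsonBasis N k ν) * hp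
  rw [h N le_rfl]; ring

lemma trigProd_sq_sum_at (N : ℕ) :
    ∑ i ∈ Finset.range (N + 1), trigProd N i ((N : ℝ) + 1) ^ 2 =
      (N.factorial : ℝ) ^ 2 * (2 * (2 * N + 1)).choose (2 * N + 1) / 2 := by
  have h1 : ∀ i ∈ Finset.range (N + 1), trigProd N i ((N : ℝ) + 1) ^ 2 =
      (N.factorial : ℝ) ^ 2 * ((2 * N + 1).choose i : ℝ) ^ 2 := by
    intro i hi
    have hi' : i ≤ N := Nat.lt_succ_iff.mp (Finset.mem_range.mp hi)
    rw [← mul_pow]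
    congr 1
    rw [trigProd, show (N : ℝ) + 1 + N = ((2 * N + 1 : ℕ) : ℝ) by push_cast; ring,
      show (N : ℝ) + 1 - i - 1 = ((N - i : ℕ) : ℝ) by push_cast [hi']; ring,
      descPochhammer_eval_eq_descFactorial, descPochhammer_eval_eq_descFactorial,
      Nat.descFactorial_self, Nat.descFactorial_eq_factorial_mul_choose]
    have h4 : (N.choose i : ℝ) * i.factorial * (N - i).factorial = N.factorial := by
      exact_mod_cast Nat.choose_mul_factorial_mul_factorial hi'
    rw [← h4]; push_cast; ring
  rw [Finset.sum_congr rfl h1, ← Finset.mul_sum]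
  have h2 : ∑ i ∈ Finset.range (2 * N + 2), ((2 * N + 1).choose i) ^ 2 =
      (2 * (2 * N + 1)).choose (2 * N + 1) := by
    simpa using Nat.sum_range_choose_sq (2 * N + 1)
  have h3 : ∑ i ∈ Finset.range (2 * N + 2), ((2 * N + 1).choose i) ^ 2 =
      2 * ∑ i ∈ Finset.range (N + 1), ((2 * N + 1).choose i) ^ 2 := by
    have h6 : ∑ i ∈ Finset.range (N + 1), ((2 * N + 1).choose (N + 1 + i)) ^ 2 =
        ∑ i ∈ Finset.range (N + 1), ((2 * N + 1).choose i) ^ 2 := by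
      rw [← Finset.sum_range_reflect (fun i => ((2 * N + 1).choose i) ^ 2) (N + 1)]
      refine Finset.sum_congr rfl fun i hi => ?_
      have hi' := Finset.mem_range.mp hi
      rw [← Nat.choose_symm (show N + 1 + i ≤ 2 * N + 1 by omega)]
      congr 2; omega
    rw [show 2 * N + 2 = (N + 1) + (N + 1) by ring, Finset.sum_range_add, h6]
    ring
  have h5 : (2 : ℝ) * ∑ i ∈ Finset.range (N + 1), ((2 * N + 1).choose i : ℝ) ^ 2 =
      ((2 * (2 * N + 1)).choose (2 * N + 1) : ℝ) := by
    rw [← h2, h3]; push_cast; ring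
  rw [← h5]; ring

/-- `P_{N+1}(N + 1 + ν)` for real arguments. -/
noncomputable def pReal (N : ℕ) (ν : ℝ) : ℝ :=
  ∑ n ∈ Finset.range (N + 1), pCoeff N n * wilsonBasis N n ν

lemma pReal_at (N : ℕ) : pReal N ((N : ℝ) + 1) = 2 * N.factorial ^ 4 / (2 * N + 1).factorial := by
  rw [pReal, Finset.sum_range_succ', Finset.sum_eq_zero, zero_add]
  · have : (N.factorial : ℝ) ≠ 0 := by positivity
    simp [pCoeff, wilsonBasis]; field_simp
  · intro n _
    simp [wilsonBasis, ascPochhammer_succ_eval_left']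

lemma wilsonOp_eq_zero_ext (N : ℕ) {y₁ y₂ : ℝ → ℝ}
    (h₁ : ∀ ν, (N : ℝ) + 1 ≤ ν → wilsonOp N y₁ ν = 0)
    (h₂ : ∀ ν, (N : ℝ) + 1 ≤ ν → wilsonOp N y₂ ν = 0)
    (h₀ : y₁ (N + 1) = y₂ (N + 1)) (j : ℕ) : y₁ (N + 1 + j) = y₂ (N + 1 + j) := by
  have key : ∀ j : ℕ, y₁ (N + 1 + j) = y₂ (N + 1 + j) ∧
      y₁ (N + 1 + (j + 1 : ℕ)) = y₂ (N + 1 + (j + 1 : ℕ)) := by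
    intro j
    induction j with
    | zero =>
      refine ⟨by simpa using h₀, ?_⟩
      have a := h₁ (N + 1) le_rfl
      have b := h₂ (N + 1) le_rfl
      simp only [wilsonOp] at a b
      have hne : ((N : ℝ) + 1 + (N + 1)) * ((N : ℝ) + 1 - N) ^ 2 ≠ 0 := by
        have : (0 : ℝ) ≤ N := Nat.cast_nonneg N
        have : ((N : ℝ) + 1 - N) = 1 := by ring
        rw [this]; positivity
      rw [zero_add, Nat.cast_one]
      refine mul_left_cancel₀ hne ?_
      rw [h₀] at a
      linear_combination a - b
    | succ j ih =>
      refine ⟨ih.2, ?_⟩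
      have hle : (N : ℝ) + 1 ≤ N + 1 + (j + 1 : ℕ) := by
        have : (0 : ℝ) ≤ ((j + 1 : ℕ) : ℝ) := Nat.cast_nonneg _
        linarith
      have a := h₁ _ hle
      have b := h₂ _ hle
      simp only [wilsonOp] at a b
      have e1 : (N : ℝ) + 1 + (j + 1 : ℕ) - 1 = N + 1 + j := by push_cast; ring
      have e2 : (N : ℝ) + 1 + (j + 1 : ℕ) + 1 = N + 1 + (j + 1 + 1 : ℕ) := by push_cast; ring
      rw [e1, e2, ih.1, ih.2] at a
      rw [e1, e2] at b
      have hne : ((N : ℝ) + 1 + (N + 1 + (j + 1 : ℕ))) * ((N : ℝ) + 1 + (j + 1 : ℕ) - N) ^ 2 ≠ 0 := by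
        rw [show (N : ℝ) + 1 + (j + 1 : ℕ) - N = 1 + (j + 1 : ℕ) by ring]
        positivity
      refine mul_left_cancel₀ hne ?_
      linear_combination a - b
  exact (key j).1

open Polynomial in
/-- `P_{N+1}` is proportional to the sum of squares of the coefficients. -/
lemma pReal_eq_trigNormSq (N : ℕ) (ν : ℝ) :
    pReal N ν = (4 * N.factorial ^ 2 * 4 ^ N /
      ((2 * N + 1).factorial * (2 * (2 * N + 1)).choose (2 * N + 1))) * trigNormSq N ν := by
  set κ : ℝ := (4 * N.factorial ^ 2 * 4 ^ N /
      ((2 * N + 1).factorial * (2 * (2 * N + 1)).choose (2 * N + 1))) with hκ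
  have hS : ∀ x, trigNormSq N x =
      (1 / 4) ^ N * ∑ i ∈ Finset.range (N + 1), trigProd N i x ^ 2 := by
    intro x
    rw [trigNormSq, Finset.mul_sum]
    refine Finset.sum_congr rfl fun i _ => ?_
    rw [trigCoeff_eval, mul_pow, mul_pow, ← pow_mul, ← pow_mul, mul_comm i 2, pow_mul (-1 : ℝ) 2 i,
      mul_comm N 2, pow_mul _ 2 N]
    norm_num
  have hp : ∃ p : ℝ[X], ∀ x, pReal N x = p.eval x := by
    refine ⟨∑ n ∈ Finset.range (N + 1), C (pCoeff N n) *
      (((ascPochhammer ℝ n).comp (C (N + 1 : ℝ) - X)) *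
        ((ascPochhammer ℝ n).comp (C (N + 1 : ℝ) + X))), fun x => ?_⟩
    simp [pReal, wilsonBasis, eval_finsetSum, eval_comp]
  have hq : ∃ q : ℝ[X], ∀ x, κ * trigNormSq N x = q.eval x := by
    refine ⟨C κ * ∑ i ∈ Finset.range (N + 1), trigCoeff N i ^ 2, fun x => ?_⟩
    simp [trigNormSq, eval_finsetSum]
  obtain ⟨p, hp⟩ := hp
  obtain ⟨q, hq⟩ := hq
  have hj : ∀ j : ℕ, pReal N (N + 1 + j) = κ * trigNormSq N (N + 1 + j) := by
    apply wilsonOp_eq_zero_ext N (y₁ := pReal N) (y₂ := fun x => κ * trigNormSq N x)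
    · intro x _; exact wilsonOp_sum_wilsonBasis N x
    · intro x hx
      have h := wilsonOp_sum_trigProd_sq N hx
      simp only [wilsonOp, hS] at h ⊢
      linear_combination κ * (1 / 4) ^ N * h
    · rw [pReal_at, hS, trigProd_sq_sum_at, hκ]
      have c : ((2 * (2 * N + 1)).choose (2 * N + 1) : ℝ) ≠ 0 := by
        exact_mod_cast (Nat.choose_pos (by omega)).ne'
      have : ((4 : ℝ) ^ N) * (1 / 4) ^ N = 1 := by rw [← mul_pow]; norm_num
      field_simp
      linear_combination -4 * this
  have hpq : p = q := by
    apply Polynomial.eq_of_infinite_eval_eq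
    refine Set.Infinite.mono (s := Set.range fun j : ℕ => (N : ℝ) + 1 + j) ?_
      (Set.infinite_range_of_injective fun a b hab => by simpa using hab)
    rintro _ ⟨j, rfl⟩
    simp only [Set.mem_ofPred_eq, ← hp, ← hq, hj]
  rw [hp, hq, hpq]

/-! ### One-dimensional integrals -/

lemma integrable_and_lintegral_ofReal {α : Type*} [MeasurableSpace α] {μ : Measure α} {f : α → ℝ}
    {c : ℝ} (hf : ∀ᵐ x ∂μ, 0 ≤ f x) (h : ∫ x, f x ∂μ = c) (hc : 0 < c) :
    Integrable f μ ∧ ∫⁻ x, ENNReal.ofReal (f x) ∂μ = ENNReal.ofReal c := by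
  have hi : Integrable f μ := by
    by_contra hn
    rw [integral_undef hn] at h
    exact hc.ne h
  exact ⟨hi, by rw [← h, ofReal_integral_eq_lintegral_ofReal hi hf]⟩

lemma lintegral_rpow_mul_exp {a r : ℝ} (ha : 0 < a) (hr : 0 < r) :
    ∫⁻ y in Set.Ioi (0 : ℝ), ENNReal.ofReal (y ^ (a - 1) * Real.exp (-(r * y))) =
      ENNReal.ofReal ((1 / r) ^ a * Real.Gamma a) := by
  refine (integrable_and_lintegral_ofReal ?_ (Real.integral_rpow_mul_exp_neg_mul_Ioi ha hr) ?_).2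
  · filter_upwards [ae_restrict_mem measurableSet_Ioi] with y hy
    have : (0 : ℝ) < y := hy
    positivity
  · have := Real.Gamma_pos_of_pos ha
    positivity

lemma lintegral_rpow_div_one_add {ν : ℝ} (h0 : 0 < ν) (h1 : ν < 1) :
    ∫⁻ τ in Set.Ioi (0 : ℝ), ENNReal.ofReal (τ ^ (-ν) / (1 + τ)) =
      ENNReal.ofReal (Real.pi / Real.sin (Real.pi * ν)) := by
  have e1 : ∀ τ ∈ Set.Ioi (0 : ℝ), ENNReal.ofReal (τ ^ (-ν) / (1 + τ)) =
      ∫⁻ y in Set.Ioi (0 : ℝ), ENNReal.ofReal (τ ^ (-ν) * Real.exp (-((1 + τ) * y))) := by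
    intro τ hτ
    have hτ' : (0 : ℝ) < τ := hτ
    have h := lintegral_rpow_mul_exp one_pos (show 0 < 1 + τ by linarith)
    simp only [sub_self, Real.rpow_zero, one_mul, Real.rpow_one, Real.Gamma_one, mul_one] at h
    simp_rw [ENNReal.ofReal_mul (Real.rpow_nonneg hτ'.le (-ν))]
    rw [lintegral_const_mul _ (by fun_prop), h, ← ENNReal.ofReal_mul (by positivity)]
    congr 1; ring
  rw [setLIntegral_congr_fun measurableSet_Ioi e1, lintegral_lintegral_swap (by fun_prop)]
  have e2 : ∀ y ∈ Set.Ioi (0 : ℝ),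
      ∫⁻ τ in Set.Ioi (0 : ℝ), ENNReal.ofReal (τ ^ (-ν) * Real.exp (-((1 + τ) * y))) =
      ENNReal.ofReal (Real.Gamma (1 - ν)) *
        ENNReal.ofReal (y ^ (ν - 1) * Real.exp (-(1 * y))) := by
    intro y hy
    have hy' : (0 : ℝ) < y := hy
    have h := lintegral_rpow_mul_exp (show 0 < 1 - ν by linarith) hy'
    have hG := Real.Gamma_pos_of_pos (show 0 < 1 - ν by linarith)
    have : ∀ τ : ℝ, ENNReal.ofReal (τ ^ (-ν) * Real.exp (-((1 + τ) * y))) =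
        ENNReal.ofReal (Real.exp (-y)) *
          ENNReal.ofReal (τ ^ (1 - ν - 1) * Real.exp (-(y * τ))) := by
      intro τ
      rw [← ENNReal.ofReal_mul (Real.exp_pos _).le, show 1 - ν - 1 = -ν by ring,
        show -((1 + τ) * y) = -y + -(y * τ) by ring, Real.exp_add]
      congr 1; ring
    simp_rw [this]
    rw [lintegral_const_mul _ (by fun_prop), h, ← ENNReal.ofReal_mul (Real.exp_pos _).le,
      ← ENNReal.ofReal_mul hG.le, one_div, Real.inv_rpow hy'.le, ← Real.rpow_neg hy'.le]
    congr 1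
    rw [show -(1 - ν) = ν - 1 by ring, one_mul]; ring
  rw [setLIntegral_congr_fun measurableSet_Ioi e2, lintegral_const_mul _ (by fun_prop),
    lintegral_rpow_mul_exp h0 one_pos, ← ENNReal.ofReal_mul
      (Real.Gamma_pos_of_pos (by linarith)).le]
  congr 1
  rw [← Real.Gamma_mul_Gamma_one_sub]; simp; ring

lemma integrableOn_rpow_div_one_add_pow {σ : ℝ} {m : ℕ} (h0 : 0 < σ) (h1 : σ < m) :
    IntegrableOn (fun τ : ℝ => τ ^ (σ - 1) / (1 + τ) ^ m) (Set.Ioi 0) := by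
  rw [← Set.Ioc_union_Ioi_eq_Ioi (zero_le_one' ℝ)]
  refine IntegrableOn.union ?_ ?_
  · have hi : IntegrableOn (fun τ : ℝ => τ ^ (σ - 1)) (Set.Ioc 0 1) := by
      rw [← intervalIntegrable_iff_integrableOn_Ioc_of_le zero_le_one]
      exact intervalIntegral.intervalIntegrable_rpow' (by linarith)
    refine hi.mono' (Measurable.aestronglyMeasurable (by fun_prop)) ?_
    filter_upwards [ae_restrict_mem measurableSet_Ioc] with τ hτ
    have hp := Real.rpow_nonneg hτ.1.le (σ - 1)
    have h1τ : (1 : ℝ) ≤ (1 + τ) ^ m := one_le_pow₀ (by linarith [hτ.1])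
    rw [Real.norm_of_nonneg (by positivity)]
    exact div_le_self hp h1τ
  · have hi : IntegrableOn (fun τ : ℝ => τ ^ (σ - 1 - m)) (Set.Ioi 1) :=
      integrableOn_Ioi_rpow_of_lt (by linarith) one_pos
    refine hi.mono' (Measurable.aestronglyMeasurable (by fun_prop)) ?_
    filter_upwards [ae_restrict_mem measurableSet_Ioi] with τ hτ
    have hτ0 : (0 : ℝ) < τ := lt_trans one_pos hτ
    have hp := Real.rpow_nonneg hτ0.le (σ - 1)
    rw [Real.norm_of_nonneg (by positivity), Real.rpow_sub hτ0 (σ - 1) m,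
      Real.rpow_natCast]
    gcongr
    linarith

lemma one_add_sq_mul_le {τ c : ℝ} (hc : c ≤ 1) :
    (1 + τ) ^ 2 * ((1 + c) / 2) ≤ 1 + 2 * τ * c + τ ^ 2 := by
  nlinarith [mul_nonneg (sub_nonneg.mpr hc) (sq_nonneg (1 - τ))]

lemma one_add_sq_mul_le_of_le {τ c θ : ℝ} (hc : c ≤ Real.cos θ) :
    (1 + τ) ^ 2 * ((1 + c) / 2) ≤ 1 + 2 * τ * Real.cos θ + τ ^ 2 :=
  le_trans (by gcongr) (one_add_sq_mul_le (Real.cos_le_one θ))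

lemma quad_pos {τ θ : ℝ} (hτ : 0 ≤ τ) (hc : -1 < Real.cos θ) :
    0 < 1 + 2 * τ * Real.cos θ + τ ^ 2 :=
  lt_of_lt_of_le (by have : 0 < 1 + Real.cos θ := by linarith
                     positivity) (one_add_sq_mul_le_of_le le_rfl)

/-- The Mellin transform `∫₀^∞ τ^(σ-1) (1 + 2 τ cos θ + τ²)^(-M) dτ`. -/
noncomputable def angInt (M : ℕ) (σ θ : ℝ) : ℝ :=
  ∫ τ in Set.Ioi (0 : ℝ), τ ^ (σ - 1) / (1 + 2 * τ * Real.cos θ + τ ^ 2) ^ M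

lemma rpow_div_quad_le {τ c θ : ℝ} (M : ℕ) (σ : ℝ) (hτ : 0 < τ) (hc1 : -1 < c)
    (hc : c ≤ Real.cos θ) :
    τ ^ (σ - 1) / (1 + 2 * τ * Real.cos θ + τ ^ 2) ^ M ≤
      (((1 + c) / 2) ^ M)⁻¹ * (τ ^ (σ - 1) / (1 + τ) ^ (2 * M)) := by
  have h1 : 0 < 1 + c := by linarith
  have hp := Real.rpow_nonneg hτ.le (σ - 1)
  have h2 : ((1 + τ) ^ 2 * ((1 + c) / 2)) ^ M ≤ (1 + 2 * τ * Real.cos θ + τ ^ 2) ^ M :=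
    pow_le_pow_left₀ (by positivity) (one_add_sq_mul_le_of_le hc) M
  calc _ ≤ τ ^ (σ - 1) / ((1 + τ) ^ 2 * ((1 + c) / 2)) ^ M := by gcongr
    _ = _ := by rw [mul_pow, ← pow_mul]; field_simp

lemma integrableOn_angInt {M : ℕ} {σ θ : ℝ} (h0 : 0 < σ) (h1 : σ < 2 * M)
    (hc : -1 < Real.cos θ) :
    IntegrableOn (fun τ : ℝ => τ ^ (σ - 1) / (1 + 2 * τ * Real.cos θ + τ ^ 2) ^ M)
      (Set.Ioi 0) := by
  have hi := (integrableOn_rpow_div_one_add_pow (m := 2 * M) h0 (by push_cast; exact h1)).const_mul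
    (((1 + Real.cos θ) / 2) ^ M)⁻¹
  refine hi.mono' (Measurable.aestronglyMeasurable (by fun_prop)) ?_
  filter_upwards [ae_restrict_mem measurableSet_Ioi] with τ hτ
  have hτ' : (0 : ℝ) < τ := hτ
  have hq := quad_pos hτ'.le hc
  rw [Real.norm_of_nonneg (by positivity)]
  exact rpow_div_quad_le M σ hτ' hc le_rfl

lemma hasDerivAt_angInt {M : ℕ} {σ θ : ℝ} (h0 : 0 < σ) (h1 : σ < 2 * M) (hc : -1 < Real.cos θ) :
    HasDerivAt (angInt M σ) (2 * M * Real.sin θ * angInt (M + 1) (σ + 1) θ) θ := by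
  set c : ℝ := (Real.cos θ - 1) / 2 with hcdef
  have hc1 : -1 < c := by rw [hcdef]; linarith
  have hc2 : c < Real.cos θ := by rw [hcdef]; linarith
  have hs : {x : ℝ | c < Real.cos x} ∈ 𝓝 θ :=
    (isOpen_lt continuous_const Real.continuous_cos).mem_nhds hc2
  have hi := (integrableOn_rpow_div_one_add_pow (σ := σ + 1) (m := 2 * (M + 1)) (by linarith)
    (by push_cast; linarith)).const_mul (2 * M * (((1 + c) / 2) ^ (M + 1))⁻¹)
  have main := hasDerivAt_integral_of_dominated_loc_of_deriv_le (μ := volume.restrict (Set.Ioi 0))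
    (F := fun x τ => τ ^ (σ - 1) / (1 + 2 * τ * Real.cos x + τ ^ 2) ^ M)
    (F' := fun x τ => 2 * M * Real.sin x *
      (τ ^ (σ + 1 - 1) / (1 + 2 * τ * Real.cos x + τ ^ 2) ^ (M + 1)))
    hs (Eventually.of_forall fun x => Measurable.aestronglyMeasurable (by fun_prop))
    (integrableOn_angInt h0 h1 hc) (Measurable.aestronglyMeasurable (by fun_prop)) ?_ hi ?_
  · have := main.2
    rw [integral_const_mul] at this
    exact this
  · filter_upwards [ae_restrict_mem measurableSet_Ioi] with τ hτ x hx
    have hτ' : (0 : ℝ) < τ := hτ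
    have hx' : c < Real.cos x := hx
    have hq := quad_pos hτ'.le (hc1.trans hx')
    rw [norm_mul, norm_mul, Real.norm_of_nonneg (show (0 : ℝ) ≤ 2 * M by positivity),
      Real.norm_of_nonneg (show 0 ≤ τ ^ (σ + 1 - 1) /
        (1 + 2 * τ * Real.cos x + τ ^ 2) ^ (M + 1) by positivity), mul_assoc (2 * (M : ℝ)) _⁻¹]
    have hsin : ‖Real.sin x‖ ≤ 1 := by rw [Real.norm_eq_abs]; exact Real.abs_sin_le_one x
    have hb := rpow_div_quad_le (M + 1) (σ + 1) hτ' hc1 hx'.le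
    calc 2 * (M : ℝ) * ‖Real.sin x‖ * (τ ^ (σ + 1 - 1) /
          (1 + 2 * τ * Real.cos x + τ ^ 2) ^ (M + 1))
        ≤ 2 * (M : ℝ) * 1 * (τ ^ (σ + 1 - 1) /
          (1 + 2 * τ * Real.cos x + τ ^ 2) ^ (M + 1)) := by gcongr
      _ ≤ _ := by rw [mul_one]; gcongr
  · filter_upwards [ae_restrict_mem measurableSet_Ioi] with τ hτ x hx
    have hτ' : (0 : ℝ) < τ := hτ
    have hx' : c < Real.cos x := hx
    have hq := quad_pos hτ'.le (hc1.trans hx')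
    have hd : HasDerivAt (fun x => 1 + 2 * τ * Real.cos x + τ ^ 2) (2 * τ * -Real.sin x) x :=
      (((Real.hasDerivAt_cos x).const_mul (2 * τ)).const_add 1).add_const _
    have h2 := ((hd.pow M).fun_inv (pow_ne_zero M hq.ne')).const_mul (τ ^ (σ - 1))
    simp only [← div_eq_mul_inv] at h2
    refine h2.congr_deriv ?_
    rw [show σ + 1 - 1 = σ - 1 + 1 by ring, Real.rpow_add hτ', Real.rpow_one]
    cases M with
    | zero => simp
    | succ k =>
      simp only [Pi.pow_apply, Nat.add_sub_cancel]
      field_simp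
      ring

/-! ### The case of exponent one -/

lemma normSq_exp_add (θ τ : ℝ) :
    Complex.normSq (Complex.exp (-(θ * Complex.I)) + τ) = 1 + 2 * τ * Real.cos θ + τ ^ 2 := by
  have h : Complex.exp (-(θ * Complex.I)) + τ =
      ((Real.cos θ + τ : ℝ) : ℂ) + ((-Real.sin θ : ℝ) : ℂ) * Complex.I := by
    rw [← neg_mul, Complex.exp_mul_I, Complex.cos_neg, Complex.sin_neg]
    push_cast; ring
  rw [h, Complex.normSq_add_mul_I]
  linear_combination Real.sin_sq_add_cos_sq θ

lemma mul_one_add_le_norm {θ τ c : ℝ} (hc : c ≤ Real.cos θ) (hc1 : -1 < c) :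
    √((1 + c) / 2) * (1 + τ) ≤ ‖Complex.exp (-(θ * Complex.I)) + τ‖ := by
  rw [Complex.norm_def, normSq_exp_add]
  apply Real.le_sqrt_of_sq_le
  rw [mul_pow, Real.sq_sqrt (by linarith), mul_comm]
  exact one_add_sq_mul_le_of_le hc

/-- The Mellin transform of `1 / (e^(-iθ) + τ)`. -/
noncomputable def poleInt (ν θ : ℝ) : ℂ :=
  ∫ τ in Set.Ioi (0 : ℝ), ((τ ^ (-ν) : ℝ) : ℂ) * (Complex.exp (-(θ * Complex.I)) + τ)⁻¹

lemma integrableOn_poleInt {ν θ c : ℝ} (h0 : 0 < ν) (h1 : ν < 1) (hc1 : -1 < c)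
    (hc : c ≤ Real.cos θ) :
    IntegrableOn (fun τ : ℝ => ((τ ^ (-ν) : ℝ) : ℂ) * (Complex.exp (-(θ * Complex.I)) + τ)⁻¹)
      (Set.Ioi 0) := by
  have hi := (integrableOn_rpow_div_one_add_pow (σ := 1 - ν) (m := 1) (by linarith)
    (by push_cast; linarith)).const_mul (√((1 + c) / 2))⁻¹
  refine hi.mono' (Measurable.aestronglyMeasurable (by fun_prop)) ?_
  filter_upwards [ae_restrict_mem measurableSet_Ioi] with τ hτ
  have hτ' : (0 : ℝ) < τ := hτ
  have hs : 0 < √((1 + c) / 2) := Real.sqrt_pos.mpr (by linarith)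
  have hp := Real.rpow_nonneg hτ'.le (-ν)
  have hn := mul_one_add_le_norm (τ := τ) hc hc1
  rw [norm_mul, norm_inv, Complex.norm_real, Real.norm_of_nonneg hp,
    show 1 - ν - 1 = -ν by ring, pow_one]
  calc τ ^ (-ν) * ‖Complex.exp (-(θ * Complex.I)) + τ‖⁻¹
      ≤ τ ^ (-ν) * (√((1 + c) / 2) * (1 + τ))⁻¹ := by gcongr
    _ = _ := by field_simp

lemma hasDerivAt_poleInt {ν θ : ℝ} (h0 : 0 < ν) (h1 : ν < 1) (hc : -1 < Real.cos θ) :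
    HasDerivAt (poleInt ν) (ν * Complex.I * poleInt ν θ) θ := by
  set c : ℝ := (Real.cos θ - 1) / 2 with hcdef
  have hc1 : -1 < c := by rw [hcdef]; linarith
  have hc2 : c < Real.cos θ := by rw [hcdef]; linarith
  have hs : {x : ℝ | c < Real.cos x} ∈ 𝓝 θ :=
    (isOpen_lt continuous_const Real.continuous_cos).mem_nhds hc2
  have hsq : 0 < √((1 + c) / 2) := Real.sqrt_pos.mpr (by linarith)
  have hi := (integrableOn_rpow_div_one_add_pow (σ := 1 - ν) (m := 2) (by linarith)
    (by push_cast; linarith)).const_mul (√((1 + c) / 2) ^ 2)⁻¹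
  have hne : ∀ x τ : ℝ, c < Real.cos x → 0 < τ → Complex.exp (-(x * Complex.I)) + τ ≠ 0 := by
    intro x τ hx hτ h
    have := mul_one_add_le_norm (τ := τ) hx.le hc1
    rw [h, norm_zero] at this
    have : 0 < √((1 + c) / 2) * (1 + τ) := by positivity
    linarith
  have main := hasDerivAt_integral_of_dominated_loc_of_deriv_le (μ := volume.restrict (Set.Ioi 0))
    (F := fun (x : ℝ) (τ : ℝ) => ((τ ^ (-ν) : ℝ) : ℂ) * (Complex.exp (-(x * Complex.I)) + τ)⁻¹)
    (F' := fun (x : ℝ) (τ : ℝ) => ((τ ^ (-ν) : ℝ) : ℂ) *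
      (Complex.I * Complex.exp (-(x * Complex.I)) / (Complex.exp (-(x * Complex.I)) + τ) ^ 2))
    hs (Eventually.of_forall fun x => Measurable.aestronglyMeasurable (by fun_prop))
    (integrableOn_poleInt h0 h1 hc1 hc2.le) (Measurable.aestronglyMeasurable (by fun_prop))
    ?_ hi ?_
  · refine main.2.congr_deriv ?_
    have hF' := main.1
    have hF := integrableOn_poleInt h0 h1 hc1 hc2.le
    have hibp : ∫ τ in Set.Ioi (0 : ℝ), (((τ ^ (-ν) : ℝ) : ℂ) *
          (Complex.I * Complex.exp (-(θ * Complex.I)) / (Complex.exp (-(θ * Complex.I)) + τ) ^ 2) -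
        ν * Complex.I *
          (((τ ^ (-ν) : ℝ) : ℂ) * (Complex.exp (-(θ * Complex.I)) + τ)⁻¹)) = 0 := by
      have := integral_Ioi_of_hasDerivAt_of_tendsto (a := (0 : ℝ)) (m := (0 : ℂ))
        (f := fun τ : ℝ => Complex.I * (((τ ^ (1 - ν) : ℝ) : ℂ) *
          (Complex.exp (-(θ * Complex.I)) + τ)⁻¹))
        (f' := fun τ : ℝ => (((τ ^ (-ν) : ℝ) : ℂ) *
          (Complex.I * Complex.exp (-(θ * Complex.I)) / (Complex.exp (-(θ * Complex.I)) + τ) ^ 2) -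
        ν * Complex.I *
          (((τ ^ (-ν) : ℝ) : ℂ) * (Complex.exp (-(θ * Complex.I)) + τ)⁻¹)))
        ?_ ?_ (by exact hF'.sub (hF.const_mul (ν * Complex.I))) ?_
      · rw [this]; simp [Real.zero_rpow (show 1 - ν ≠ 0 by linarith)]
      · refine ContinuousAt.continuousWithinAt ?_
        refine continuousAt_const.mul (ContinuousAt.mul ?_ (ContinuousAt.inv₀ ?_ ?_))
        · exact Complex.continuous_ofReal.continuousAt.comp
            (Real.continuousAt_rpow_const _ _ (Or.inr (by linarith)))
        · fun_prop
        · simp [Complex.exp_ne_zero]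
      · intro τ hτ
        have hτ' : (0 : ℝ) < τ := hτ
        have hn := hne θ τ hc2 hτ'
        have d1 := (Real.hasDerivAt_rpow_const (p := 1 - ν) (Or.inl hτ'.ne')).ofReal_comp
        have d2 : HasDerivAt (fun τ : ℝ => Complex.exp (-(θ * Complex.I)) + (τ : ℂ)) 1 τ :=
          (Complex.ofRealCLM.hasDerivAt).const_add _
        refine ((d1.mul (d2.fun_inv hn)).const_mul Complex.I).congr_deriv ?_
        have e1 : τ ^ (1 - ν) = τ ^ (-ν) * τ := by
          rw [show 1 - ν = -ν + 1 by ring, Real.rpow_add hτ', Real.rpow_one]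
        rw [show 1 - ν - 1 = -ν by ring, e1]
        push_cast
        field_simp
        ring
      · have hz : Tendsto (fun τ : ℝ => (√((1 + c) / 2))⁻¹ * τ ^ (-ν)) atTop (𝓝 0) := by
          simpa using (tendsto_rpow_neg_atTop h0).const_mul (√((1 + c) / 2))⁻¹
        refine squeeze_zero_norm' ?_ hz
        filter_upwards [eventually_gt_atTop 0] with τ hτ
        have hn := mul_one_add_le_norm (τ := τ) hc2.le hc1
        have e1 : τ ^ (1 - ν) = τ ^ (-ν) * τ := by
          rw [show 1 - ν = -ν + 1 by ring, Real.rpow_add hτ, Real.rpow_one]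
        have hp := Real.rpow_nonneg hτ.le (-ν)
        rw [norm_mul, norm_mul, norm_inv, Complex.norm_I, one_mul, Complex.norm_real,
          Real.norm_of_nonneg (Real.rpow_nonneg hτ.le _), e1]
        calc τ ^ (-ν) * τ * ‖Complex.exp (-(θ * Complex.I)) + τ‖⁻¹
            ≤ τ ^ (-ν) * τ * (√((1 + c) / 2) * τ)⁻¹ := by
              gcongr
              refine le_trans ?_ hn
              gcongr; linarith
          _ = _ := by field_simp
    rw [integral_sub hF' (hF.const_mul _), integral_const_mul, sub_eq_zero] at hibp
    exact hibp
  · filter_upwards [ae_restrict_mem measurableSet_Ioi] with τ hτ x hx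
    have hτ' : (0 : ℝ) < τ := hτ
    have hn := mul_one_add_le_norm (τ := τ) (le_of_lt hx) hc1
    have hp := Real.rpow_nonneg hτ'.le (-ν)
    have hexp : ‖Complex.exp (-(x * Complex.I))‖ = 1 := by
      rw [← neg_mul, ← Complex.ofReal_neg]; exact Complex.norm_exp_ofReal_mul_I _
    rw [norm_mul, norm_div, norm_mul, norm_pow, hexp, Complex.norm_I, one_mul, Complex.norm_real,
      Real.norm_of_nonneg hp, show 1 - ν - 1 = -ν by ring]
    calc τ ^ (-ν) * (1 / ‖Complex.exp (-(x * Complex.I)) + τ‖ ^ 2)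
        ≤ τ ^ (-ν) * (1 / (√((1 + c) / 2) * (1 + τ)) ^ 2) := by gcongr
      _ = _ := by rw [mul_pow]; field_simp
  · filter_upwards [ae_restrict_mem measurableSet_Ioi] with τ hτ x hx
    have hn := hne x τ hx hτ
    have d0 : HasDerivAt (fun x : ℝ => -((x : ℂ) * Complex.I)) (-(1 * Complex.I)) x :=
      ((Complex.ofRealCLM.hasDerivAt).mul_const Complex.I).neg
    have d1 := (d0.cexp.add_const (τ : ℂ)).fun_inv hn
    refine (d1.const_mul ((τ ^ (-ν) : ℝ) : ℂ)).congr_deriv ?_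
    ring

lemma poleInt_zero {ν : ℝ} (h0 : 0 < ν) (h1 : ν < 1) :
    poleInt ν 0 = ((Real.pi / Real.sin (Real.pi * ν) : ℝ) : ℂ) := by
  have hsin : 0 < Real.sin (Real.pi * ν) :=
    Real.sin_pos_of_pos_of_lt_pi (by positivity) (by nlinarith [Real.pi_pos])
  have e : poleInt ν 0 = ∫ τ in Set.Ioi (0 : ℝ), ((τ ^ (-ν) / (1 + τ) : ℝ) : ℂ) := by
    refine setIntegral_congr_fun measurableSet_Ioi fun τ _ => ?_
    simp [div_eq_mul_inv]
  rw [e, integral_complex_ofReal]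
  congr 1
  rw [integral_eq_lintegral_of_nonneg_ae ?_ (Measurable.aestronglyMeasurable (by fun_prop)),
    lintegral_rpow_div_one_add h0 h1, ENNReal.toReal_ofReal (by positivity)]
  filter_upwards [ae_restrict_mem measurableSet_Ioi] with τ hτ
  have : (0 : ℝ) < τ := hτ
  simp only [Pi.zero_apply]
  positivity

lemma neg_one_lt_cos {θ : ℝ} (h0 : 0 ≤ θ) (h1 : θ < Real.pi) : -1 < Real.cos θ := by
  rw [← Real.cos_pi]
  exact Real.cos_lt_cos_of_nonneg_of_le_pi h0 le_rfl h1

lemma poleInt_eq {ν θ : ℝ} (h0 : 0 < ν) (h1 : ν < 1) (hθ0 : 0 ≤ θ) (hθ1 : θ < Real.pi) :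
    poleInt ν θ = ((Real.pi / Real.sin (Real.pi * ν) : ℝ) : ℂ) *
      Complex.exp ((ν * θ : ℝ) * Complex.I) := by
  have hd : ∀ x ∈ Set.Icc 0 θ, HasDerivAt
      (fun x : ℝ => poleInt ν x * Complex.exp (-((ν * x : ℝ) * Complex.I))) 0 x := by
    intro x hx
    have d1 := hasDerivAt_poleInt h0 h1 (neg_one_lt_cos hx.1 (hx.2.trans_lt hθ1))
    have d0 : HasDerivAt (fun x : ℝ => -(((ν * x : ℝ) : ℂ) * Complex.I))
        (-(((ν * 1 : ℝ) : ℂ) * Complex.I)) x :=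
      ((((hasDerivAt_id x).const_mul ν).ofReal_comp).mul_const Complex.I).neg
    refine (d1.mul d0.cexp).congr_deriv ?_
    push_cast; ring
  have := constant_of_has_deriv_right_zero (fun x hx => (hd x hx).continuousAt.continuousWithinAt)
    (fun x hx => (hd x ⟨hx.1, hx.2.le⟩).hasDerivWithinAt) θ ⟨hθ0, le_rfl⟩
  rw [poleInt_zero h0 h1] at this
  simp only [mul_zero, Complex.ofReal_zero, zero_mul, neg_zero, Complex.exp_zero, mul_one] at this
  rw [← this, mul_assoc, ← Complex.exp_add]
  simp

lemma sin_mul_angInt_one {ν θ : ℝ} (h0 : 0 < ν) (h1 : ν < 1) (hθ0 : 0 ≤ θ) (hθ1 : θ < Real.pi) :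
    Real.sin θ * angInt 1 (1 - ν) θ = Real.pi / Real.sin (Real.pi * ν) * Real.sin (ν * θ) := by
  have hint := integrableOn_poleInt h0 h1 (neg_one_lt_cos hθ0 hθ1) le_rfl
  have him : (poleInt ν θ).im = ∫ τ in Set.Ioi (0 : ℝ),
      (((τ ^ (-ν) : ℝ) : ℂ) * (Complex.exp (-(θ * Complex.I)) + τ)⁻¹).im :=
    (Complex.imCLM.integral_comp_comm hint).symm
  have e : ∀ τ ∈ Set.Ioi (0 : ℝ),
      (((τ ^ (-ν) : ℝ) : ℂ) * (Complex.exp (-(θ * Complex.I)) + τ)⁻¹).im =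
      Real.sin θ * (τ ^ (1 - ν - 1) / (1 + 2 * τ * Real.cos θ + τ ^ 2) ^ 1) := by
    intro τ _
    rw [Complex.im_ofReal_mul, Complex.inv_im, normSq_exp_add, show 1 - ν - 1 = -ν by ring, pow_one,
      ← neg_mul, ← Complex.ofReal_neg, Complex.add_im, Complex.exp_ofReal_mul_I_im,
      Complex.ofReal_im, Real.sin_neg]
    ring
  rw [setIntegral_congr_fun measurableSet_Ioi e, integral_const_mul] at him
  rw [angInt, ← him, poleInt_eq h0 h1 hθ0 hθ1, Complex.im_ofReal_mul, Complex.exp_ofReal_mul_I_im]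

/-! ### The trigonometric sums -/

/-- `∑ᵢ aᵢ(ν) sin ((ν + N - 2i) θ)`. -/
noncomputable def trigSum (N : ℕ) (ν θ : ℝ) : ℝ :=
  ∑ i ∈ Finset.range (N + 1), (trigCoeff N i).eval ν * Real.sin ((ν + N - 2 * i) * θ)

lemma trigSum_succ (N : ℕ) (ν θ : ℝ) :
    trigSum (N + 1) ν θ =
      Real.sin θ * (∑ i ∈ Finset.range (N + 1), (trigCoeff N i).eval ν *
        ((ν + N - 2 * i) * Real.cos ((ν + N - 2 * i) * θ))) -
      (2 * N + 1) * Real.cos θ * trigSum N ν θ := by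
  have key : trigSum (N + 1) ν θ =
      1 / 2 * (∑ i ∈ Finset.range (N + 1), (ν - (N + 1 + 2 * i)) * (trigCoeff N i).eval ν *
          Real.sin ((ν + N + 1 - 2 * i) * θ) -
        ∑ i ∈ Finset.range (N + 1), (ν + (3 * N + 1 - 2 * i)) * (trigCoeff N i).eval ν *
          Real.sin ((ν + N - 1 - 2 * i) * θ)) := by
    have h1 : ∑ i ∈ Finset.range (N + 1), (ν - (N + 1 + 2 * i)) * (trigCoeff N i).eval ν *
          Real.sin ((ν + N + 1 - 2 * i) * θ) =
        ∑ i ∈ Finset.range (N + 2), (ν - (N + 1 + 2 * i)) * (trigCoeff N i).eval ν *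
          Real.sin ((ν + N + 1 - 2 * i) * θ) := by
      rw [Finset.sum_range_succ _ (N + 1), trigCoeff_eq_zero N (N + 1) (Nat.lt_succ_self N)]
      simp
    rw [h1, trigSum, Finset.sum_range_succ' _ (N + 1), Finset.sum_range_succ' _ (N + 1)]
    have h2 : ∀ i : ℕ, (trigCoeff (N + 1) (i + 1)).eval ν *
        Real.sin ((ν + (N + 1 : ℕ) - 2 * (i + 1 : ℕ)) * θ) =
        1 / 2 * ((ν - (N + 1 + 2 * (i + 1 : ℕ))) * (trigCoeff N (i + 1)).eval ν *
            Real.sin ((ν + N + 1 - 2 * (i + 1 : ℕ)) * θ) -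
          (ν + (3 * N + 1 - 2 * i)) * (trigCoeff N i).eval ν *
            Real.sin ((ν + N - 1 - 2 * i) * θ)) := by
      intro i
      rw [show (ν + (N + 1 : ℕ) - 2 * (i + 1 : ℕ)) = ν + N - 1 - 2 * i by push_cast; ring,
        show (ν + N + 1 - 2 * (i + 1 : ℕ)) = ν + N - 1 - 2 * i by push_cast; ring]
      simp only [trigCoeff, Polynomial.eval_mul, Polynomial.eval_sub, Polynomial.eval_add,
        Polynomial.eval_C, Polynomial.eval_X]
      push_cast; ring
    rw [Finset.sum_congr rfl fun i _ => h2 i, ← Finset.mul_sum, Finset.sum_sub_distrib]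
    simp only [trigCoeff, Polynomial.eval_mul, Polynomial.eval_sub, Polynomial.eval_C,
      Polynomial.eval_X]
    push_cast
    rw [show (ν + ((N : ℝ) + 1) - 2 * 0) = ν + N + 1 - 2 * 0 by ring]
    ring
  rw [key, ← Finset.sum_sub_distrib, trigSum, Finset.mul_sum, Finset.mul_sum, Finset.mul_sum,
    ← Finset.sum_sub_distrib]
  refine Finset.sum_congr rfl fun i _ => ?_
  rw [show (ν + N + 1 - 2 * i) * θ = (ν + N - 2 * i) * θ + θ by ring,
    show (ν + N - 1 - 2 * i) * θ = (ν + N - 2 * i) * θ - θ by ring, Real.sin_add, Real.sin_sub]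
  ring

lemma sin_pow_mul_angInt {ν : ℝ} (h0 : 0 < ν) (h1 : ν < 1) (N : ℕ) :
    ∀ θ ∈ Set.Ioo 0 Real.pi, Real.sin θ ^ (2 * N + 1) * angInt (N + 1) (N + 1 - ν) θ =
      Real.pi / Real.sin (Real.pi * ν) / (2 ^ N * N.factorial) * trigSum N ν θ := by
  induction N with
  | zero =>
    intro θ hθ
    have := sin_mul_angInt_one h0 h1 hθ.1.le hθ.2
    simpa [trigSum, trigCoeff] using this
  | succ N ih =>
    intro θ hθ
    set K : ℝ := Real.pi / Real.sin (Real.pi * ν) / (2 ^ N * N.factorial) with hK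
    have hs : 0 < Real.sin θ := Real.sin_pos_of_pos_of_lt_pi hθ.1 hθ.2
    have heq : angInt (N + 1) (N + 1 - ν) =ᶠ[𝓝 θ]
        fun x => K * trigSum N ν x / Real.sin x ^ (2 * N + 1) := by
      filter_upwards [isOpen_Ioo.mem_nhds hθ] with x hx
      have hx' : 0 < Real.sin x := Real.sin_pos_of_pos_of_lt_pi hx.1 hx.2
      rw [eq_div_iff (by positivity), ← ih x hx]; ring
    have d1 := hasDerivAt_angInt (M := N + 1) (σ := N + 1 - ν) (θ := θ)
      (by have : (0 : ℝ) ≤ N := Nat.cast_nonneg N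
          linarith)
      (by have : (0 : ℝ) ≤ N := Nat.cast_nonneg N
          push_cast; linarith) (neg_one_lt_cos hθ.1.le hθ.2)
    have d2 : HasDerivAt (trigSum N ν) (∑ i ∈ Finset.range (N + 1), (trigCoeff N i).eval ν *
        ((ν + N - 2 * i) * Real.cos ((ν + N - 2 * i) * θ))) θ := by
      unfold trigSum
      refine HasDerivAt.fun_sum fun i _ => ?_
      refine (((hasDerivAt_id θ).const_mul (ν + N - 2 * i)).sin.const_mul _).congr_deriv ?_
      simp only [id]; ring
    have d3 := ((d2.const_mul K).div ((Real.hasDerivAt_sin θ).pow (2 * N + 1))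
      (by simp only [Pi.pow_apply]; positivity))
    have hu := d1.unique (d3.congr_of_eventuallyEq heq)
    rw [trigSum_succ]
    simp only [Pi.pow_apply, Nat.add_sub_cancel] at hu
    rw [show 2 * (N + 1) + 1 = 2 * N + 1 + 2 by ring, Nat.factorial_succ]
    have e1 : ((N + 1 : ℕ) : ℝ) + 1 - ν = N + 1 - ν + 1 := by push_cast; ring
    rw [e1]
    generalize angInt (N + 1 + 1) (N + 1 - ν + 1) θ = A at hu ⊢
    rw [eq_div_iff (by positivity)] at hu
    have e2 : Real.pi / Real.sin (Real.pi * ν) / (2 ^ (N + 1) * ((N + 1) * N.factorial : ℕ)) =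
        K / (2 * (N + 1)) := by
      rw [hK]; push_cast; field_simp; ring
    rw [e2, div_mul_eq_mul_div, eq_div_iff (by positivity)]
    have hsn : Real.sin θ ^ (2 * N) ≠ 0 := by positivity
    refine mul_left_cancel₀ hsn ?_
    push_cast at hu
    have e3 : Real.sin θ ^ (2 * N + 1) = Real.sin θ ^ (2 * N) * Real.sin θ := pow_succ _ _
    rw [e3] at hu
    rw [show 2 * N + 1 + 2 = 2 * N + 3 by ring, pow_add]
    linear_combination hu

lemma sin_freq (N i : ℕ) (ν : ℝ) :
    Real.sin ((ν + N - 2 * i) * Real.pi) = (-1) ^ N * Real.sin (Real.pi * ν) := by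
  rw [show (ν + N - 2 * i) * Real.pi = (ν * Real.pi + N * Real.pi) - i * (2 * Real.pi) by ring,
    Real.sin_sub_nat_mul_two_pi, Real.sin_add_nat_mul_pi, mul_comm ν]

lemma cos_freq (N i : ℕ) (ν : ℝ) :
    Real.cos ((ν + N - 2 * i) * Real.pi) = (-1) ^ N * Real.cos (Real.pi * ν) := by
  rw [show (ν + N - 2 * i) * Real.pi = (ν * Real.pi + N * Real.pi) - i * (2 * Real.pi) by ring,
    Real.cos_sub_nat_mul_two_pi, Real.cos_add_nat_mul_pi, mul_comm ν]

lemma integral_sin_mul_sin_reflect (N i j : ℕ) {ν : ℝ} (hν : ∀ m : ℤ, ν ≠ m) :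
    ∫ θ in (0 : ℝ)..Real.pi, Real.sin ((ν + N - 2 * i) * θ) *
      Real.sin ((ν + N - 2 * j) * (Real.pi - θ)) =
    1 / 2 * (-1) ^ N * (Real.sin (Real.pi * ν) / (ν - ((i : ℝ) + j - N)) -
      if i = j then Real.pi * Real.cos (Real.pi * ν) else 0) := by
  have hne : ν - ((i : ℝ) + j - N) ≠ 0 := by
    have := hν ((i : ℤ) + j - N)
    push_cast at this
    exact sub_ne_zero.mpr this
  rcases eq_or_ne i j with rfl | hij
  · have hμ : (ν + N - 2 * i) ≠ 0 := fun h => hne (by linarith)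
    have hd : ∀ θ ∈ Set.uIcc (0 : ℝ) Real.pi, HasDerivAt (fun θ =>
        Real.sin (2 * (ν + N - 2 * i) * θ - (ν + N - 2 * i) * Real.pi) / (4 * (ν + N - 2 * i)) -
          θ * (Real.cos ((ν + N - 2 * i) * Real.pi) / 2))
        (Real.sin ((ν + N - 2 * i) * θ) * Real.sin ((ν + N - 2 * i) * (Real.pi - θ))) θ := by
      intro θ _
      have d1 := ((((hasDerivAt_id θ).const_mul (2 * (ν + N - 2 * i))).sub_const
        ((ν + N - 2 * i) * Real.pi)).sin.div_const (4 * (ν + N - 2 * i))).sub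
        ((hasDerivAt_id θ).mul_const (Real.cos ((ν + N - 2 * i) * Real.pi) / 2))
      refine d1.congr_deriv ?_
      simp only [id, mul_one]
      rw [show 2 * (ν + N - 2 * i) * θ - (ν + N - 2 * i) * Real.pi =
        (ν + N - 2 * i) * θ - (ν + N - 2 * i) * (Real.pi - θ) by ring,
        show (ν + N - 2 * i) * Real.pi =
        (ν + N - 2 * i) * θ + (ν + N - 2 * i) * (Real.pi - θ) by ring, Real.cos_sub, Real.cos_add]
      field_simp
      ring
    rw [intervalIntegral.integral_eq_sub_of_hasDerivAt hd (by
      apply Continuous.intervalIntegrable; fun_prop), if_pos rfl]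
    rw [show 2 * (ν + N - 2 * i) * Real.pi - (ν + N - 2 * i) * Real.pi =
      (ν + N - 2 * i) * Real.pi by ring, mul_zero, zero_sub, Real.sin_neg, sin_freq, cos_freq,
      show ν - ((i : ℝ) + i - N) = ν + N - 2 * i by ring]
    field_simp
    ring
  · have hs : (ν + N - 2 * i) + (ν + N - 2 * j) ≠ 0 := fun h => hne (by linarith)
    have hm : (ν + N - 2 * i) - (ν + N - 2 * j) ≠ 0 := fun h =>
      hij (by have : (i : ℝ) = j := by linarith
              exact_mod_cast this)
    have hd : ∀ θ ∈ Set.uIcc (0 : ℝ) Real.pi, HasDerivAt (fun θ =>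
        Real.sin (((ν + N - 2 * i) + (ν + N - 2 * j)) * θ - (ν + N - 2 * j) * Real.pi) /
          (2 * ((ν + N - 2 * i) + (ν + N - 2 * j))) -
        Real.sin (((ν + N - 2 * i) - (ν + N - 2 * j)) * θ + (ν + N - 2 * j) * Real.pi) /
          (2 * ((ν + N - 2 * i) - (ν + N - 2 * j))))
        (Real.sin ((ν + N - 2 * i) * θ) * Real.sin ((ν + N - 2 * j) * (Real.pi - θ))) θ := by
      intro θ _
      have d1 := ((((hasDerivAt_id θ).const_mul ((ν + N - 2 * i) + (ν + N - 2 * j))).sub_const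
        ((ν + N - 2 * j) * Real.pi)).sin.div_const (2 * ((ν + N - 2 * i) + (ν + N - 2 * j)))).sub
        ((((hasDerivAt_id θ).const_mul ((ν + N - 2 * i) - (ν + N - 2 * j))).add_const
        ((ν + N - 2 * j) * Real.pi)).sin.div_const (2 * ((ν + N - 2 * i) - (ν + N - 2 * j))))
      refine d1.congr_deriv ?_
      simp only [id, mul_one]
      rw [show ((ν + N - 2 * i) + (ν + N - 2 * j)) * θ - (ν + N - 2 * j) * Real.pi =
        (ν + N - 2 * i) * θ - (ν + N - 2 * j) * (Real.pi - θ) by ring,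
        show ((ν + N - 2 * i) - (ν + N - 2 * j)) * θ + (ν + N - 2 * j) * Real.pi =
        (ν + N - 2 * i) * θ + (ν + N - 2 * j) * (Real.pi - θ) by ring, Real.cos_sub, Real.cos_add]
      generalize (ν + N - 2 * i) + (ν + N - 2 * j) = p at *
      generalize (ν + N - 2 * i) - (ν + N - 2 * j) = q at *
      field_simp
      ring
    rw [intervalIntegral.integral_eq_sub_of_hasDerivAt hd (by
      apply Continuous.intervalIntegrable; fun_prop), if_neg hij]
    rw [show ((ν + N - 2 * i) + (ν + N - 2 * j)) * Real.pi - (ν + N - 2 * j) * Real.pi =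
      (ν + N - 2 * i) * Real.pi by ring,
      show ((ν + N - 2 * i) - (ν + N - 2 * j)) * Real.pi + (ν + N - 2 * j) * Real.pi =
      (ν + N - 2 * i) * Real.pi by ring, mul_zero, mul_zero, zero_sub, zero_add, Real.sin_neg,
      sin_freq, sin_freq]
    rw [show ν - ((i : ℝ) + j - N) = ((ν + N - 2 * i) + (ν + N - 2 * j)) / 2 by ring]
    field_simp
    ring

lemma integral_trigSum_mul_reflect (N : ℕ) {ν : ℝ} (hν : ∀ m : ℤ, ν ≠ m) :
    ∫ θ in (0 : ℝ)..Real.pi, trigSum N ν θ * trigSum N ν (Real.pi - θ) =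
      1 / 2 * (-1) ^ N * (Real.sin (Real.pi * ν) * (∑ n ∈ Finset.range (2 * N + 1),
        trigNormSq N ((n : ℝ) - N) / (ν - ((n : ℝ) - N))) -
        Real.pi * Real.cos (Real.pi * ν) * trigNormSq N ν) := by
  have e : ∀ θ : ℝ, trigSum N ν θ * trigSum N ν (Real.pi - θ) =
      ∑ i ∈ Finset.range (N + 1), ∑ j ∈ Finset.range (N + 1),
        (trigCoeff N i).eval ν * (trigCoeff N j).eval ν * (Real.sin ((ν + N - 2 * i) * θ) *
          Real.sin ((ν + N - 2 * j) * (Real.pi - θ))) := by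
    intro θ
    rw [trigSum, trigSum, Finset.sum_mul_sum]
    exact Finset.sum_congr rfl fun i _ => Finset.sum_congr rfl fun j _ => by ring
  simp_rw [e]
  rw [intervalIntegral.integral_finsetSum fun i _ => by
    apply Continuous.intervalIntegrable; fun_prop]
  have e2 : ∀ i ∈ Finset.range (N + 1), (∫ θ in (0 : ℝ)..Real.pi, ∑ j ∈ Finset.range (N + 1),
        (trigCoeff N i).eval ν * (trigCoeff N j).eval ν * (Real.sin ((ν + N - 2 * i) * θ) *
          Real.sin ((ν + N - 2 * j) * (Real.pi - θ)))) =
      1 / 2 * (-1) ^ N * (Real.sin (Real.pi * ν) * (∑ j ∈ Finset.range (N + 1),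
        (trigCoeff N i).eval ν * (trigCoeff N j).eval ν / (ν - ((i : ℝ) + j - N))) -
        Real.pi * Real.cos (Real.pi * ν) * (trigCoeff N i).eval ν ^ 2) := by
    intro i hi
    rw [intervalIntegral.integral_finsetSum fun j _ => by
      apply Continuous.intervalIntegrable; fun_prop]
    simp_rw [intervalIntegral.integral_const_mul, integral_sin_mul_sin_reflect N i _ hν]
    have e3 : ∀ j : ℕ, (trigCoeff N i).eval ν * (trigCoeff N j).eval ν *
        (1 / 2 * (-1) ^ N * (Real.sin (Real.pi * ν) / (ν - ((i : ℝ) + j - N)) -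
          if i = j then Real.pi * Real.cos (Real.pi * ν) else 0)) =
        1 / 2 * (-1) ^ N * (Real.sin (Real.pi * ν) * ((trigCoeff N i).eval ν *
          (trigCoeff N j).eval ν / (ν - ((i : ℝ) + j - N)))) -
        (if i = j then 1 / 2 * (-1) ^ N * (Real.pi * Real.cos (Real.pi * ν) *
          ((trigCoeff N i).eval ν * (trigCoeff N j).eval ν)) else 0) := by
      intro j
      split_ifs <;> ring
    simp_rw [e3]
    rw [Finset.sum_sub_distrib, Finset.sum_ite_eq, if_pos hi, ← Finset.mul_sum, ← Finset.mul_sum]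
    ring
  rw [Finset.sum_congr rfl e2, ← Finset.mul_sum, Finset.sum_sub_distrib, ← Finset.mul_sum,
    ← Finset.mul_sum, sum_trigCoeff_div_eq_sum_trigNormSq N hν, trigNormSq]

/-! ### Schwinger and Feynman parameters -/

lemma lintegral_pow_mul_exp (n : ℕ) {r : ℝ} (hr : 0 < r) :
    ∫⁻ y in Set.Ioi (0 : ℝ), ENNReal.ofReal (y ^ n * Real.exp (-(r * y))) =
      ENNReal.ofReal (n.factorial / r ^ (n + 1)) := by
  have h := lintegral_rpow_mul_exp (a := n + 1) (by positivity) hr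
  rw [Real.Gamma_nat_eq_factorial] at h
  simp only [add_sub_cancel_right, Real.rpow_natCast] at h
  rw [h]
  congr 1
  rw [show ((n : ℝ) + 1) = ((n + 1 : ℕ) : ℝ) by push_cast; ring, Real.rpow_natCast,
    one_div, inv_pow]
  field_simp

lemma lintegral_comp_pos_smul {E : Type*} [NormedAddCommGroup E] [NormedSpace ℝ E]
    [MeasurableSpace E] [BorelSpace E] [FiniteDimensional ℝ E] (μ : Measure E)
    [μ.IsAddHaarMeasure] {f : E → ENNReal} (hf : Measurable f) {r : ℝ} (hr : 0 < r) :
    ENNReal.ofReal (r ^ Module.finrank ℝ E) * ∫⁻ x, f (r • x) ∂μ = ∫⁻ x, f x ∂μ := by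
  have h : ∫⁻ x, f (r • x) ∂μ = ∫⁻ x, f x ∂(Measure.map (r • ·) μ) :=
    (lintegral_map hf (measurable_const_smul r)).symm
  rw [h, Measure.map_addHaar_smul μ hr.ne', lintegral_smul_measure, smul_eq_mul, ← mul_assoc,
    abs_of_pos (by positivity), ← ENNReal.ofReal_mul (by positivity),
    mul_inv_cancel₀ (by positivity), ENNReal.ofReal_one, one_mul]

lemma setLIntegral_Ioi_comp_mul {f : ℝ → ENNReal} (hf : Measurable f) {r : ℝ} (hr : 0 < r) :
    ∫⁻ t in Set.Ioi (0 : ℝ), f t =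
      ENNReal.ofReal r * ∫⁻ τ in Set.Ioi (0 : ℝ), f (r * τ) := by
  rw [← lintegral_indicator measurableSet_Ioi, ← lintegral_indicator measurableSet_Ioi,
    ← lintegral_comp_pos_smul volume (hf.indicator measurableSet_Ioi) hr]
  simp only [Module.finrank_self, pow_one, smul_eq_mul]
  congr 1
  refine lintegral_congr fun x => ?_
  simp only [Set.indicator_apply, Set.mem_Ioi, mul_pos_iff_of_pos_left hr]

/-- The open two-dimensional simplex. -/
def simplex2 : Set (ℝ × ℝ) := {p | 0 < p.1 ∧ 0 < p.2 ∧ p.1 + p.2 < 1}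

lemma measurableSet_simplex2 : MeasurableSet simplex2 :=
  ((measurableSet_lt measurable_const measurable_fst).inter
    ((measurableSet_lt measurable_const measurable_snd).inter
      (measurableSet_lt (measurable_fst.add measurable_snd) measurable_const)))

/-- Integration over the octant as integration over a simplex and a scale. -/
lemma lintegral_simplex2_scale {f : ℝ × ℝ × ℝ → ENNReal} (hf : Measurable f) :
    ∫⁻ p in simplex2, ∫⁻ ρ in Set.Ioi (0 : ℝ),
      ENNReal.ofReal (ρ ^ 2) * f (ρ * p.1, ρ * p.2, ρ * (1 - p.1 - p.2)) =
    ∫⁻ p in Set.Ioi (0 : ℝ) ×ˢ Set.Ioi (0 : ℝ), ∫⁻ γ in Set.Ioi (0 : ℝ), f (p.1, p.2, γ) := by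
  set S : Set (ℝ × ℝ × ℝ) := Set.Ioi 0 ×ˢ Set.Ioi 0 ×ˢ Set.Ioi 0 with hS
  have hSm : MeasurableSet S := measurableSet_Ioi.prod (measurableSet_Ioi.prod measurableSet_Ioi)
  have hF : Measurable (S.indicator f) := hf.indicator hSm
  have h1 : ∫⁻ p in simplex2, ∫⁻ ρ in Set.Ioi (0 : ℝ),
      ENNReal.ofReal (ρ ^ 2) * f (ρ * p.1, ρ * p.2, ρ * (1 - p.1 - p.2)) =
      ∫⁻ ρ in Set.Ioi (0 : ℝ), ∫⁻ p in simplex2,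
      ENNReal.ofReal (ρ ^ 2) * f (ρ * p.1, ρ * p.2, ρ * (1 - p.1 - p.2)) :=
    lintegral_lintegral_swap (by fun_prop)
  have h2 : ∀ ρ ∈ Set.Ioi (0 : ℝ), ∫⁻ p in simplex2,
      ENNReal.ofReal (ρ ^ 2) * f (ρ * p.1, ρ * p.2, ρ * (1 - p.1 - p.2)) =
      ∫⁻ p : ℝ × ℝ, S.indicator f (p.1, p.2, ρ - p.1 - p.2) := by
    intro ρ hρ
    have hρ' : (0 : ℝ) < ρ := hρ
    have hg : Measurable fun p : ℝ × ℝ => S.indicator f (p.1, p.2, ρ - p.1 - p.2) := by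
      fun_prop
    rw [← lintegral_comp_pos_smul volume hg hρ', ← lintegral_const_mul _ (by fun_prop),
      ← lintegral_indicator measurableSet_simplex2]
    refine lintegral_congr fun p => ?_
    have hfr : Module.finrank ℝ (ℝ × ℝ) = 2 := by simp
    rw [hfr]
    simp only [Set.indicator_apply, Prod.smul_fst, Prod.smul_snd, smul_eq_mul, hS, Set.mem_prod,
      Set.mem_Ioi, mul_pos_iff_of_pos_left hρ']
    have e : ρ - ρ * p.1 - ρ * p.2 = ρ * (1 - p.1 - p.2) := by ring
    simp only [e, mul_pos_iff_of_pos_left hρ']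
    by_cases hp : p ∈ simplex2
    · rw [Set.indicator_of_mem hp, if_pos ⟨hp.1, hp.2.1, by have := hp.2.2; linarith⟩]
    · rw [Set.indicator_of_notMem hp, if_neg, mul_zero]
      rintro ⟨a, b, c⟩
      exact hp ⟨a, b, by linarith⟩
  rw [h1, setLIntegral_congr_fun measurableSet_Ioi h2, lintegral_lintegral_swap (by fun_prop),
    ← lintegral_indicator (measurableSet_Ioi.prod measurableSet_Ioi)]
  refine lintegral_congr fun p => ?_
  have h3 : ∫⁻ ρ in Set.Ioi (0 : ℝ), S.indicator f (p.1, p.2, ρ - p.1 - p.2) =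
      ∫⁻ ρ : ℝ, S.indicator f (p.1, p.2, ρ - (p.1 + p.2)) := by
    rw [← lintegral_indicator measurableSet_Ioi]
    refine lintegral_congr fun ρ => ?_
    simp only [sub_sub]
    by_cases hρ : ρ ∈ Set.Ioi (0 : ℝ)
    · rw [Set.indicator_of_mem hρ]
    · rw [Set.indicator_of_notMem hρ, Set.indicator_of_notMem]
      rintro ⟨a, b, c⟩
      simp only [Set.mem_Ioi] at a b c hρ
      linarith
  rw [h3, lintegral_sub_right_eq_self (fun γ => S.indicator f (p.1, p.2, γ)) (p.1 + p.2)]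
  by_cases hp : p ∈ Set.Ioi (0 : ℝ) ×ˢ Set.Ioi (0 : ℝ)
  · rw [Set.indicator_of_mem hp, ← lintegral_indicator measurableSet_Ioi]
    refine lintegral_congr fun γ => ?_
    simp only [Set.indicator_apply, hS, Set.mem_prod, hp.1, hp.2, true_and]
  · rw [Set.indicator_of_notMem hp]
    rw [lintegral_eq_zero_iff (by fun_prop)]
    refine Eventually.of_forall fun γ => ?_
    simp only [Pi.zero_apply]
    rw [Set.indicator_of_notMem]
    rintro ⟨a, b, c⟩
    exact hp ⟨a, b⟩

lemma lintegral_feynman (N : ℕ) {A₁ A₂ A₃ : ℝ} (h₁ : 0 < A₁) (h₂ : 0 < A₂) (h₃ : 0 < A₃) :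
    ∫⁻ p in simplex2, ∫⁻ ρ in Set.Ioi (0 : ℝ), ENNReal.ofReal (ρ ^ (3 * N + 2) *
      (p.1 * p.2 * (1 - p.1 - p.2)) ^ N *
        Real.exp (-(ρ * (p.1 * A₁ + p.2 * A₂ + (1 - p.1 - p.2) * A₃)))) =
    ENNReal.ofReal (N.factorial ^ 3 / (A₁ * A₂ * A₃) ^ (N + 1)) := by
  set g : ℝ → ℝ → ENNReal := fun A y => ENNReal.ofReal (y ^ N * Real.exp (-(A * y))) with hg
  have hgm : ∀ A, Measurable (g A) := fun A => by fun_prop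
  have h := lintegral_simplex2_scale (f := fun q => g A₁ q.1 * (g A₂ q.2.1 * g A₃ q.2.2))
    (by fun_prop)
  have e1 : ∀ p ∈ simplex2, ∫⁻ ρ in Set.Ioi (0 : ℝ), ENNReal.ofReal (ρ ^ (3 * N + 2) *
      (p.1 * p.2 * (1 - p.1 - p.2)) ^ N *
        Real.exp (-(ρ * (p.1 * A₁ + p.2 * A₂ + (1 - p.1 - p.2) * A₃)))) =
      ∫⁻ ρ in Set.Ioi (0 : ℝ), ENNReal.ofReal (ρ ^ 2) * (g A₁ (ρ * p.1) * (g A₂ (ρ * p.2) *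
        g A₃ (ρ * (1 - p.1 - p.2)))) := by
    intro p hp
    have hp3 : 0 < 1 - p.1 - p.2 := by have := hp.2.2; linarith
    have hp1 := hp.1
    have hp2 := hp.2.1
    refine setLIntegral_congr_fun measurableSet_Ioi fun ρ hρ => ?_
    have hρ' : (0 : ℝ) < ρ := hρ
    simp only [hg]
    rw [← ENNReal.ofReal_mul (by positivity), ← ENNReal.ofReal_mul (by positivity),
      ← ENNReal.ofReal_mul (by positivity)]
    congr 1
    rw [show -(ρ * (p.1 * A₁ + p.2 * A₂ + (1 - p.1 - p.2) * A₃)) = -(A₁ * (ρ * p.1)) +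
      (-(A₂ * (ρ * p.2)) + -(A₃ * (ρ * (1 - p.1 - p.2)))) by ring, Real.exp_add, Real.exp_add]
    generalize 1 - p.1 - p.2 = q
    ring
  rw [setLIntegral_congr_fun measurableSet_simplex2 e1, h]
  have e2 : ∀ p : ℝ × ℝ, ∫⁻ γ in Set.Ioi (0 : ℝ), g A₁ p.1 * (g A₂ p.2 * g A₃ γ) =
      ENNReal.ofReal (N.factorial / A₃ ^ (N + 1)) * (g A₁ p.1 * g A₂ p.2) := by
    intro p
    simp_rw [← mul_assoc]
    rw [lintegral_const_mul _ (hgm A₃), hg]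
    simp only
    rw [lintegral_pow_mul_exp N h₃]; ring
  simp_rw [e2]
  rw [lintegral_const_mul _ (by fun_prop), Measure.volume_eq_prod, ← Measure.prod_restrict,
    lintegral_prod_mul (hgm A₁).aemeasurable (hgm A₂).aemeasurable]
  simp only [hg]
  rw [lintegral_pow_mul_exp N h₁, lintegral_pow_mul_exp N h₂, ← ENNReal.ofReal_mul (by positivity),
    ← ENNReal.ofReal_mul (by positivity)]
  congr 1
  field_simp
  ring

lemma lintegral_gaussian_half_plane (N : ℕ) {ρ : ℝ} (hρ : 0 < ρ) (a : ℝ) :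
    ∫⁻ w in (Set.univ : Set ℝ) ×ˢ Set.Ioi (0 : ℝ), ENNReal.ofReal (Real.exp (-ρ * (w.1 - a) ^ 2)) *
      ENNReal.ofReal (w.2 ^ (4 * N + 2) * Real.exp (-ρ * w.2 ^ 2)) =
    ENNReal.ofReal (√Real.pi * Real.Gamma (2 * N + 3 / 2) / 2 / ρ ^ (2 * N + 2)) := by
  rw [Measure.volume_eq_prod, ← Measure.prod_restrict, Measure.restrict_univ,
    lintegral_prod_mul (f := fun x => ENNReal.ofReal (Real.exp (-ρ * (x - a) ^ 2)))
      (g := fun y => ENNReal.ofReal (y ^ (4 * N + 2) * Real.exp (-ρ * y ^ 2)))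
      (by fun_prop) (by fun_prop)]
  have hG : 0 < Real.Gamma (2 * N + 3 / 2) := Real.Gamma_pos_of_pos (by positivity)
  have h1 : ∫⁻ x : ℝ, ENNReal.ofReal (Real.exp (-ρ * (x - a) ^ 2)) =
      ENNReal.ofReal (√(Real.pi / ρ)) := by
    rw [lintegral_sub_right_eq_self (fun x => ENNReal.ofReal (Real.exp (-ρ * x ^ 2))) a]
    refine (integrable_and_lintegral_ofReal (Eventually.of_forall fun x => (Real.exp_pos _).le)
      (integral_gaussian ρ) (Real.sqrt_pos.mpr (by positivity))).2
  have h2 : ∫⁻ y in Set.Ioi (0 : ℝ), ENNReal.ofReal (y ^ (4 * N + 2) * Real.exp (-ρ * y ^ 2)) =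
      ENNReal.ofReal (ρ ^ (-(2 * N + 3 / 2 : ℝ)) * (1 / 2) * Real.Gamma (2 * N + 3 / 2)) := by
    refine (integrable_and_lintegral_ofReal ?_ ?_ (by positivity)).2
    · filter_upwards [ae_restrict_mem measurableSet_Ioi] with y hy
      have : (0 : ℝ) < y := hy
      positivity
    · have h := integral_rpow_mul_exp_neg_mul_rpow (p := 2) (q := 4 * N + 2) (b := ρ) two_pos
        (by have : (0 : ℝ) ≤ N := Nat.cast_nonneg N
            linarith) hρ
      rw [show (4 * (N : ℝ) + 2 + 1) / 2 = 2 * N + 3 / 2 by ring,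
        show -(4 * (N : ℝ) + 2 + 1) / 2 = -(2 * N + 3 / 2) by ring] at h
      rw [← h]
      refine setIntegral_congr_fun measurableSet_Ioi fun y hy => ?_
      rw [show (4 * (N : ℝ) + 2) = ((4 * N + 2 : ℕ) : ℝ) by push_cast; ring, Real.rpow_natCast,
        Real.rpow_two]
  rw [h1, h2, ← ENNReal.ofReal_mul (Real.sqrt_nonneg _)]
  congr 1
  rw [Real.sqrt_div Real.pi_pos.le, Real.sqrt_eq_rpow ρ, Real.rpow_neg hρ.le]
  have : ρ ^ (1 / 2 : ℝ) * ρ ^ (2 * (N : ℝ) + 3 / 2) = ρ ^ (2 * N + 2) := by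
    rw [← Real.rpow_add hρ, ← Real.rpow_natCast]
    congr 1; push_cast; ring
  rw [← this]
  field_simp

/-- The quadratic form `αγ (1+t)² + αβ t² + βγ` on the simplex. -/
noncomputable def simplexForm (t : ℝ) (p : ℝ × ℝ) : ℝ :=
  p.1 * (1 - p.1 - p.2) * (1 + t) ^ 2 + p.1 * p.2 * t ^ 2 + p.2 * (1 - p.1 - p.2)

lemma simplexForm_pos {t : ℝ} (ht : 0 < t) {p : ℝ × ℝ} (hp : p ∈ simplex2) :
    0 < simplexForm t p := by
  have hp3 : 0 < 1 - p.1 - p.2 := by have := hp.2.2; linarith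
  have hp1 := hp.1
  have hp2 := hp.2.1
  unfold simplexForm
  positivity

/-- The simplex integral `∫ (αβγ)^N / (αγ (1+t)² + αβ t² + βγ)^(N+1)`. -/
noncomputable def simplexLInt (N : ℕ) (t : ℝ) : ENNReal :=
  ∫⁻ p in simplex2,
    ENNReal.ofReal ((p.1 * p.2 * (1 - p.1 - p.2)) ^ N / simplexForm t p ^ (N + 1))

/-- The integrand of the contact diagram in the upper half-plane. -/
noncomputable def contactFun (N : ℕ) (t : ℝ) (w : ℝ × ℝ) : ℝ :=
  w.2 ^ (4 * N + 2) / (((w.1 - t) ^ 2 + w.2 ^ 2) * (w.1 ^ 2 + w.2 ^ 2) *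
    ((w.1 + 1) ^ 2 + w.2 ^ 2)) ^ (N + 1)

lemma lintegral_contactFun (N : ℕ) {t : ℝ} (ht : 0 < t) :
    ∫⁻ w in (Set.univ : Set ℝ) ×ˢ Set.Ioi (0 : ℝ), ENNReal.ofReal (contactFun N t w) =
      ENNReal.ofReal (√Real.pi * Real.Gamma (2 * N + 3 / 2) / 2 / N.factorial ^ 2) *
        simplexLInt N t := by
  have hG : 0 < Real.Gamma (2 * N + 3 / 2) := Real.Gamma_pos_of_pos (by positivity)
  have hfac : (0 : ℝ) < N.factorial ^ 3 := by positivity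
  have hms : MeasurableSet ((Set.univ : Set ℝ) ×ˢ Set.Ioi (0 : ℝ)) :=
    MeasurableSet.univ.prod measurableSet_Ioi
  have key : ENNReal.ofReal (N.factorial ^ 3) *
      ∫⁻ w in (Set.univ : Set ℝ) ×ˢ Set.Ioi (0 : ℝ), ENNReal.ofReal (contactFun N t w) =
      ENNReal.ofReal (√Real.pi * Real.Gamma (2 * N + 3 / 2) / 2 * N.factorial) *
        simplexLInt N t := by
    rw [← lintegral_const_mul _ (by unfold contactFun; fun_prop)]
    have e1 : ∀ w ∈ (Set.univ : Set ℝ) ×ˢ Set.Ioi (0 : ℝ),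
        ENNReal.ofReal (N.factorial ^ 3) * ENNReal.ofReal (contactFun N t w) =
        ∫⁻ p in simplex2, ∫⁻ ρ in Set.Ioi (0 : ℝ), ENNReal.ofReal (w.2 ^ (4 * N + 2)) *
          ENNReal.ofReal (ρ ^ (3 * N + 2) *
          (p.1 * p.2 * (1 - p.1 - p.2)) ^ N *
          Real.exp (-(ρ * (p.1 * ((w.1 - t) ^ 2 + w.2 ^ 2) + p.2 * (w.1 ^ 2 + w.2 ^ 2) +
            (1 - p.1 - p.2) * ((w.1 + 1) ^ 2 + w.2 ^ 2))))) := by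
      intro w hw
      have hw2 : (0 : ℝ) < w.2 := hw.2
      simp_rw [lintegral_const_mul' _ _ ENNReal.ofReal_ne_top]
      rw [lintegral_feynman N (by positivity) (by positivity) (by positivity),
        ← ENNReal.ofReal_mul hfac.le, ← ENNReal.ofReal_mul (by positivity)]
      congr 1
      rw [contactFun]; ring
    rw [setLIntegral_congr_fun hms e1, lintegral_lintegral_swap
      (Measurable.aemeasurable (Measurable.lintegral_prod_right'
        (f := fun z : ((ℝ × ℝ) × ℝ × ℝ) × ℝ => ENNReal.ofReal (z.1.1.2 ^ (4 * N + 2)) *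
          ENNReal.ofReal (z.2 ^ (3 * N + 2) * (z.1.2.1 * z.1.2.2 * (1 - z.1.2.1 - z.1.2.2)) ^ N *
          Real.exp (-(z.2 * (z.1.2.1 * ((z.1.1.1 - t) ^ 2 + z.1.1.2 ^ 2) +
            z.1.2.2 * (z.1.1.1 ^ 2 + z.1.1.2 ^ 2) +
            (1 - z.1.2.1 - z.1.2.2) * ((z.1.1.1 + 1) ^ 2 + z.1.1.2 ^ 2)))))) (by fun_prop))),
      simplexLInt, ← lintegral_const_mul' _ _ ENNReal.ofReal_ne_top]
    refine setLIntegral_congr_fun measurableSet_simplex2 fun p hp => ?_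
    have hp3 : 0 < 1 - p.1 - p.2 := by have := hp.2.2; linarith
    have hp1 := hp.1
    have hp2 := hp.2.1
    have hQ := simplexForm_pos ht hp
    rw [lintegral_lintegral_swap (by fun_prop)]
    have e2 : ∀ ρ ∈ Set.Ioi (0 : ℝ), (∫⁻ w in (Set.univ : Set ℝ) ×ˢ Set.Ioi (0 : ℝ),
          ENNReal.ofReal (w.2 ^ (4 * N + 2)) * ENNReal.ofReal (ρ ^ (3 * N + 2) *
          (p.1 * p.2 * (1 - p.1 - p.2)) ^ N *
          Real.exp (-(ρ * (p.1 * ((w.1 - t) ^ 2 + w.2 ^ 2) + p.2 * (w.1 ^ 2 + w.2 ^ 2) +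
            (1 - p.1 - p.2) * ((w.1 + 1) ^ 2 + w.2 ^ 2)))))) =
        ENNReal.ofReal ((p.1 * p.2 * (1 - p.1 - p.2)) ^ N *
          (√Real.pi * Real.Gamma (2 * N + 3 / 2) / 2)) *
        ENNReal.ofReal (ρ ^ N * Real.exp (-(simplexForm t p * ρ))) := by
      intro ρ hρ
      have hρ' : (0 : ℝ) < ρ := hρ
      have e3 : ∀ w ∈ (Set.univ : Set ℝ) ×ˢ Set.Ioi (0 : ℝ),
          ENNReal.ofReal (w.2 ^ (4 * N + 2)) * ENNReal.ofReal (ρ ^ (3 * N + 2) *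
          (p.1 * p.2 * (1 - p.1 - p.2)) ^ N *
          Real.exp (-(ρ * (p.1 * ((w.1 - t) ^ 2 + w.2 ^ 2) + p.2 * (w.1 ^ 2 + w.2 ^ 2) +
            (1 - p.1 - p.2) * ((w.1 + 1) ^ 2 + w.2 ^ 2))))) =
          ENNReal.ofReal (ρ ^ (3 * N + 2) * (p.1 * p.2 * (1 - p.1 - p.2)) ^ N *
            Real.exp (-(simplexForm t p * ρ))) *
          (ENNReal.ofReal (Real.exp (-ρ * (w.1 - (p.1 * t - (1 - p.1 - p.2))) ^ 2)) *
            ENNReal.ofReal (w.2 ^ (4 * N + 2) * Real.exp (-ρ * w.2 ^ 2))) := by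
        intro w hw
        have hw2 : (0 : ℝ) < w.2 := hw.2
        rw [← ENNReal.ofReal_mul (by positivity), ← ENNReal.ofReal_mul (by positivity),
          ← ENNReal.ofReal_mul (by positivity)]
        congr 1
        have : -(ρ * (p.1 * ((w.1 - t) ^ 2 + w.2 ^ 2) + p.2 * (w.1 ^ 2 + w.2 ^ 2) +
            (1 - p.1 - p.2) * ((w.1 + 1) ^ 2 + w.2 ^ 2))) = -(simplexForm t p * ρ) +
            (-ρ * (w.1 - (p.1 * t - (1 - p.1 - p.2))) ^ 2 + -ρ * w.2 ^ 2) := by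
          unfold simplexForm; ring
        rw [this, Real.exp_add, Real.exp_add]
        ring
      rw [setLIntegral_congr_fun hms e3, lintegral_const_mul' _ _ ENNReal.ofReal_ne_top,
        lintegral_gaussian_half_plane N hρ', ← ENNReal.ofReal_mul (by positivity),
        ← ENNReal.ofReal_mul (by positivity)]
      congr 1
      rw [show 3 * N + 2 = N + (2 * N + 2) by ring, pow_add ρ N]
      field_simp
    rw [setLIntegral_congr_fun measurableSet_Ioi e2, lintegral_const_mul' _ _ ENNReal.ofReal_ne_top,
      lintegral_pow_mul_exp N hQ, ← ENNReal.ofReal_mul (by positivity),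
      ← ENNReal.ofReal_mul (by positivity)]
    congr 1
    ring
  have hne : ENNReal.ofReal ((N.factorial : ℝ) ^ 3) ≠ 0 := by
    simp only [ne_eq, ENNReal.ofReal_eq_zero, not_le]; exact hfac
  refine (ENNReal.mul_right_inj hne ENNReal.ofReal_ne_top).mp ?_
  rw [key, ← mul_assoc, ← ENNReal.ofReal_mul hfac.le]
  congr 2
  field_simp

/-! ### The Mellin transform in polar coordinates -/

/-- The lower Lebesgue integral version of `angInt`. -/
noncomputable def angLInt (M : ℕ) (σ θ : ℝ) : ENNReal :=
  ∫⁻ τ in Set.Ioi (0 : ℝ), ENNReal.ofReal (τ ^ (σ - 1) / (1 + 2 * τ * Real.cos θ + τ ^ 2) ^ M)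

lemma angLInt_eq {M : ℕ} {σ θ : ℝ} (h0 : 0 < σ) (h1 : σ < 2 * M) (hc : -1 < Real.cos θ) :
    angLInt M σ θ = ENNReal.ofReal (angInt M σ θ) := by
  rw [angInt, ofReal_integral_eq_lintegral_ofReal (integrableOn_angInt h0 h1 hc), angLInt]
  filter_upwards [ae_restrict_mem measurableSet_Ioi] with τ hτ
  have hτ' : (0 : ℝ) < τ := hτ
  have := quad_pos hτ'.le hc
  simp only [Pi.zero_apply]
  positivity

lemma measurable_angLInt (M : ℕ) (σ : ℝ) : Measurable (angLInt M σ) :=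
  Measurable.lintegral_prod_right' (f := fun z : ℝ × ℝ =>
    ENNReal.ofReal (z.2 ^ (σ - 1) / (1 + 2 * z.2 * Real.cos z.1 + z.2 ^ 2) ^ M)) (by fun_prop)

/-- The angular integral `∫₀^π sin^(4N+2) θ G(θ) G(π - θ) dθ`. -/
noncomputable def angularLInt (N : ℕ) (σ : ℝ) : ENNReal :=
  ∫⁻ θ in Set.Ioo 0 Real.pi, ENNReal.ofReal (Real.sin θ ^ (4 * N + 2)) *
    (angLInt (N + 1) σ θ * angLInt (N + 1) σ (Real.pi - θ))

lemma lintegral_half_plane_polar {f : ℝ × ℝ → ENNReal} :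
    ∫⁻ w in (Set.univ : Set ℝ) ×ˢ Set.Ioi (0 : ℝ), f w =
      ∫⁻ q in Set.Ioi (0 : ℝ) ×ˢ Set.Ioo 0 Real.pi,
        ENNReal.ofReal q.1 * f (q.1 * Real.cos q.2, q.1 * Real.sin q.2) := by
  rw [← lintegral_indicator (MeasurableSet.univ.prod measurableSet_Ioi),
    ← lintegral_comp_polarCoord_symm, ← lintegral_indicator polarCoord.open_target.measurableSet,
    ← lintegral_indicator (measurableSet_Ioi.prod measurableSet_Ioo)]
  refine lintegral_congr fun q => ?_
  by_cases hq : q ∈ Set.Ioi (0 : ℝ) ×ˢ Set.Ioo 0 Real.pi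
  · have hq1 : (0 : ℝ) < q.1 := hq.1
    have hs : 0 < Real.sin q.2 := Real.sin_pos_of_pos_of_lt_pi hq.2.1 hq.2.2
    have ht : q ∈ polarCoord.target := ⟨hq.1, by linarith [hq.2.1, Real.pi_pos], hq.2.2⟩
    rw [Set.indicator_of_mem ht, Set.indicator_of_mem hq, polarCoord_symm_apply,
      Set.indicator_of_mem, smul_eq_mul]
    exact ⟨trivial, mul_pos hq1 hs⟩
  · rw [Set.indicator_of_notMem hq]
    by_cases ht : q ∈ polarCoord.target
    · rw [Set.indicator_of_mem ht, polarCoord_symm_apply, Set.indicator_of_notMem, smul_zero]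
      rintro ⟨_, h⟩
      have h1 : (0 : ℝ) < q.1 := ht.1
      have h2 : 0 < Real.sin q.2 := (mul_pos_iff_of_pos_left h1).mp h
      refine hq ⟨h1, ?_, ht.2.2⟩
      by_contra hn
      have : Real.sin q.2 ≤ 0 := Real.sin_nonpos_of_nonpos_of_neg_pi_le (not_lt.mp hn) ht.2.1.le
      linarith
    · rw [Set.indicator_of_notMem ht]

lemma lintegral_rpow_mul_contactFun (N : ℕ) (σ : ℝ) :
    ∫⁻ t in Set.Ioi (0 : ℝ), ENNReal.ofReal (t ^ (σ - 1)) *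
      ∫⁻ w in (Set.univ : Set ℝ) ×ˢ Set.Ioi (0 : ℝ), ENNReal.ofReal (contactFun N t w) =
    angularLInt N σ := by
  have hm : Measurable fun z : ℝ × ℝ × ℝ => contactFun N z.1 z.2 := by
    unfold contactFun; fun_prop
  have e1 : ∀ t : ℝ, ENNReal.ofReal (t ^ (σ - 1)) *
      ∫⁻ w in (Set.univ : Set ℝ) ×ˢ Set.Ioi (0 : ℝ), ENNReal.ofReal (contactFun N t w) =
      ∫⁻ q in Set.Ioi (0 : ℝ) ×ˢ Set.Ioo 0 Real.pi, ENNReal.ofReal (t ^ (σ - 1)) *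
        (ENNReal.ofReal q.1 *
          ENNReal.ofReal (contactFun N t (q.1 * Real.cos q.2, q.1 * Real.sin q.2))) := by
    intro t
    rw [lintegral_half_plane_polar, lintegral_const_mul' _ _ ENNReal.ofReal_ne_top]
  simp_rw [e1]
  rw [lintegral_lintegral_swap (by fun_prop)]
  have e2 : ∀ q ∈ Set.Ioi (0 : ℝ) ×ˢ Set.Ioo 0 Real.pi,
      ∫⁻ t in Set.Ioi (0 : ℝ), ENNReal.ofReal (t ^ (σ - 1)) * (ENNReal.ofReal q.1 *
          ENNReal.ofReal (contactFun N t (q.1 * Real.cos q.2, q.1 * Real.sin q.2))) =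
      ENNReal.ofReal (q.1 ^ (σ - 1) / (1 + 2 * q.1 * Real.cos q.2 + q.1 ^ 2) ^ (N + 1)) *
        (ENNReal.ofReal (Real.sin q.2 ^ (4 * N + 2)) * angLInt (N + 1) σ (Real.pi - q.2)) := by
    intro q hq
    have hr : (0 : ℝ) < q.1 := hq.1
    have hs : 0 < Real.sin q.2 := Real.sin_pos_of_pos_of_lt_pi hq.2.1 hq.2.2
    rw [setLIntegral_Ioi_comp_mul (by fun_prop) hr, angLInt,
      ← lintegral_const_mul' _ _ ENNReal.ofReal_ne_top,
      ← lintegral_const_mul' _ _ ENNReal.ofReal_ne_top,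
      ← lintegral_const_mul' _ _ ENNReal.ofReal_ne_top]
    refine setLIntegral_congr_fun measurableSet_Ioi fun τ hτ => ?_
    have hτ' : (0 : ℝ) < τ := hτ
    have hc1 := neg_one_lt_cos hq.2.1.le hq.2.2
    have hq1 := quad_pos hr.le hc1
    have hq2 := quad_pos (θ := Real.pi - q.2) hτ'.le
      (neg_one_lt_cos (by linarith [hq.2.2]) (by linarith [hq.2.1]))
    have hA : (q.1 * Real.cos q.2 - q.1 * τ) ^ 2 + (q.1 * Real.sin q.2) ^ 2 =
        q.1 ^ 2 * (1 + 2 * τ * Real.cos (Real.pi - q.2) + τ ^ 2) := by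
      rw [Real.cos_pi_sub]
      linear_combination q.1 ^ 2 * Real.sin_sq_add_cos_sq q.2
    have hB : (q.1 * Real.cos q.2) ^ 2 + (q.1 * Real.sin q.2) ^ 2 = q.1 ^ 2 := by
      linear_combination q.1 ^ 2 * Real.sin_sq_add_cos_sq q.2
    have hC : (q.1 * Real.cos q.2 + 1) ^ 2 + (q.1 * Real.sin q.2) ^ 2 =
        1 + 2 * q.1 * Real.cos q.2 + q.1 ^ 2 := by
      linear_combination q.1 ^ 2 * Real.sin_sq_add_cos_sq q.2
    simp only [contactFun]
    rw [hA, hB, hC, ← ENNReal.ofReal_mul (by positivity), ← ENNReal.ofReal_mul (by positivity),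
      ← ENNReal.ofReal_mul (by positivity), ← ENNReal.ofReal_mul (by positivity),
      ← ENNReal.ofReal_mul (by positivity)]
    congr 1
    rw [Real.mul_rpow hr.le hτ'.le]
    generalize 1 + 2 * τ * Real.cos (Real.pi - q.2) + τ ^ 2 = X at *
    generalize 1 + 2 * q.1 * Real.cos q.2 + q.1 ^ 2 = Y at *
    rw [mul_pow, mul_pow, mul_pow, mul_pow]
    field_simp
    ring
  rw [setLIntegral_congr_fun (measurableSet_Ioi.prod measurableSet_Ioo) e2,
    Measure.volume_eq_prod, ← Measure.prod_restrict]
  have hmA := measurable_angLInt (N + 1) σ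
  rw [lintegral_prod_symm _ (by fun_prop), angularLInt]
  refine setLIntegral_congr_fun measurableSet_Ioo fun θ hθ => ?_
  simp only
  rw [lintegral_mul_const _ (by fun_prop)]
  rw [← angLInt]; ring

lemma simplexLInt_mellin (N : ℕ) (σ : ℝ) :
    ENNReal.ofReal (√Real.pi * Real.Gamma (2 * N + 3 / 2) / 2 / N.factorial ^ 2) *
      ∫⁻ t in Set.Ioi (0 : ℝ), ENNReal.ofReal (t ^ (σ - 1)) * simplexLInt N t =
    angularLInt N σ := by
  rw [← lintegral_rpow_mul_contactFun, ← lintegral_const_mul' _ _ ENNReal.ofReal_ne_top]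
  refine setLIntegral_congr_fun measurableSet_Ioi fun t ht => ?_
  rw [lintegral_contactFun N ht]; ring

lemma angularLInt_lt_top (N : ℕ) {σ : ℝ} (h0 : 0 < σ) (h1 : σ < 2 * (N + 1 : ℕ)) :
    angularLInt N σ < ⊤ := by
  set B : ℝ := ∫ τ in Set.Ioi (0 : ℝ), τ ^ (σ - 1) / (1 + τ) ^ (2 * (N + 1)) with hB
  have hB0 : 0 ≤ B := setIntegral_nonneg measurableSet_Ioi fun τ hτ => by
    have : (0 : ℝ) < τ := hτ
    positivity
  have hb : ∀ θ, -1 < Real.cos θ → angInt (N + 1) σ θ ≤ (((1 + Real.cos θ) / 2) ^ (N + 1))⁻¹ * B := by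
    intro θ hc
    rw [angInt, hB, ← integral_const_mul]
    refine setIntegral_mono_on (integrableOn_angInt h0 h1 hc)
      ((integrableOn_rpow_div_one_add_pow h0 (by push_cast at h1 ⊢; exact h1)).const_mul _)
      measurableSet_Ioi fun τ hτ => rpow_div_quad_le (N + 1) σ hτ hc le_rfl
  have hle : angularLInt N σ ≤ ∫⁻ _θ in Set.Ioo 0 Real.pi, ENNReal.ofReal (4 ^ (N + 1) * B ^ 2) := by
    refine setLIntegral_mono' measurableSet_Ioo fun θ hθ => ?_
    have hc := neg_one_lt_cos hθ.1.le hθ.2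
    have hc' := neg_one_lt_cos (θ := Real.pi - θ) (by linarith [hθ.2]) (by linarith [hθ.1])
    have hs : 0 < Real.sin θ := Real.sin_pos_of_pos_of_lt_pi hθ.1 hθ.2
    rw [angLInt_eq h0 h1 hc, angLInt_eq h0 h1 hc']
    have h2 := hb _ hc'
    rw [Real.cos_pi_sub] at hc' h2
    have p1 : 0 < 1 + Real.cos θ := by linarith
    have p2 : 0 < 1 + -Real.cos θ := by linarith
    calc _ ≤ ENNReal.ofReal (Real.sin θ ^ (4 * N + 2)) *
          (ENNReal.ofReal ((((1 + Real.cos θ) / 2) ^ (N + 1))⁻¹ * B) *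
          ENNReal.ofReal ((((1 + -Real.cos θ) / 2) ^ (N + 1))⁻¹ * B)) := by
          gcongr
          exact hb _ hc
      _ = ENNReal.ofReal (Real.sin θ ^ (2 * N) * (4 ^ (N + 1) * B ^ 2)) := by
          rw [← ENNReal.ofReal_mul (by positivity), ← ENNReal.ofReal_mul (by positivity)]
          congr 1
          have e : Real.sin θ ^ 2 = (1 + Real.cos θ) * (1 + -Real.cos θ) := by
            linear_combination Real.sin_sq_add_cos_sq θ
          have e' : Real.sin θ ^ (4 * N + 2) = Real.sin θ ^ (2 * N) *
              ((1 + Real.cos θ) ^ (N + 1) * (1 + -Real.cos θ) ^ (N + 1)) := by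
            rw [← mul_pow, ← e]; ring
          have e4 : (4 : ℝ) ^ (N + 1) = 2 ^ (N + 1) * 2 ^ (N + 1) := by
            rw [← mul_pow]; norm_num
          rw [e', e4, div_pow, div_pow]
          field_simp
      _ ≤ _ := by
          refine ENNReal.ofReal_le_ofReal ?_
          refine mul_le_of_le_one_left (by positivity) ?_
          exact pow_le_one₀ hs.le (Real.sin_le_one θ)
  refine hle.trans_lt ?_
  rw [lintegral_const]
  exact ENNReal.mul_lt_top ENNReal.ofReal_lt_top (by simp)

lemma continuous_trigSum (N : ℕ) (ν : ℝ) : Continuous (trigSum N ν) := by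
  unfold trigSum; fun_prop

lemma angularLInt_eq (N : ℕ) {ν : ℝ} (h0 : 0 < ν) (h1 : ν < 1) :
    (angularLInt N (N + 1 - ν)).toReal =
      (Real.pi / Real.sin (Real.pi * ν) / (2 ^ N * N.factorial)) ^ 2 *
        ∫ θ in (0 : ℝ)..Real.pi, trigSum N ν θ * trigSum N ν (Real.pi - θ) := by
  have hN : (0 : ℝ) ≤ N := Nat.cast_nonneg N
  have hsin : 0 < Real.sin (Real.pi * ν) :=
    Real.sin_pos_of_pos_of_lt_pi (by positivity) (by nlinarith [Real.pi_pos])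
  set K := Real.pi / Real.sin (Real.pi * ν) / (2 ^ N * N.factorial) with hK
  have hK0 : 0 < K := by have := Real.pi_pos; positivity
  have hpos : ∀ θ ∈ Set.Ioo 0 Real.pi, 0 ≤ trigSum N ν θ := by
    intro θ hθ
    have h := sin_pow_mul_angInt h0 h1 N θ hθ
    have hs : 0 < Real.sin θ := Real.sin_pos_of_pos_of_lt_pi hθ.1 hθ.2
    have ha : 0 ≤ angInt (N + 1) (N + 1 - ν) θ :=
      setIntegral_nonneg measurableSet_Ioi fun τ hτ => by
        have hτ' : (0 : ℝ) < τ := hτ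
        have := quad_pos hτ'.le (neg_one_lt_cos hθ.1.le hθ.2)
        positivity
    have : 0 ≤ K * trigSum N ν θ := by rw [← h]; positivity
    exact nonneg_of_mul_nonneg_right this hK0
  have e : ∀ θ ∈ Set.Ioo 0 Real.pi, ENNReal.ofReal (Real.sin θ ^ (4 * N + 2)) *
      (angLInt (N + 1) (N + 1 - ν) θ * angLInt (N + 1) (N + 1 - ν) (Real.pi - θ)) =
      ENNReal.ofReal (K ^ 2 * (trigSum N ν θ * trigSum N ν (Real.pi - θ))) := by
    intro θ hθ
    have hθ' : Real.pi - θ ∈ Set.Ioo 0 Real.pi := ⟨by linarith [hθ.2], by linarith [hθ.1]⟩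
    have hs : 0 < Real.sin θ := Real.sin_pos_of_pos_of_lt_pi hθ.1 hθ.2
    have b0 : 0 < (N : ℝ) + 1 - ν := by linarith
    have b1 : (N : ℝ) + 1 - ν < 2 * (N + 1 : ℕ) := by push_cast; linarith
    rw [angLInt_eq b0 b1 (neg_one_lt_cos hθ.1.le hθ.2),
      angLInt_eq b0 b1 (neg_one_lt_cos hθ'.1.le hθ'.2)]
    have g1 := sin_pow_mul_angInt h0 h1 N θ hθ
    have g2 := sin_pow_mul_angInt h0 h1 N _ hθ'
    rw [Real.sin_pi_sub] at g2
    have p1 : angInt (N + 1) (N + 1 - ν) θ = K * trigSum N ν θ / Real.sin θ ^ (2 * N + 1) := by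
      rw [eq_div_iff (by positivity), ← g1]; ring
    have p2 : angInt (N + 1) (N + 1 - ν) (Real.pi - θ) =
        K * trigSum N ν (Real.pi - θ) / Real.sin θ ^ (2 * N + 1) := by
      rw [eq_div_iff (by positivity), ← g2]; ring
    have t1 := hpos θ hθ
    have t2 := hpos _ hθ'
    rw [p1, p2, ← ENNReal.ofReal_mul (by positivity), ← ENNReal.ofReal_mul (by positivity)]
    congr 1
    rw [show 4 * N + 2 = (2 * N + 1) + (2 * N + 1) by ring, pow_add]
    field_simp
  have hc := continuous_trigSum N ν
  rw [angularLInt, setLIntegral_congr_fun measurableSet_Ioo e,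
    ← integral_eq_lintegral_of_nonneg_ae]
  · rw [integral_const_mul, intervalIntegral.integral_of_le Real.pi_pos.le,
      integral_Ioc_eq_integral_Ioo]
  · filter_upwards [ae_restrict_mem measurableSet_Ioo] with θ hθ
    have t1 := hpos θ hθ
    have t2 := hpos (Real.pi - θ) ⟨by linarith [hθ.2], by linarith [hθ.1]⟩
    simp only [Pi.zero_apply]
    positivity
  · exact Continuous.aestronglyMeasurable (by fun_prop)

lemma mellin_differentiableAt_of_convergent {f : ℝ → ℂ} {a b : ℝ}
    (hf : AEStronglyMeasurable f (volume.restrict (Set.Ioi 0)))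
    (h : ∀ x : ℝ, a < x → x < b → MellinConvergent f x) {s : ℂ}
    (ha : a < s.re) (hb : s.re < b) : DifferentiableAt ℂ (mellin f) s := by
  set F : ℂ → ℝ → ℂ := fun (z : ℂ) (t : ℝ) => (t : ℂ) ^ (z - 1) • f t
  set F' : ℂ → ℝ → ℂ := fun (z : ℂ) (t : ℝ) => ((t : ℂ) ^ (z - 1) * Real.log t) • f t
  obtain ⟨v, hv0, hv1, hv2⟩ : ∃ v : ℝ, 0 < v ∧ a < s.re - 2 * v ∧ s.re + 2 * v < b := by
    refine ⟨min (s.re - a) (b - s.re) / 3, ?_, ?_, ?_⟩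
    · have := lt_min (sub_pos.2 ha) (sub_pos.2 hb); positivity
    · linarith [min_le_left (s.re - a) (b - s.re)]
    · linarith [min_le_right (s.re - a) (b - s.re)]
  have hnorm : ∀ x : ℝ, a < x → x < b →
      IntegrableOn (fun t : ℝ => t ^ (x - 1) * ‖f t‖) (Set.Ioi 0) := fun x hx hx' => by
    simpa using (mellin_convergent_iff_norm subset_rfl measurableSet_Ioi hf).1 (h x hx hx')
  have hcpow : ∀ z : ℂ, ContinuousOn (fun t : ℝ => (t : ℂ) ^ (z - 1)) (Set.Ioi 0) := fun z =>
    continuousOn_of_forall_continuousAt fun t ht =>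
      Complex.continuousAt_ofReal_cpow_const _ _ (Or.inr <| ne_of_gt ht)
  let bound : ℝ → ℝ := fun t : ℝ =>
    1 / v * (t ^ (s.re + 2 * v - 1) * ‖f t‖ + t ^ (s.re - 2 * v - 1) * ‖f t‖)
  have h1 : ∀ᶠ z : ℂ in 𝓝 s, AEStronglyMeasurable (F z) (volume.restrict <| Set.Ioi 0) :=
    Eventually.of_forall fun z =>
      ((hcpow z).aestronglyMeasurable measurableSet_Ioi).smul hf
  have h2 : IntegrableOn (F s) (Set.Ioi (0 : ℝ)) :=
    (mellin_convergent_iff_norm subset_rfl measurableSet_Ioi hf).2 (hnorm _ ha hb)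
  have h3 : AEStronglyMeasurable (F' s) (volume.restrict <| Set.Ioi 0) := by
    refine AEStronglyMeasurable.smul (ContinuousOn.aestronglyMeasurable
      ((hcpow s).mul (Complex.continuous_ofReal.comp_continuousOn
        (Real.continuousOn_log.mono ?_))) measurableSet_Ioi) hf
    exact Set.subset_compl_singleton_iff.mpr Set.self_notMem_Ioi
  have h4 : ∀ᵐ t : ℝ ∂volume.restrict (Set.Ioi 0),
      ∀ z : ℂ, z ∈ Metric.ball s v → ‖F' z t‖ ≤ bound t := by
    refine (ae_restrict_mem measurableSet_Ioi).mono fun t ht z hz => ?_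
    have ht0 : 0 < t := ht
    have hz' : |z.re - s.re| ≤ v := by
      rw [mem_ball_iff_norm] at hz
      simpa using (Complex.abs_re_le_norm (z - s)).trans hz.le
    obtain ⟨hz1, hz2⟩ := abs_le.1 hz'
    have key : t ^ (z.re - 1) * |Real.log t| ≤
        1 / v * (t ^ (s.re + 2 * v - 1) + t ^ (s.re - 2 * v - 1)) := by
      have p1 : 0 < t ^ (s.re + 2 * v - 1) := Real.rpow_pos_of_pos ht0 _
      have p2 : 0 < t ^ (s.re - 2 * v - 1) := Real.rpow_pos_of_pos ht0 _
      rcases le_or_gt 1 t with h | h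
      · rw [abs_of_nonneg (Real.log_nonneg h)]
        calc t ^ (z.re - 1) * Real.log t ≤ t ^ (s.re + v - 1) * (t ^ v / v) := by
              gcongr
              · exact Real.log_nonneg h
              · linarith
              · exact Real.log_le_rpow_div ht0.le hv0
          _ = 1 / v * t ^ (s.re + 2 * v - 1) := by
              rw [show s.re + 2 * v - 1 = (s.re + v - 1) + v by ring, Real.rpow_add ht0]; ring
          _ ≤ _ := by gcongr; linarith
      · rw [abs_of_neg (Real.log_neg ht0 h), ← Real.log_inv]
        calc t ^ (z.re - 1) * Real.log t⁻¹ ≤ t ^ (s.re - v - 1) * (t⁻¹ ^ v / v) := by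
              refine mul_le_mul (Real.rpow_le_rpow_of_exponent_ge ht0 h.le (by linarith))
                (Real.log_le_rpow_div (by positivity) hv0)
                (Real.log_nonneg ((one_le_inv₀ ht0).2 h.le)) (by positivity)
          _ = 1 / v * t ^ (s.re - 2 * v - 1) := by
              rw [show s.re - 2 * v - 1 = (s.re - v - 1) + -v by ring, Real.rpow_add ht0,
                Real.rpow_neg ht0.le, Real.inv_rpow ht0.le]; ring
          _ ≤ _ := by gcongr; linarith
    simp only [F', bound, norm_smul, norm_mul, Complex.norm_real, Real.norm_eq_abs]
    rw [Complex.norm_cpow_eq_rpow_re_of_pos ht0, ← add_mul, ← mul_assoc]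
    exact mul_le_mul_of_nonneg_right (by simpa using key) (norm_nonneg _)
  have h5 : IntegrableOn bound (Set.Ioi 0) :=
    ((hnorm _ (by linarith) hv2).add (hnorm _ hv1 (by linarith))).const_mul _
  have h6 : ∀ᵐ t : ℝ ∂volume.restrict (Set.Ioi 0),
      ∀ y : ℂ, y ∈ Metric.ball s v → HasDerivAt (fun z : ℂ => F z t) (F' y t) y := by
    refine (ae_restrict_mem measurableSet_Ioi).mono fun t ht y _ => ?_
    have ht' : (t : ℂ) ≠ 0 := Complex.ofReal_ne_zero.mpr (ne_of_gt ht)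
    have u1 : HasDerivAt (fun z : ℂ => (t : ℂ) ^ (z - 1)) (t ^ (y - 1) * Real.log t) y := by
      convert! ((hasDerivAt_id' y).sub_const 1).const_cpow (Or.inl ht') using 1
      rw [Complex.ofReal_log (le_of_lt ht)]
      ring
    exact u1.smul_const (f t)
  exact (hasDerivAt_integral_of_dominated_loc_of_deriv_le
    (Metric.ball_mem_nhds _ hv0) h1 h2 h3 h4 h5 h6).2.differentiableAt

lemma measurable_simplexLInt (N : ℕ) : Measurable (simplexLInt N) := by
  unfold simplexLInt simplexForm
  exact Measurable.lintegral_prod_right' (f := fun q : ℝ × ℝ × ℝ =>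
    ENNReal.ofReal ((q.2.1 * q.2.2 * (1 - q.2.1 - q.2.2)) ^ N /
      (q.2.1 * (1 - q.2.1 - q.2.2) * (1 + q.1) ^ 2 + q.2.1 * q.2.2 * q.1 ^ 2 +
        q.2.2 * (1 - q.2.1 - q.2.2)) ^ (N + 1))) (by fun_prop)

lemma Dbar_eq_simplexLInt (N : ℕ) {t : ℝ} (ht : 0 < t) :
    Dbar ((N + 1 : ℕ) : ℝ) (t / (1 + t)) * (t / (1 + t)) ^ (2 * (N + 1)) =
      N.factorial ^ 2 * t ^ (2 * (N + 1)) * (simplexLInt N t).toReal := by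
  have h1t : 0 < 1 + t := by linarith
  have hG : Real.Gamma ((N + 1 : ℕ) : ℝ) = N.factorial := by
    push_cast; exact Real.Gamma_nat_eq_factorial N
  have hD : Dbar ((N + 1 : ℕ) : ℝ) (t / (1 + t)) = ∫ p in simplex2,
      (N.factorial ^ 2 * (1 + t) ^ (2 * (N + 1))) *
        ((p.1 * p.2 * (1 - p.1 - p.2)) ^ N / simplexForm t p ^ (N + 1)) := by
    unfold Dbar DbarUV
    refine setIntegral_congr_fun measurableSet_simplex2 fun p hp => ?_
    have e1 : ((N + 1 : ℕ) : ℝ) - 1 = (N : ℝ) := by push_cast; ring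
    have e2 : (((N + 1 : ℕ) : ℝ) + ((N + 1 : ℕ) : ℝ) + ((N + 1 : ℕ) : ℝ) +
        ((N + 1 : ℕ) : ℝ)) / 2 - ((N + 1 : ℕ) : ℝ) = ((N + 1 : ℕ) : ℝ) := by ring
    have hq := simplexForm_pos ht hp
    have e3 : p.1 * (1 - p.1 - p.2) + p.1 * p.2 * (t / (1 + t)) ^ 2 +
        p.2 * (1 - p.1 - p.2) * (1 - t / (1 + t)) ^ 2 = simplexForm t p / (1 + t) ^ 2 := by
      unfold simplexForm; field_simp; ring
    simp only [e1, e2, e3, Real.rpow_natCast, hG]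
    rw [div_pow, ← pow_mul, mul_pow, mul_pow]
    field_simp
  rw [hD, integral_const_mul, integral_eq_lintegral_of_nonneg_ae, simplexLInt, div_pow]
  · field_simp
  · refine (ae_restrict_mem measurableSet_simplex2).mono fun p hp => ?_
    have hq := simplexForm_pos ht hp
    obtain ⟨h1, h2, h3⟩ := hp
    have h4 : 0 < 1 - p.1 - p.2 := by linarith
    simp only [Pi.zero_apply]; positivity
  · unfold simplexForm
    exact Measurable.aestronglyMeasurable (by fun_prop)

lemma lintegral_rpow_mul_simplexLInt_lt_top (N : ℕ) {σ : ℝ} (h0 : 0 < σ)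
    (h1 : σ < 2 * (N + 1 : ℕ)) :
    ∫⁻ t in Set.Ioi (0 : ℝ), ENNReal.ofReal (t ^ (σ - 1)) * simplexLInt N t < ⊤ := by
  have hΓ : 0 < Real.Gamma (2 * N + 3 / 2) := Real.Gamma_pos_of_pos (by positivity)
  have hc : 0 < √Real.pi * Real.Gamma (2 * N + 3 / 2) / 2 / N.factorial ^ 2 := by
    have := Real.pi_pos
    positivity
  have h := angularLInt_lt_top N h0 h1
  rw [← simplexLInt_mellin] at h
  exact ENNReal.lt_top_of_mul_ne_top_right h.ne (by simpa using hc)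

lemma integrableOn_rpow_mul_simplexLInt (N : ℕ) {σ : ℝ} (h0 : 0 < σ)
    (h1 : σ < 2 * (N + 1 : ℕ)) :
    IntegrableOn (fun t : ℝ => t ^ (σ - 1) * (simplexLInt N t).toReal) (Set.Ioi 0) ∧
    ∫ t in Set.Ioi (0 : ℝ), t ^ (σ - 1) * (simplexLInt N t).toReal =
      (∫⁻ t in Set.Ioi (0 : ℝ), ENNReal.ofReal (t ^ (σ - 1)) * simplexLInt N t).toReal := by
  have hm : Measurable fun t : ℝ => ENNReal.ofReal (t ^ (σ - 1)) * simplexLInt N t := by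
    have := measurable_simplexLInt N
    fun_prop
  have hfin := (lintegral_rpow_mul_simplexLInt_lt_top N h0 h1).ne
  have he : ∀ t ∈ Set.Ioi (0 : ℝ),
      (ENNReal.ofReal (t ^ (σ - 1)) * simplexLInt N t).toReal =
        t ^ (σ - 1) * (simplexLInt N t).toReal := fun t ht => by
    rw [ENNReal.toReal_mul, ENNReal.toReal_ofReal (Real.rpow_nonneg (le_of_lt ht) _)]
  refine ⟨(integrableOn_congr_fun he measurableSet_Ioi).1
    (integrable_toReal_of_lintegral_ne_top hm.aemeasurable hfin), ?_⟩
  rw [← integral_toReal hm.aemeasurable (ae_lt_top hm hfin)]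
  exact setIntegral_congr_fun measurableSet_Ioi fun t ht => (he t ht).symm

lemma DbarIntegrand_eq (N : ℕ) {t : ℝ} (ht : 0 < t) :
    DbarIntegrand (N + 1) t =
      ((N.factorial ^ 2 * t ^ (2 * (N + 1)) * (simplexLInt N t).toReal : ℝ) : ℂ) := by
  rw [← Dbar_eq_simplexLInt N ht]; rfl

lemma aestronglyMeasurable_DbarIntegrand (N : ℕ) :
    AEStronglyMeasurable (DbarIntegrand (N + 1)) (volume.restrict (Set.Ioi 0)) := by
  have hm : Measurable fun t : ℝ =>
      ((N.factorial ^ 2 * t ^ (2 * (N + 1)) * (simplexLInt N t).toReal : ℝ) : ℂ) := by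
    have := measurable_simplexLInt N
    fun_prop
  refine hm.aestronglyMeasurable.congr ?_
  filter_upwards [ae_restrict_mem measurableSet_Ioi] with t ht
  exact (DbarIntegrand_eq N ht).symm

lemma rpow_mul_pow_eq (N : ℕ) (x c y : ℝ) {t : ℝ} (ht : 0 < t) :
    t ^ (-x - 1) * (c * t ^ (2 * (N + 1)) * y) =
      c * (t ^ ((2 * (N + 1 : ℕ) - x) - 1) * y) := by
  rw [← Real.rpow_natCast t (2 * (N + 1)),
    show (2 * (N + 1 : ℕ) - x) - 1 = (-x - 1) + ((2 * (N + 1) : ℕ) : ℝ) by push_cast; ring,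
    Real.rpow_add ht]
  ring

lemma mellinConvergent_DbarIntegrand (N : ℕ) {s : ℂ} (h0 : 0 < s.re)
    (h1 : s.re < 2 * (N + 1 : ℕ)) : MellinConvergent (DbarIntegrand (N + 1)) (-s) := by
  refine (mellin_convergent_iff_norm subset_rfl measurableSet_Ioi
    (aestronglyMeasurable_DbarIntegrand N)).2 ?_
  have hi := (integrableOn_rpow_mul_simplexLInt N (σ := 2 * (N + 1 : ℕ) - s.re)
    (by linarith) (by linarith)).1.const_mul ((N.factorial : ℝ) ^ 2)
  refine (integrableOn_congr_fun (fun t ht => ?_) measurableSet_Ioi).1 hi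
  have ht0 : (0 : ℝ) < t := ht
  rw [DbarIntegrand_eq N ht, Complex.norm_real, Real.norm_of_nonneg (by positivity),
    Complex.neg_re, rpow_mul_pow_eq N _ _ _ ht0]

lemma Mhat_ofReal (N : ℕ) {x : ℝ} (h0 : 0 < x) (h1 : x < 2 * (N + 1 : ℕ)) :
    Mhat (N + 1) x = ((N.factorial ^ 2 * (∫⁻ t in Set.Ioi (0 : ℝ),
      ENNReal.ofReal (t ^ ((2 * (N + 1 : ℕ) - x) - 1)) * simplexLInt N t).toReal : ℝ) : ℂ) := by
  rw [← (integrableOn_rpow_mul_simplexLInt N (by linarith) (by linarith)).2,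
    ← integral_const_mul, ← integral_complex_ofReal, Mhat, mellin]
  refine setIntegral_congr_fun measurableSet_Ioi fun t ht => ?_
  have ht0 : (0 : ℝ) < t := ht
  rw [DbarIntegrand_eq N ht0, ← rpow_mul_pow_eq N _ _ _ ht0, Complex.ofReal_mul (t ^ (-x - 1)),
    Complex.ofReal_cpow ht0.le, smul_eq_mul]
  push_cast
  rfl

lemma Gamma_two_mul_add_three_halves (N : ℕ) :
    √Real.pi * Real.Gamma (2 * N + 3 / 2) =
      Real.pi * (Nat.doubleFactorial (4 * N + 1) : ℝ) / (2 * 4 ^ N) := by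
  have h := Real.Gamma_nat_add_half (2 * N + 1)
  rw [show 2 * (2 * N + 1) - 1 = 4 * N + 1 by omega] at h
  rw [show (2 * N + 3 / 2 : ℝ) = ((2 * N + 1 : ℕ) : ℝ) + 1 / 2 by push_cast; ring, h,
    pow_succ, pow_mul]
  norm_num
  rw [← mul_div_assoc, mul_comm (√Real.pi), mul_assoc, Real.mul_self_sqrt Real.pi_pos.le]
  ring

lemma pReal_eq_doubleFactorial (N : ℕ) (ν : ℝ) :
    pReal N ν =
      2 * N.factorial ^ 2 / (Nat.doubleFactorial (4 * N + 1) : ℝ) * trigNormSq N ν := by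
  rw [pReal_eq_trigNormSq]
  congr 1
  have h1 := Nat.factorial_eq_mul_doubleFactorial (4 * N + 1)
  rw [show 4 * N + 1 + 1 = 2 * (2 * N + 1) by ring, Nat.doubleFactorial_two_mul] at h1
  have h2 := Nat.choose_mul_factorial_mul_factorial
    (show 2 * N + 1 ≤ 2 * (2 * N + 1) by omega)
  rw [show 2 * (2 * N + 1) - (2 * N + 1) = 2 * N + 1 by omega, h1, pow_succ, pow_mul] at h2
  have h3 : (((2 * (2 * N + 1)).choose (2 * N + 1) : ℕ) : ℝ) * (2 * N + 1).factorial *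
      (2 * N + 1).factorial = 4 ^ N * 2 * (2 * N + 1).factorial *
        (Nat.doubleFactorial (4 * N + 1) : ℝ) := by exact_mod_cast h2
  have p1 : (0 : ℝ) < (2 * N + 1).factorial := by exact_mod_cast Nat.factorial_pos _
  have p2 : (0 : ℝ) < (((2 * (2 * N + 1)).choose (2 * N + 1) : ℕ) : ℝ) := by
    exact_mod_cast Nat.choose_pos (by omega)
  have p3 : (0 : ℝ) < (Nat.doubleFactorial (4 * N + 1) : ℝ) := by
    exact_mod_cast Nat.doubleFactorial_pos _
  have h4 := mul_right_cancel₀ p1.ne' (h3.trans (by ring :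
    _ = (4 ^ N * 2 * (Nat.doubleFactorial (4 * N + 1) : ℝ)) * (2 * N + 1).factorial))
  rw [div_eq_div_iff (by positivity) p3.ne']
  linear_combination (-2 * (N.factorial : ℝ) ^ 2) * h4

/-- The Mellin transform on the unit interval to the right of the centre of the strip. -/
lemma Mhat_real_eq (N : ℕ) {ν : ℝ} (h0 : 0 < ν) (h1 : ν < 1) :
    Mhat (N + 1) ((N + 1 + ν : ℝ) : ℂ) = ((Real.pi / ((-1) ^ (N + 1) * Real.sin (Real.pi * ν)) *
      (Real.pi * (Real.cos (Real.pi * ν) / Real.sin (Real.pi * ν)) * pReal N ν -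
        ∑ n ∈ Finset.range (2 * N + 1), pReal N (n - N) / (ν - (n - N))) : ℝ) : ℂ) := by
  have hN : (0 : ℝ) ≤ N := Nat.cast_nonneg N
  rw [Mhat_ofReal N (by linarith) (by push_cast; linarith)]
  congr 1
  rw [show 2 * ((N + 1 : ℕ) : ℝ) - (N + 1 + ν) = N + 1 - ν by push_cast; ring]
  have hM := congrArg ENNReal.toReal (simplexLInt_mellin N (N + 1 - ν))
  have hν : ∀ m : ℤ, ν ≠ m := by
    rintro m rfl
    have a1 : (0 : ℤ) < m := by exact_mod_cast h0
    have a2 : m < (1 : ℤ) := by exact_mod_cast h1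
    omega
  rw [ENNReal.toReal_mul, Gamma_two_mul_add_three_halves, ENNReal.toReal_ofReal (by positivity),
    angularLInt_eq N h0 h1, integral_trigSum_mul_reflect N hν] at hM
  set X := (∫⁻ t in Set.Ioi (0 : ℝ),
    ENNReal.ofReal (t ^ ((N + 1 - ν : ℝ) - 1)) * simplexLInt N t).toReal
  have hS : ∑ n ∈ Finset.range (2 * N + 1), pReal N (n - N) / (ν - (n - N)) =
      2 * N.factorial ^ 2 / (Nat.doubleFactorial (4 * N + 1) : ℝ) *
        ∑ n ∈ Finset.range (2 * N + 1), trigNormSq N (n - N) / (ν - (n - N)) := by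
    rw [Finset.mul_sum]
    exact Finset.sum_congr rfl fun n _ => by rw [pReal_eq_doubleFactorial, mul_div_assoc]
  rw [hS, pReal_eq_doubleFactorial]
  set S := ∑ n ∈ Finset.range (2 * N + 1), trigNormSq N (n - N) / (ν - (n - N))
  have hsin : 0 < Real.sin (Real.pi * ν) :=
    Real.sin_pos_of_pos_of_lt_pi (by have := Real.pi_pos; positivity)
      (by nlinarith [Real.pi_pos])
  have p3 : (0 : ℝ) < (Nat.doubleFactorial (4 * N + 1) : ℝ) := by
    exact_mod_cast Nat.doubleFactorial_pos _
  have p4 : (0 : ℝ) < N.factorial := by exact_mod_cast Nat.factorial_pos _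
  have hpi := Real.pi_pos
  have hX : X = 2 * (2 * 4 ^ N) * N.factorial ^ 2 / (Real.pi * (4 * N + 1).doubleFactorial) *
      ((Real.pi / Real.sin (Real.pi * ν) / (2 ^ N * N.factorial)) ^ 2 *
        (1 / 2 * (-1) ^ N * (Real.sin (Real.pi * ν) * S -
          Real.pi * Real.cos (Real.pi * ν) * trigNormSq N ν))) := by
    rw [← hM]; field_simp
  have h4 : (4 : ℝ) ^ N = 2 ^ N * 2 ^ N := by rw [← mul_pow]; norm_num
  have hsq : ((-1 : ℝ) ^ N) * (-1) ^ N = 1 := by rw [← mul_pow]; norm_num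
  have hinv : Real.pi / ((-1) ^ (N + 1) * Real.sin (Real.pi * ν)) =
      Real.pi * (-(-1) ^ N) / Real.sin (Real.pi * ν) := by
    rw [div_eq_div_iff (mul_ne_zero (by simp) hsin.ne') hsin.ne']
    linear_combination (-Real.pi * Real.sin (Real.pi * ν)) * hsq
  rw [hX, h4, hinv]
  field_simp
  ring

lemma PDelta_succ_eq (N : ℕ) (s : ℂ) :
    PDelta (N + 1) s = ∑ n ∈ Finset.range (N + 1), (pCoeff N n : ℂ) *
      ((ascPochhammer ℂ n).eval (2 * (N + 1 : ℕ) - s) * (ascPochhammer ℂ n).eval s) := by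
  rw [PDelta, Finset.mul_sum]
  refine Finset.sum_congr rfl fun n hn => ?_
  have hnN : n ≤ N := by simpa [Nat.lt_succ_iff] using hn
  have g1 : Complex.Gamma (2 * n + 1) = (2 * n).factorial := by
    simpa using Complex.Gamma_nat_eq_factorial (2 * n)
  have g2 : Complex.Gamma ((N + 1 : ℕ) : ℂ) = N.factorial := by
    simpa using Complex.Gamma_nat_eq_factorial N
  have g3 : Complex.Gamma ((N + 1 : ℕ) + n) = (N + n).factorial := by
    rw [← Complex.Gamma_nat_eq_factorial]; push_cast; ring_nf
  have g4 : Complex.Gamma ((N + 1 : ℕ) - n) = (N - n).factorial := by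
    rw [← Complex.Gamma_nat_eq_factorial]; push_cast [hnN]; ring_nf
  have g5 : Complex.Gamma (2 * ((N + 1 : ℕ) + n)) = (2 * (N + n) + 1).factorial := by
    rw [← Complex.Gamma_nat_eq_factorial]; push_cast; ring_nf
  rw [g1, g2, g3, g4, g5, Complex.Gamma_nat_eq_factorial, pCoeff]
  push_cast
  ring

lemma ofReal_ascPochhammer_eval (n : ℕ) (x : ℝ) :
    (((ascPochhammer ℝ n).eval x : ℝ) : ℂ) = (ascPochhammer ℂ n).eval (x : ℂ) := by
  rw [← ascPochhammer_map Complex.ofRealHom n, Polynomial.eval_map]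
  exact (Polynomial.eval₂_at_apply Complex.ofRealHom x).symm

lemma PDelta_ofReal (N : ℕ) (ν : ℝ) :
    PDelta (N + 1) ((N + 1 + ν : ℝ) : ℂ) = (pReal N ν : ℂ) := by
  rw [PDelta_succ_eq, pReal, Complex.ofReal_sum]
  refine Finset.sum_congr rfl fun n _ => ?_
  rw [Complex.ofReal_mul, wilsonBasis, Complex.ofReal_mul, ofReal_ascPochhammer_eval,
    ofReal_ascPochhammer_eval]
  push_cast
  ring_nf

lemma MhatClosed_ofReal (N : ℕ) (ν : ℝ) :
    MhatClosed (N + 1) ((N + 1 + ν : ℝ) : ℂ) =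
      ((Real.pi / ((-1) ^ (N + 1) * Real.sin (Real.pi * ν)) *
      (Real.pi * (Real.cos (Real.pi * ν) / Real.sin (Real.pi * ν)) * pReal N ν -
        ∑ n ∈ Finset.range (2 * N + 1), pReal N (n - N) / (ν - (n - N))) : ℝ) : ℂ) := by
  have e : Real.pi * (N + 1 + ν) = Real.pi * ν + (N + 1 : ℕ) * Real.pi := by push_cast; ring
  have hs : Complex.sin (Real.pi * ((N + 1 + ν : ℝ) : ℂ)) =
      (((-1) ^ (N + 1) * Real.sin (Real.pi * ν) : ℝ) : ℂ) := by
    rw [← Complex.ofReal_mul, ← Complex.ofReal_sin, e, Real.sin_add_nat_mul_pi]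
  have hc : Complex.cos (Real.pi * ((N + 1 + ν : ℝ) : ℂ)) =
      (((-1) ^ (N + 1) * Real.cos (Real.pi * ν) : ℝ) : ℂ) := by
    rw [← Complex.ofReal_mul, ← Complex.ofReal_cos, e, Real.cos_add_nat_mul_pi]
  have hI : Finset.Icc 1 (2 * (N + 1) - 1) = Finset.Ico 1 (2 * N + 2) := by
    ext; simp only [Finset.mem_Icc, Finset.mem_Ico]; omega
  have hsum : ∑ k ∈ Finset.Icc 1 (2 * (N + 1) - 1),
      PDelta (N + 1) k / (((N + 1 + ν : ℝ) : ℂ) - k) =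
      ((∑ n ∈ Finset.range (2 * N + 1), pReal N (n - N) / (ν - (n - N)) : ℝ) : ℂ) := by
    rw [hI, Finset.sum_Ico_eq_sum_range, Complex.ofReal_sum]
    refine Finset.sum_congr rfl fun n _ => ?_
    rw [Complex.ofReal_div, ← PDelta_ofReal]
    congr 1
    · congr 1; push_cast; ring
    · push_cast; ring
  rw [MhatClosed, Complex.cot, hs, hc, hsum, PDelta_ofReal]
  have h1 : ((-1 : ℝ)) ^ (N + 1) ≠ 0 := by simp
  rw [← Complex.ofReal_div (_ * _), mul_div_mul_left _ _ h1]
  push_cast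
  rfl

lemma Mhat_eq_MhatClosed_ofReal (N : ℕ) {x : ℝ} (h0 : N + 1 < x) (h1 : x < N + 2) :
    Mhat (N + 1) (x : ℂ) = MhatClosed (N + 1) x := by
  obtain ⟨ν, rfl⟩ : ∃ ν, x = N + 1 + ν := ⟨x - (N + 1), by ring⟩
  rw [MhatClosed_ofReal, Mhat_real_eq N (by linarith) (by linarith)]

lemma differentiable_PDelta (N : ℕ) : Differentiable ℂ (PDelta (N + 1)) := by
  have : PDelta (N + 1) = fun s : ℂ => ∑ n ∈ Finset.range (N + 1), (pCoeff N n : ℂ) *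
      ((ascPochhammer ℂ n).eval (2 * (N + 1 : ℕ) - s) * (ascPochhammer ℂ n).eval s) :=
    funext (PDelta_succ_eq N)
  rw [this]
  refine Differentiable.fun_sum fun n _ => Differentiable.const_mul (Differentiable.mul ?_ ?_) _
  · exact (ascPochhammer ℂ n).differentiable.comp (differentiable_id.const_sub _)
  · exact (ascPochhammer ℂ n).differentiable

lemma differentiableAt_Mhat (N : ℕ) {s : ℂ} (h0 : 0 < s.re) (h1 : s.re < 2 * (N + 1 : ℕ)) :
    DifferentiableAt ℂ (Mhat (N + 1)) s := by
  have h : DifferentiableAt ℂ (mellin (DbarIntegrand (N + 1))) (-s) :=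
    mellin_differentiableAt_of_convergent (aestronglyMeasurable_DbarIntegrand N)
      (a := -(2 * (N + 1 : ℕ))) (b := 0)
      (fun x hx hx' => by
        have := mellinConvergent_DbarIntegrand N (s := ((-x : ℝ) : ℂ))
          (by rw [Complex.ofReal_re]; linarith) (by rw [Complex.ofReal_re]; linarith)
        simpa using this)
      (by rw [Complex.neg_re]; linarith) (by rw [Complex.neg_re]; linarith)
  exact DifferentiableAt.comp s h differentiableAt_id.neg

lemma complex_sin_pi_mul_ne_zero {s : ℂ} (hs : ∀ m : ℤ, s ≠ m) :
    Complex.sin (Real.pi * s) ≠ 0 :=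
  sin_pi_mul_ne_zero fun ⟨m, hm⟩ => hs m hm.symm

/-- `MhatClosed` multiplied by `sin (π s)² ∏ₖ (s - k)`, as an entire function. -/
noncomputable def clearedMhat (Δ : ℕ) (s : ℂ) : ℂ :=
  Real.pi ^ 2 * Complex.cos (Real.pi * s) * PDelta Δ s *
      ∏ k ∈ Finset.Icc 1 (2 * Δ - 1), (s - k) -
    Real.pi * Complex.sin (Real.pi * s) * ∑ k ∈ Finset.Icc 1 (2 * Δ - 1),
      PDelta Δ k * ∏ j ∈ (Finset.Icc 1 (2 * Δ - 1)).erase k, (s - j)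

lemma mul_MhatClosed_eq_clearedMhat (Δ : ℕ) {s : ℂ} (hs : ∀ m : ℤ, s ≠ m) :
    Complex.sin (Real.pi * s) ^ 2 * (∏ k ∈ Finset.Icc 1 (2 * Δ - 1), (s - k)) *
      MhatClosed Δ s = clearedMhat Δ s := by
  have hsin := complex_sin_pi_mul_ne_zero hs
  have hsum : ∑ k ∈ Finset.Icc 1 (2 * Δ - 1),
      PDelta Δ k * ∏ j ∈ (Finset.Icc 1 (2 * Δ - 1)).erase k, (s - j) =
      (∏ k ∈ Finset.Icc 1 (2 * Δ - 1), (s - k)) *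
        ∑ k ∈ Finset.Icc 1 (2 * Δ - 1), PDelta Δ k / (s - k) := by
    rw [Finset.mul_sum]
    refine Finset.sum_congr rfl fun k hk => ?_
    have hk0 : s - k ≠ 0 := sub_ne_zero.2 (by simpa using hs k)
    rw [← Finset.mul_prod_erase _ _ hk]
    field_simp
  rw [clearedMhat, hsum, MhatClosed, Complex.cot]
  field_simp

lemma differentiable_clearedMhat (N : ℕ) : Differentiable ℂ (clearedMhat (N + 1)) := by
  have := differentiable_PDelta N
  unfold clearedMhat
  fun_prop

lemma Mhat_eq_MhatClosed (N : ℕ) {s : ℂ} (h0 : 0 < s.re) (h1 : s.re < 2 * (N + 1 : ℕ))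
    (hs : ∀ m : ℤ, s ≠ m) : Mhat (N + 1) s = MhatClosed (N + 1) s := by
  set U : Set ℂ := {z | 0 < z.re ∧ z.re < 2 * (N + 1 : ℕ)} with hU
  have hUo : IsOpen U := (isOpen_lt continuous_const Complex.continuous_re).inter
    (isOpen_lt Complex.continuous_re continuous_const)
  have hUc : IsPreconnected U := ((convex_halfSpace_re_gt 0).inter
    (convex_halfSpace_re_lt (2 * (N + 1 : ℕ)))).isPreconnected
  set D : ℂ → ℂ := fun z =>
    Complex.sin (Real.pi * z) ^ 2 * ∏ k ∈ Finset.Icc 1 (2 * (N + 1) - 1), (z - k)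
  have hD : Differentiable ℂ D := by fun_prop
  have hf : AnalyticOnNhd ℂ (fun z => D z * Mhat (N + 1) z) U :=
    DifferentiableOn.analyticOnNhd (fun z hz =>
      (hD.differentiableAt.mul (differentiableAt_Mhat N hz.1 hz.2)).differentiableWithinAt) hUo
  have hg : AnalyticOnNhd ℂ (clearedMhat (N + 1)) U :=
    (differentiable_clearedMhat N).differentiableOn.analyticOnNhd hUo
  have hN : (0 : ℝ) ≤ N := Nat.cast_nonneg N
  set x₀ : ℝ := N + 3 / 2 with hx₀
  have hx₀U : (x₀ : ℂ) ∈ U :=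
    ⟨by rw [Complex.ofReal_re]; positivity, by rw [Complex.ofReal_re]; push_cast; linarith⟩
  have hfreq : ∃ᶠ z in 𝓝[≠] (x₀ : ℂ), D z * Mhat (N + 1) z = clearedMhat (N + 1) z := by
    have ht : Tendsto (fun x : ℝ => (x : ℂ)) (𝓝[≠] x₀) (𝓝[≠] (x₀ : ℂ)) :=
      Complex.continuous_ofReal.continuousAt.continuousWithinAt.tendsto_nhdsWithin
        fun x hx => by simpa using hx
    refine ht.frequently (Eventually.frequently (eventually_nhdsWithin_of_eventually_nhds ?_))
    filter_upwards [Ioo_mem_nhds (show (N : ℝ) + 1 < x₀ by linarith)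
      (show x₀ < (N : ℝ) + 2 by linarith)] with x hx
    rw [Mhat_eq_MhatClosed_ofReal N hx.1 hx.2]
    refine mul_MhatClosed_eq_clearedMhat (N + 1) fun m hm => ?_
    have hm' : x = m := by exact_mod_cast hm
    rw [hm'] at hx
    have a1 : ((N : ℤ) + 1) < m := by exact_mod_cast hx.1
    have a2 : m < (N : ℤ) + 2 := by exact_mod_cast hx.2
    omega
  have heq := hf.eqOn_of_preconnected_of_frequently_eq hg hUc hx₀U hfreq (⟨h0, h1⟩ : s ∈ U)
  simp only at heq
  rw [← mul_MhatClosed_eq_clearedMhat (N + 1) hs] at heq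
  refine mul_left_cancel₀ (mul_ne_zero (pow_ne_zero 2 (complex_sin_pi_mul_ne_zero hs)) ?_) heq
  exact Finset.prod_ne_zero_iff.2 fun k _ => sub_ne_zero.2 (by simpa using hs k)

lemma tendsto_MhatClosed (N : ℕ) {m : ℕ} (hm : m ∈ Finset.Icc 1 (2 * (N + 1) - 1)) :
    Tendsto (MhatClosed (N + 1)) (𝓝[≠] (m : ℂ)) (𝓝 (Mhat (N + 1) m)) := by
  obtain ⟨hm1, hm2⟩ := Finset.mem_Icc.1 hm
  have h0 : 0 < (m : ℂ).re := by simpa [Nat.pos_iff_ne_zero, Nat.one_le_iff_ne_zero] using hm1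
  have h1 : (m : ℂ).re < 2 * (N + 1 : ℕ) := by
    rw [Complex.natCast_re]; exact_mod_cast (by omega : m < 2 * (N + 1))
  have hc : Tendsto (Mhat (N + 1)) (𝓝[≠] (m : ℂ)) (𝓝 (Mhat (N + 1) m)) :=
    (differentiableAt_Mhat N h0 h1).continuousAt.tendsto.mono_left nhdsWithin_le_nhds
  refine hc.congr' ?_
  filter_upwards [self_mem_nhdsWithin, nhdsWithin_le_nhds (Metric.ball_mem_nhds (m : ℂ) one_pos),
    nhdsWithin_le_nhds (Complex.continuous_re.continuousAt.preimage_mem_nhds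
      (Ioo_mem_nhds h0 h1))] with s hs hb hr
  refine Mhat_eq_MhatClosed N hr.1 hr.2 fun j hj => hs ?_
  rw [hj, Metric.mem_ball, Complex.dist_eq, ← Int.cast_natCast m, ← Int.cast_sub,
    Complex.norm_intCast] at hb
  have hb' : |j - (m : ℤ)| < 1 := by exact_mod_cast hb
  rw [Int.abs_lt_one_iff, sub_eq_zero] at hb'
  rw [hj, hb']; simp

lemma pCoeff_mul_eq_regularizedHGFunCoeff (N : ℕ) (s : ℂ) {n : ℕ} (hn : n ≤ N) :
    (pCoeff N n : ℂ) *
      ((ascPochhammer ℂ n).eval (2 * (N + 1 : ℕ) - s) * (ascPochhammer ℂ n).eval s) =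
    2 * (Complex.Gamma (N + 1 : ℕ) ^ 4 / Complex.Gamma (2 * (N + 1 : ℕ))) *
      (Complex.Gamma ((N + 1 : ℕ) + 1 / 2) *
        Complex.regularizedHGFunCoeff {1 / 2, s, 1 - ((N + 1 : ℕ) : ℂ), 2 * (N + 1 : ℕ) - s}
          {1, 1, ((N + 1 : ℕ) : ℂ) + 1 / 2} n) := by
  induction n with
  | zero =>
    have hΓ : Complex.Gamma ((N + 1 : ℕ) + 1 / 2) ≠ 0 :=
      Complex.Gamma_ne_zero_of_re_pos (by simp; positivity)
    have g2 : Complex.Gamma ((N + 1 : ℕ) : ℂ) = N.factorial := by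
      simpa using Complex.Gamma_nat_eq_factorial N
    have g5 : Complex.Gamma (2 * ((N + 1 : ℕ))) = (2 * N + 1).factorial := by
      rw [← Complex.Gamma_nat_eq_factorial]; push_cast; ring_nf
    have hN : (N.factorial : ℂ) ≠ 0 := by exact_mod_cast N.factorial_ne_zero
    have hN2 : ((2 * N + 1).factorial : ℂ) ≠ 0 := by exact_mod_cast Nat.factorial_ne_zero _
    rw [g2, g5]
    simp only [pCoeff, Complex.regularizedHGFunCoeff, ascPochhammer_zero, Polynomial.eval_one,
      Multiset.insert_eq_cons, Multiset.map_cons, Multiset.map_singleton, Multiset.prod_cons,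
      Multiset.prod_singleton, Nat.cast_zero, add_zero, Complex.Gamma_one, mul_one, one_mul,
      Nat.factorial_zero, Nat.cast_one, mul_zero, Nat.sub_zero]
    rw [mul_one_div_cancel hΓ]
    push_cast
    field_simp
  | succ n ih =>
    have ih := ih (by omega)
    have hrec := pCoeff_succ N n (by omega)
    have hrecC : (pCoeff N (n + 1) : ℂ) * ((n + 1) ^ 3 * (2 * N + 2 * n + 3)) =
        pCoeff N n * ((2 * n + 1) * (n - N)) := by exact_mod_cast congrArg Complex.ofReal hrec
    have h1 : (n : ℂ) + 1 ≠ 0 := by exact_mod_cast Nat.succ_ne_zero n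
    have h2 : (2 * N + 2 * n + 3 : ℂ) ≠ 0 := by
      exact_mod_cast (by omega : 2 * N + 2 * n + 3 ≠ 0)
    have hb : ∀ k ∈ ({1, 1, ((N + 1 : ℕ) : ℂ) + 1 / 2} : Multiset ℂ), k ≠ -n := by
      intro k hk h
      simp only [Multiset.insert_eq_cons, Multiset.mem_cons, Multiset.mem_singleton] at hk
      rcases hk with rfl | rfl | rfl
      · exact h1 (by linear_combination h)
      · exact h1 (by linear_combination h)
      · exact h2 (by push_cast at h; linear_combination 2 * h)
    rw [Complex.regularizedHGFunCoeff_add_one hb, ascPochhammer_succ_eval,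
      ascPochhammer_succ_eval]
    simp only [Multiset.insert_eq_cons, Multiset.map_cons, Multiset.map_singleton,
      Multiset.prod_cons, Multiset.prod_singleton] at ih ⊢
    have hp : (pCoeff N (n + 1) : ℂ) =
        pCoeff N n * ((2 * n + 1) * (n - N)) / ((n + 1) ^ 3 * (2 * N + 2 * n + 3)) := by
      rw [eq_div_iff (mul_ne_zero (pow_ne_zero 3 h1) h2), hrecC]
    have hc : (1 / 2 + (n : ℂ)) * ((s + n) * ((1 - ((N + 1 : ℕ) : ℂ) + n) *
          (2 * ((N + 1 : ℕ) : ℂ) - s + n))) /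
        ((1 + (n : ℂ)) * ((1 + n) * (((N + 1 : ℕ) : ℂ) + 1 / 2 + n)) * (n + 1)) =
        ((2 * n + 1) * (n - N)) / ((n + 1) ^ 3 * (2 * N + 2 * n + 3)) *
          ((2 * ((N + 1 : ℕ) : ℂ) - s + n) * (s + n)) := by
      have h3 : (((N + 1 : ℕ) : ℂ) + 1 / 2 + n) ≠ 0 := fun h =>
        h2 (by push_cast at h; linear_combination 2 * h)
      have h4 : 1 + (n : ℂ) ≠ 0 := by rwa [add_comm]
      rw [div_mul_eq_mul_div, div_eq_div_iff (by positivity) (by positivity)]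
      push_cast
      ring
    rw [hc, hp]
    linear_combination (((2 * n + 1) * (n - N)) / ((n + 1) ^ 3 * (2 * N + 2 * n + 3)) *
          ((2 * ((N + 1 : ℕ) : ℂ) - s + n) * (s + n))) * ih

lemma PDelta_eq_hypergeometricF (N : ℕ) (s : ℂ) :
    PDelta (N + 1) s =
      2 * (Complex.Gamma (N + 1 : ℕ) ^ 4 / Complex.Gamma (2 * (N + 1 : ℕ))) *
        hypergeometricF {1 / 2, s, 1 - ((N + 1 : ℕ) : ℂ), 2 * (N + 1 : ℕ) - s}
          {1, 1, ((N + 1 : ℕ) : ℂ) + 1 / 2} 1 := by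
  set a : Multiset ℂ := {1 / 2, s, 1 - ((N + 1 : ℕ) : ℂ), 2 * (N + 1 : ℕ) - s} with ha
  set b : Multiset ℂ := {1, 1, ((N + 1 : ℕ) : ℂ) + 1 / 2} with hb
  have hprod : (b.map Complex.Gamma).prod = Complex.Gamma ((N + 1 : ℕ) + 1 / 2) := by
    simp [hb]
  have hsum : Complex.regularizedHGFun a b 1 =
      ∑ n ∈ Finset.range (N + 1), Complex.regularizedHGFunCoeff a b n := by
    have : Complex.regularizedHGFun a b 1 = ∑' n, Complex.regularizedHGFunCoeff a b n := by
      have := FormalMultilinearSeries.ofScalars_sum_eq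
        (Complex.regularizedHGFunCoeff a b) (1 : ℂ)
      simpa using! this
    rw [this]
    refine tsum_eq_sum fun n hn => ?_
    refine Complex.regularizedHGFunCoeff_eq_zero_left a b n N ?_ (by simpa using hn)
    simp only [ha, Multiset.insert_eq_cons, Multiset.mem_cons, Multiset.mem_singleton]
    exact Or.inr (Or.inr (Or.inl (by push_cast; ring)))
  rw [PDelta_succ_eq, hypergeometricF, hprod, hsum, Finset.mul_sum, Finset.mul_sum]
  exact Finset.sum_congr rfl fun n hn =>
    pCoeff_mul_eq_regularizedHGFunCoeff N s (by simpa [Nat.lt_succ_iff] using hn)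

open Polynomial in
lemma exists_polynomial_PDelta (N : ℕ) :
    ∃ p : ℂ[X], p.degree = ((2 * (N + 1) - 2 : ℕ) : WithBot ℕ) ∧
      ∀ s : ℂ, PDelta (N + 1) s = p.eval s := by
  set q : ℕ → ℂ[X] := fun n => C (pCoeff N n : ℂ) *
    ((ascPochhammer ℂ n).comp (C (2 * (N + 1 : ℕ) : ℂ) - X) * ascPochhammer ℂ n) with hq
  have hlin : (C (2 * (N + 1 : ℕ) : ℂ) - X : ℂ[X]).natDegree = 1 := by
    rw [natDegree_sub, natDegree_X_sub_C]
  have hdeg : ∀ n, (q n).degree ≤ ((2 * n : ℕ) : WithBot ℕ) := by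
    intro n
    refine degree_le_of_natDegree_le ((natDegree_C_mul_le _ _).trans
      (natDegree_mul_le.trans ?_))
    rw [natDegree_comp, hlin, ascPochhammer_natDegree]
    omega
  have htop : (q N).degree = ((2 * N : ℕ) : WithBot ℕ) := by
    have hc : (pCoeff N N : ℂ) ≠ 0 := by
      have : pCoeff N N ≠ 0 := by
        unfold pCoeff
        have h1 : ((-1 : ℝ)) ^ N ≠ 0 := by simp
        positivity
      exact_mod_cast this
    have hne : (ascPochhammer ℂ N).comp (C (2 * (N + 1 : ℕ) : ℂ) - X) ≠ 0 := by
      intro h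
      have hl := leadingCoeff_comp (p := ascPochhammer ℂ N) (by rw [hlin]; exact one_ne_zero)
      rw [h, (monic_ascPochhammer ℂ N).leadingCoeff, leadingCoeff_zero, one_mul] at hl
      refine pow_ne_zero _ (leadingCoeff_ne_zero.2 fun h0 => ?_) hl.symm
      rw [h0] at hlin; simp at hlin
    have hne2 : ascPochhammer ℂ N ≠ 0 := (monic_ascPochhammer ℂ N).ne_zero
    rw [hq]
    simp only
    rw [degree_C_mul hc, degree_eq_natDegree (mul_ne_zero hne hne2), natDegree_mul hne hne2,
      natDegree_comp, hlin, ascPochhammer_natDegree]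
    congr 1; ring
  refine ⟨∑ n ∈ Finset.range (N + 1), q n, ?_, fun s => ?_⟩
  · rw [Finset.sum_range_succ, show 2 * (N + 1) - 2 = 2 * N by omega, ← htop]
    refine degree_add_eq_right_of_degree_lt ?_
    rw [htop]
    refine (degree_sum_le _ _).trans_lt ((Finset.sup_lt_iff (WithBot.bot_lt_coe _)).2 fun n hn => ?_)
    refine (hdeg n).trans_lt ?_
    have := Finset.mem_range.1 hn
    exact_mod_cast (by omega : 2 * n < 2 * N)
  · rw [PDelta_succ_eq, eval_finsetSum]
    refine Finset.sum_congr rfl fun n _ => ?_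
    simp [hq, eval_comp]

lemma hasMellin_finsetSum {ι : Type*} {S : Finset ι} {F : ι → ℝ → ℂ} {s : ℂ}
    (h : ∀ i ∈ S, MellinConvergent (F i) s) :
    HasMellin (fun t => ∑ i ∈ S, F i t) s (∑ i ∈ S, mellin (F i) s) := by
  constructor
  · simp only [MellinConvergent, Finset.smul_sum]
    exact integrable_finsetSum _ h
  · simp only [mellin, Finset.smul_sum]
    exact integral_finsetSum _ h

lemma HasMellin.congr_Ioi {f g : ℝ → ℂ} {s m : ℂ} (h : HasMellin f s m)
    (hfg : ∀ t : ℝ, 0 < t → f t = g t) : HasMellin g s m := by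
  have e : ∀ t ∈ Set.Ioi (0 : ℝ), (t : ℂ) ^ (s - 1) • f t = (t : ℂ) ^ (s - 1) • g t :=
    fun t ht => by rw [hfg t ht]
  refine ⟨(integrableOn_congr_fun e measurableSet_Ioi).1 h.1, ?_⟩
  rw [← h.2]
  exact (setIntegral_congr_fun measurableSet_Ioi e).symm

lemma two_mul_cCoeff {k L : ℕ} (hk : k ≤ 2 * L) :
    2 * cCoeff k L = (2 * L).choose k + (if k = 0 then 1 else 0) +
      (if k = 2 * L then 1 else 0) := by
  have h1 : Real.Gamma (2 * L + 1) = (2 * L).factorial := by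
    simpa using Real.Gamma_nat_eq_factorial (2 * L)
  have h2 : Real.Gamma (2 * L - k + 1) = (2 * L - k).factorial := by
    rw [← Real.Gamma_nat_eq_factorial]; push_cast [hk]; ring_nf
  rw [cCoeff, h1, h2, Real.Gamma_nat_eq_factorial, Nat.cast_choose ℝ hk]
  ring

lemma sum_cCoeff_mul_inv_pow (L : ℕ) (t : ℝ) :
    ∑ k ∈ Finset.range (2 * L + 1), 2 * cCoeff k L * (t⁻¹) ^ k =
      (1 + t⁻¹) ^ (2 * L) + 1 + (t⁻¹) ^ (2 * L) := by
  rw [add_comm 1 t⁻¹, add_pow]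
  rw [Finset.sum_congr rfl fun k hk => by
    rw [two_mul_cCoeff (by simpa [Nat.lt_succ_iff] using hk), add_mul, add_mul],
    Finset.sum_add_distrib, Finset.sum_add_distrib]
  congr 1
  · congr 1
    · exact Finset.sum_congr rfl fun k _ => by ring
    · simp
  · simp

lemma contactCorrelator_eq_sum (Δ L : ℕ) {t : ℝ} (ht : 0 < t) :
    contactCorrelator Δ L (t / (1 + t)) = ∑ k ∈ Finset.range (2 * L + 1),
      2 * contactNorm Δ L * cCoeff k L * ((t⁻¹) ^ k *
        (Dbar ((Δ + L : ℕ) : ℝ) (t / (1 + t)) * (t / (1 + t)) ^ (2 * (Δ + L)))) := by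
  have h1 : 1 + t ≠ 0 := by positivity
  have e : ∑ k ∈ Finset.range (2 * L + 1), 2 * contactNorm Δ L * cCoeff k L * ((t⁻¹) ^ k *
        (Dbar ((Δ + L : ℕ) : ℝ) (t / (1 + t)) * (t / (1 + t)) ^ (2 * (Δ + L)))) =
      contactNorm Δ L * (Dbar ((Δ + L : ℕ) : ℝ) (t / (1 + t)) * (t / (1 + t)) ^ (2 * (Δ + L))) *
        ∑ k ∈ Finset.range (2 * L + 1), 2 * cCoeff k L * (t⁻¹) ^ k := by
    rw [Finset.mul_sum]
    exact Finset.sum_congr rfl fun k _ => by ring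
  have e2 : (t / (1 + t)) ^ (2 * L) * ((1 + t⁻¹) ^ (2 * L) + 1 + (t⁻¹) ^ (2 * L)) =
      1 + (t / (1 + t)) ^ (2 * L) + (1 - t / (1 + t)) ^ (2 * L) := by
    rw [mul_add, mul_add, ← mul_pow, ← mul_pow, mul_one,
      show t / (1 + t) * (1 + t⁻¹) = 1 by field_simp; ring,
      show t / (1 + t) * t⁻¹ = 1 - t / (1 + t) by field_simp; ring, one_pow]
  rw [e, sum_cCoeff_mul_inv_pow, contactCorrelator, ← e2, mul_add 2, pow_add]
  ring

lemma hasMellin_contactCorrelator (Δ L : ℕ) (hΔ : 0 < Δ) {s : ℂ} (h0 : 0 < s.re)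
    (h1 : s.re < 2 * Δ) :
    HasMellin (fun t : ℝ => ((contactCorrelator Δ L (t / (1 + t)) : ℝ) : ℂ)) (-s)
      (2 * contactNorm Δ L *
        ∑ k ∈ Finset.range (2 * L + 1), (cCoeff k L : ℂ) * Mhat (Δ + L) (s + k)) := by
  obtain ⟨M, hM⟩ : ∃ M, Δ + L = M + 1 := ⟨Δ + L - 1, by omega⟩
  set F : ℕ → ℝ → ℂ := fun k t => (2 * contactNorm Δ L * cCoeff k L : ℂ) •
    ((t : ℂ) ^ (-(k : ℂ)) • DbarIntegrand (Δ + L) t) with hF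
  have hconv : ∀ k ∈ Finset.range (2 * L + 1), MellinConvergent (F k) (-s) := by
    intro k hk
    refine MellinConvergent.const_smul (MellinConvergent.cpow_smul.2 ?_) _
    rw [show -s + -(k : ℂ) = -(s + k) by ring, hM]
    have hk' : (k : ℝ) ≤ 2 * L := by
      exact_mod_cast (by simpa [Nat.lt_succ_iff] using hk : k ≤ 2 * L)
    have hM' : (Δ : ℝ) + L = (M + 1 : ℕ) := by exact_mod_cast hM
    have hk0 : (0 : ℝ) ≤ k := Nat.cast_nonneg k
    refine mellinConvergent_DbarIntegrand M ?_ ?_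
    · rw [Complex.add_re, Complex.natCast_re]; linarith
    · rw [Complex.add_re, Complex.natCast_re, ← hM']; linarith
  have h := hasMellin_finsetSum hconv
  have hval : ∑ k ∈ Finset.range (2 * L + 1), mellin (F k) (-s) = 2 * contactNorm Δ L *
        ∑ k ∈ Finset.range (2 * L + 1), (cCoeff k L : ℂ) * Mhat (Δ + L) (s + k) := by
    rw [Finset.mul_sum]
    refine Finset.sum_congr rfl fun k _ => ?_
    rw [hF, mellin_const_smul, mellin_cpow_smul, Mhat, neg_add, smul_eq_mul, mul_assoc]
  rw [hval] at h
  refine h.congr_Ioi fun t ht => ?_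
  rw [contactCorrelator_eq_sum Δ L ht, Complex.ofReal_sum]
  refine Finset.sum_congr rfl fun k _ => ?_
  simp only [hF, DbarIntegrand, smul_eq_mul]
  rw [Complex.cpow_neg, Complex.cpow_natCast]
  push_cast
  ring

theorem mainTheorem4 (Δ : ℕ) (hΔ : 0 < Δ) :
    -- the Mellin integral converges in the strip and is given by the closed formula
    (∀ s : ℂ, 0 < s.re → s.re < 2 * Δ →
      MellinConvergent (DbarIntegrand Δ) (-s) ∧
        ((∀ m : ℤ, s ≠ m) → Mhat Δ s = MhatClosed Δ s)) ∧
    -- at the integers of the strip the singularities of the closed formula are removable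
    (∀ m ∈ Finset.Icc 1 (2 * Δ - 1),
      Tendsto (MhatClosed Δ) (𝓝[≠] (m : ℂ)) (𝓝 (Mhat Δ m))) ∧
    -- `P_Δ` is a terminating `₄F₃` and a polynomial of degree `2Δ - 2`
    (∀ s : ℂ, PDelta Δ s =
      2 * (Complex.Gamma Δ ^ 4 / Complex.Gamma (2 * Δ)) *
        hypergeometricF {1 / 2, s, 1 - (Δ : ℂ), 2 * Δ - s} {1, 1, (Δ : ℂ) + 1 / 2} 1) ∧
    (∃ p : Polynomial ℂ, p.degree = ((2 * Δ - 2 : ℕ) : WithBot ℕ) ∧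
      ∀ s : ℂ, PDelta Δ s = p.eval s) ∧
    -- the Mellin transform of the correlator with `4L` derivatives
    (∀ (L : ℕ) (s : ℂ), 0 < s.re → s.re < 2 * Δ →
      HasMellin (fun t : ℝ => ((contactCorrelator Δ L (t / (1 + t)) : ℝ) : ℂ)) (-s)
        (2 * contactNorm Δ L *
          ∑ k ∈ Finset.range (2 * L + 1), (cCoeff k L : ℂ) * Mhat (Δ + L) (s + k))) := by
  obtain ⟨N, rfl⟩ : ∃ N, Δ = N + 1 := ⟨Δ - 1, by omega⟩
  exact ⟨fun s h0 h1 => ⟨mellinConvergent_DbarIntegrand N h0 h1, Mhat_eq_MhatClosed N h0 h1⟩,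
    fun m hm => tendsto_MhatClosed N hm, PDelta_eq_hypergeometricF N, exists_polynomial_PDelta N,
    fun L s h0 h1 => hasMellin_contactCorrelator (N + 1) L hΔ h0 h1⟩
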